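/- Let $\mathcal G$ be a finite groupoid (composition written left to right: $\mathfrak{fg}$ means first $\mathfrak f$, then $\mathfrak g$; $\mathrm s,\mathrm t$ denote source and target) and let $\alpha$ be a normalised $\mathrm U(1)$-valued 3-cocycle of $\mathcal G$. For a 2-cochain put $(d\phi)(\mathfrak f,\mathfrak g,\mathfrak h)=\phi(\mathfrak g,\mathfrak h)\,\phi(\mathfrak f,\mathfrak g\mathfrak h)\,\phi(\mathfrak f\mathfrak g,\mathfrak h)^{-1}\phi(\mathfrak f,\mathfrak g)^{-1}$. Let $\mathsf{Vec}^\alpha_{\mathcal G}$ be the category of finite-dimensional complex vector spaces graded by the morphisms of $\mathcal G$, with tensor product $(V\otimes W)_{\mathfrak k}=\bigoplus_{\mathfrak f\mathfrak g=\mathfrak k}V_{\mathfrak f}\otimes W_{\mathfrak g}$, unit $\bigoplus_X\mathbb C_{\mathrm{id}_X}$, associator $(u_{\mathfrak f}\otimes v_{\mathfrak g})\otimes w_{\mathfrak h}\mapsto\alpha(\mathfrak f,\mathfrak g,\mathfrak h)\,u_{\mathfrak f}\otimes(v_{\mathfrak g}\otimes w_{\mathfrak h})$ and the evident unitors. A $(\mathcal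 G,\alpha)$-subgroupoid is a pair $(\mathcal A,\phi)$ of a subgroupoid $\mathcal A\subseteq\mathcal G$ (on any set of objects, possibly empty) and a normalised 2-cochain $\phi:\mathcal A\to\mathrm U(1)$ with $d\phi=\alpha^{-1}|_{\mathcal A}$. It defines an algebra object $\mathcal A_\phi=\bigoplus_{\mathfrak a\in\mathrm{Hom}(\mathcal A)}\mathbb C_{\mathfrak a}$ with multiplication $\mathfrak a\otimes\mathfrak a'\mapsto\phi(\mathfrak a,\mathfrak a')\,\mathfrak a\mathfrak a'$ and unit $\sum_{X\in\mathrm{Ob}(\mathcal A)}\mathrm{id}_X$. An algebra object $A$ with multiplication $m$ is separable if there is an $(A,A)$-bimodule map $\Delta:A\to A\otimes A$ with $m\circ\Delta=\mathrm{id}_A$. Then the following hold. **(1) Algebra objects.** (a) For every $(\mathcal G,\alpha)$-subgroupoid $(\mathcal A,\phi)$, the algebra $\mathcal A_\phi$ is separable, with section $$\Delta(\mathfrak a)=\frac1{|\mathrm{Hom}_{\mathcal A}(\mathrm s(\mathfrak a),-)|}\sum_{\substack{\mathfrak a_1,\mathfrak a_2\in\mathrm{Hom}(\mathcal A)\\ \mathfrak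 a_1\mathfrak a_2=\mathfrak a}}\frac1{\phi(\mathfrak a_1,\mathfrak a_2)}\,\mathfrak a_1\otimes\mathfrak a_2 .$$ (b) An algebra object $A$ of $\mathsf{Vec}^\alpha_{\mathcal G}$ is isomorphic to $\mathcal A_\phi$ for some $(\mathcal G,\alpha)$-subgroupoid $(\mathcal A,\phi)$ if and only if $A$ is separable and all its homogeneous components $A_{\mathfrak g}$ have dimension at most $1$. (c) $\mathcal A_\phi\cong\mathcal B_\psi$ as algebra objects if and only if $\mathcal A=\mathcal B$ and there is $\lambda:\mathrm{Hom}(\mathcal A)\to\mathrm U(1)$ with $\phi(\mathfrak a,\mathfrak a')\,\lambda(\mathfrak a\mathfrak a')=\psi(\mathfrak a,\mathfrak a')\,\lambda(\mathfrak a)\lambda(\mathfrak a')$ for all composable $\mathfrak a,\mathfrak a'$. **(2) Bimodule objects.** For $(\mathcal G,\alpha)$-subgroupoids $(\mathcal A,\phi)$, $(\mathcal B,\psi)$ let $\widetilde{\mathcal G}_{\mathcal{AB}}$ be the groupoid whose objects are the morphisms $\mathfrak g$ of $\mathcal G$ with $\mathrm s(\mathfrak g)\in\mathrm{Ob}(\mathcal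 A)$ and $\mathrm t(\mathfrak g)\in\mathrm{Ob}(\mathcal B)$, whose morphisms $\mathfrak g\to\mathfrak a\mathfrak g\mathfrak b$ are the pairs $(\mathfrak a,\mathfrak b)$ with $\mathfrak a\in\mathrm{Hom}_{\mathcal A}(-,\mathrm s(\mathfrak g))$ and $\mathfrak b\in\mathrm{Hom}_{\mathcal B}(\mathrm t(\mathfrak g),-)$, and in which $(\mathfrak a,\mathfrak b)$ followed by $(\mathfrak a',\mathfrak b')$ is $(\mathfrak a'\mathfrak a,\mathfrak b\mathfrak b')$. Then $$\varpi^{\mathcal{AB}}\big((\mathfrak a,\mathfrak b)_{\mathfrak g},(\mathfrak a',\mathfrak b')\big)=\frac{\alpha(\mathfrak a,\mathfrak g\mathfrak b,\mathfrak b')\,\alpha(\mathfrak g,\mathfrak b,\mathfrak b')}{\alpha(\mathfrak a',\mathfrak a,\mathfrak g\mathfrak b\mathfrak b')}\,\phi(\mathfrak a',\mathfrak a)\,\psi(\mathfrak b,\mathfrak b')$$ is a normalised 2-cocycle of $\widetilde{\mathcal G}_{\mathcal{AB}}$. Let $\mathbb C[\widetilde{\mathcal G}_{\mathcal{AB}}]^{\varpi^{\mathcal{AB}}}$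 be the twisted groupoid algebra, with basis $|f\rangle$ indexed by the morphisms and product $|f\rangle\star|f'\rangle=\varpi^{\mathcal{AB}}(f,f')\,|ff'\rangle$ for composable $f,f'$ and $0$ otherwise, and let $\mathsf{Mod}$ denote finite-dimensional right modules. There are equivalences of categories $$E_{\mathcal{AB}}:\mathsf{Bimod}_{\mathsf{Vec}^\alpha_{\mathcal G}}(\mathcal A_\phi,\mathcal B_\psi)\simeq\mathsf{Mod}\big(\mathbb C[\widetilde{\mathcal G}_{\mathcal{AB}}]^{\varpi^{\mathcal{AB}}}\big)$$ for which there is, naturally in $M$, a linear identification of $E_{\mathcal{AB}}(M)$ with $\bigoplus_{\mathfrak g}M_{\mathfrak g}$ such that $|(\mathfrak a,\mathfrak b)\rangle$ with source $\mathfrak g$ sends $v\in M_{\mathfrak g}$ to the image in $M_{\mathfrak a\mathfrak g\mathfrak b}$ of $\mathfrak a\otimes(v\otimes\mathfrak b)$ under the two-sided action $\mathcal A_\phi\otimes(M\otimes\mathcal B_\psi)\to M$ (act by $\mathcal B_\psi$ on the right, then by $\mathcal A_\phi$ on the left), and kills the other homogeneous components. **(3) Relative tensor products.** Let also $(\mathcal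 C,\varphi)$ be a $(\mathcal G,\alpha)$-subgroupoid. For an $(\mathcal A_\phi,\mathcal B_\psi)$-bimodule $M$ and a $(\mathcal B_\psi,\mathcal C_\varphi)$-bimodule $N$ let $P_{M,N}:\mathcal A_\phi\otimes((M\otimes N)\otimes\mathcal C_\varphi)\to M\otimes N$ be the morphism which (after re-association) inserts $\Delta\circ u:\mathbb 1\to\mathcal B_\psi\otimes\mathcal B_\psi$ between $M$ and $N$, where $u$ is the unit and $\Delta$ the section of $\mathcal B_\psi$ from (1a), and then applies the two-sided actions $\mathcal A_\phi\otimes(M\otimes\mathcal B_\psi)\to M$ and $\mathcal B_\psi\otimes(N\otimes\mathcal C_\varphi)\to N$. Let $e_{M,N}$ be the endomorphism of $M\otimes N$ obtained from $P_{M,N}$ by inserting the units of $\mathcal A_\phi$ and $\mathcal C_\varphi$. A relative tensor product $M\otimes_{\mathcal B}N$ is an $(\mathcal A_\phi,\mathcal C_\varphi)$-bimodule $T$ with morphisms $s:M\otimes N\to T$, $r:T\to M\otimes N$ of $\mathsf{Vec}^\alpha_{\mathcal G}$ such that $r\circ s=e_{M,N}$, $s\circ r=\mathrm{id}_T$, and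 the two-sided action of $T$ is $s\circ P_{M,N}\circ(\mathrm{id}\otimes(r\otimes\mathrm{id}))$. Define the linear map $\widetilde\Delta_{\mathcal B}:\mathbb C[\widetilde{\mathcal G}_{\mathcal{AC}}]^{\varpi^{\mathcal{AC}}}\to\mathbb C[\widetilde{\mathcal G}_{\mathcal{AB}}]^{\varpi^{\mathcal{AB}}}\otimes\mathbb C[\widetilde{\mathcal G}_{\mathcal{BC}}]^{\varpi^{\mathcal{BC}}}$, on the basis vector of $(\mathfrak a,\mathfrak c)$ with source $\mathfrak g$, by $$\widetilde\Delta_{\mathcal B}\big(|(\mathfrak a,\mathfrak c)_{\mathfrak g}\rangle\big)=\sum_{\substack{\mathfrak g_1\in\mathrm{Ob}(\widetilde{\mathcal G}_{\mathcal{AB}}),\ \mathfrak g_2\in\mathrm{Ob}(\widetilde{\mathcal G}_{\mathcal{BC}})\\ \mathfrak g_1\mathfrak g_2=\mathfrak g\\ \mathfrak b\in\mathrm{Hom}_{\mathcal B}(\mathrm t(\mathfrak g_1),-)}}\frac{1}{|\mathrm{Hom}_{\mathcal B}(\mathrm t(\mathfrak g_1),-)|}\,\frac{\alpha(\mathfrak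 g_1,\mathfrak g_2,\mathfrak c)\,\alpha(\mathfrak a,\mathfrak g_1,\mathfrak b)\,\alpha(\mathfrak a\mathfrak g_1\mathfrak b,\mathfrak b^{-1},\mathfrak g_2\mathfrak c)}{\psi(\mathfrak b,\mathfrak b^{-1})\,\alpha(\mathfrak a,\mathfrak g_1,\mathfrak g_2\mathfrak c)\,\alpha(\mathfrak a\mathfrak g_1,\mathfrak b,\mathfrak b^{-1})}\;|(\mathfrak a,\mathfrak b)_{\mathfrak g_1}\rangle\otimes|(\mathfrak b^{-1},\mathfrak c)_{\mathfrak g_2}\rangle .$$ Then: $\widetilde\Delta_{\mathcal B}$ is multiplicative (not necessarily unital); there is a bifunctor $\otimes_{\mathcal B}:\mathsf{Bimod}(\mathcal A_\phi,\mathcal B_\psi)\times\mathsf{Bimod}(\mathcal B_\psi,\mathcal C_\varphi)\to\mathsf{Bimod}(\mathcal A_\phi,\mathcal C_\varphi)$ with morphisms $s_{M,N},r_{M,N}$ making each $M\otimes_{\mathcal B}N$ a relative tensor product, and with $f\otimes_{\mathcal B}g=s\circ(f\otimes g)\circ r$ on morphisms; and for every relative tensor product $(T,s,r)$ of $M$ and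 $N$, the map $E_{\mathcal{AC}}(T)\to E_{\mathcal{AB}}(M)\otimes E_{\mathcal{BC}}(N)$ induced by $r$ through the identifications in (2) is injective, has as its image the image of the operator by which $\widetilde\Delta_{\mathcal B}(1)$ acts on $E_{\mathcal{AB}}(M)\otimes E_{\mathcal{BC}}(N)$, and intertwines the action of every $x\in\mathbb C[\widetilde{\mathcal G}_{\mathcal{AC}}]^{\varpi^{\mathcal{AC}}}$ with that of $\widetilde\Delta_{\mathcal B}(x)$. The equivalences and identifications in (2) can be chosen once and for all $(\mathcal A,\phi),(\mathcal B,\psi)$, and (3) holds for them. -/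

import Mathlib

open CategoryTheory MonoidalCategory
open scoped TensorProduct DirectSum

noncomputable section

namespace GroupoidGraded

/-! ### Groupoid cochains with values in `U(1)` (trivial action) -/

section Cochains

variable (𝒢 : Type) [Groupoid.{0} 𝒢]

/-- 1-cochains of a groupoid with values in `U(1)`. -/
abbrev Cochain₁ := ∀ ⦃X Y : 𝒢⦄, (X ⟶ Y) → Circle

/-- 2-cochains: functions on pairs of composable morphisms. -/
abbrev Cochain₂ := ∀ ⦃X Y Z : 𝒢⦄, (X ⟶ Y) → (Y ⟶ Z) → Circle

/-- 3-cochains: functions on triples of composable morphisms. -/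
abbrev Cochain₃ := ∀ ⦃W X Y Z : 𝒢⦄, (W ⟶ X) → (X ⟶ Y) → (Y ⟶ Z) → Circle

variable {𝒢}

/-- The coboundary of a 1-cochain. -/
def d₁ (l : Cochain₁ 𝒢) : Cochain₂ 𝒢 := fun _ _ _ f g =>
  l g * l f * (l (f ≫ g))⁻¹

/-- The coboundary of a 2-cochain. -/
def d₂ (φ : Cochain₂ 𝒢) : Cochain₃ 𝒢 := fun _ _ _ _ f g h =>
  φ g h * (φ f g)⁻¹ * (φ (f ≫ g) h)⁻¹ * φ f (g ≫ h)

/-- The coboundary of a 3-cochain, evaluated on four composable morphisms. -/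
def d₃ (α : Cochain₃ 𝒢) {V W X Y Z : 𝒢} (f : V ⟶ W) (g : W ⟶ X) (h : X ⟶ Y) (k : Y ⟶ Z) :
    Circle :=
  α g h k * α f g h * (α (f ≫ g) h k)⁻¹ * α f (g ≫ h) k * (α f g (h ≫ k))⁻¹

/-- A 2-cochain is normalised if it is `1` whenever one of its arguments is an identity. -/
structure IsNormalised₂ (φ : Cochain₂ 𝒢) : Prop where
  id_left : ∀ {X Y : 𝒢} (f : X ⟶ Y), φ (𝟙 X) f = 1
  id_right : ∀ {X Y : 𝒢} (f : X ⟶ Y), φ f (𝟙 Y) = 1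

variable (𝒢)

/-- Normalised 2-cocycles. -/
structure Cocycle₂ where
  toFun : Cochain₂ 𝒢
  normalised : IsNormalised₂ toFun
  cocycle : ∀ {W X Y Z : 𝒢} (f : W ⟶ X) (g : X ⟶ Y) (h : Y ⟶ Z), d₂ toFun f g h = 1

/-- Normalised 3-cocycles. -/
structure Cocycle₃ where
  toFun : Cochain₃ 𝒢
  id_left : ∀ {X Y Z : 𝒢} (f : X ⟶ Y) (g : Y ⟶ Z), toFun (𝟙 X) f g = 1
  id_mid : ∀ {X Y Z : 𝒢} (f : X ⟶ Y) (g : Y ⟶ Z), toFun f (𝟙 Y) g = 1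
  id_right : ∀ {X Y Z : 𝒢} (f : X ⟶ Y) (g : Y ⟶ Z), toFun f g (𝟙 Z) = 1
  cocycle : ∀ {V W X Y Z : 𝒢} (f : V ⟶ W) (g : W ⟶ X) (h : X ⟶ Y) (k : Y ⟶ Z),
    d₃ toFun f g h k = 1

end Cochains

/-- The predicate of being an identity morphism. -/
inductive IsIdentity {𝒢 : Type} [Groupoid.{0} 𝒢] : ∀ ⦃X Y : 𝒢⦄, (X ⟶ Y) → Prop
  | id (X : 𝒢) : IsIdentity (𝟙 X)

/-- A factorisation `k = fst ≫ snd` of a morphism. -/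
structure Fac {G : Type} [Groupoid.{0} G] {X Z : G} (k : X ⟶ Z) where
  mid : G
  fst : X ⟶ mid
  snd : mid ⟶ Z
  comp : fst ≫ snd = k

instance {G : Type} [Groupoid.{0} G] [Fintype G] [∀ X Y : G, Fintype (X ⟶ Y)]
    {X Z : G} (k : X ⟶ Z) : Finite (Fac k) :=
  Finite.of_injective
    (fun p : Fac k => (⟨p.mid, p.fst, p.snd⟩ : Σ Y : G, (X ⟶ Y) × (Y ⟶ Z)))
    (by rintro ⟨Y, f, g, h⟩ ⟨Y', f', g', h'⟩ e; simp only [Sigma.mk.injEq] at e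
        obtain ⟨rfl, e⟩ := e
        simp only [heq_eq_eq, Prod.mk.injEq] at e
        obtain ⟨rfl, rfl⟩ := e
        rfl)

instance {G : Type} [Groupoid.{0} G] {X Z : G} (k : X ⟶ Z) : DecidableEq (Fac k) :=
  Classical.decEq _

instance {G : Type} [Groupoid.{0} G] [Fintype G] [∀ X Y : G, Fintype (X ⟶ Y)]
    {X Z : G} (k : X ⟶ Z) : Fintype (Fac k) := Fintype.ofFinite _

/-! ### The monoidal category of `G`-graded vector spaces, twisted by `α` -/

variable {G : Type} [Groupoid.{0} G]

/-- Finite-dimensional complex vector spaces graded by the morphisms of `G`. The cocycle `α`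
only enters the associator. -/
structure GrVec (α : Cocycle₃ G) where
  deg : ∀ ⦃X Y : G⦄, (X ⟶ Y) → FGModuleCat.{0} ℂ

namespace GrVec

variable {α : Cocycle₃ G}

/-- Grading-preserving linear maps. -/
@[ext]
structure Hom (V W : GrVec α) where
  app : ∀ ⦃X Y : G⦄ (g : X ⟶ Y), V.deg g →ₗ[ℂ] W.deg g

instance : Category (GrVec α) where
  Hom V W := Hom V W
  id V := ⟨fun _ _ _ => LinearMap.id⟩
  comp f g := ⟨fun _ _ k => g.app k ∘ₗ f.app k⟩

@[ext]
theorem hom_ext {V W : GrVec α} {f g : V ⟶ W}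
    (h : ∀ ⦃X Y : G⦄ (k : X ⟶ Y), f.app k = g.app k) : f = g :=
  Hom.ext (by funext X Y k; exact h k)

@[simp] theorem id_app (V : GrVec α) {X Y : G} (k : X ⟶ Y) :
    Hom.app (𝟙 V) k = LinearMap.id := rfl

@[simp] theorem comp_app {U V W : GrVec α} (f : U ⟶ V) (g : V ⟶ W) {X Y : G} (k : X ⟶ Y) :
    (f ≫ g).app k = g.app k ∘ₗ f.app k := rfl

/-- Build an isomorphism from mutually inverse families. -/
@[simps] def isoMk {V W : GrVec α} (e : ∀ ⦃X Y : G⦄ (k : X ⟶ Y), V.deg k ≃ₗ[ℂ] W.deg k) :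
    V ≅ W where
  hom := ⟨fun _ _ k => (e k).toLinearMap⟩
  inv := ⟨fun _ _ k => (e k).symm.toLinearMap⟩
  hom_inv_id := by ext; simp
  inv_hom_id := by ext; simp

section Tensor

variable [Fintype G] [∀ X Y : G, Fintype (X ⟶ Y)]

/-- `(V ⊗ W)_k` is the direct sum of all `V_g ⊗ W_h` with `gh = k`. -/
def tensor (V W : GrVec α) : GrVec α where
  deg _ _ k := FGModuleCat.of ℂ (⨁ p : Fac k, (V.deg p.fst ⊗[ℂ] W.deg p.snd))

/-- The vector `v ⊗ w` in degree `k = fg`. -/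
def tm {V W : GrVec α} {X Y Z : G} (f : X ⟶ Y) (g : Y ⟶ Z) {k : X ⟶ Z} (e : f ≫ g = k)
    (v : V.deg f) (w : W.deg g) : (tensor V W).deg k :=
  DirectSum.lof ℂ (Fac k) (fun p => V.deg p.fst ⊗[ℂ] W.deg p.snd) ⟨Y, f, g, e⟩ (v ⊗ₜ w)

theorem tensor_ext {V W : GrVec α} {X Z : G} {k : X ⟶ Z} {M : Type} [AddCommGroup M]
    [Module ℂ M] {F F' : (tensor V W).deg k →ₗ[ℂ] M}
    (h : ∀ {Y : G} (f : X ⟶ Y) (g : Y ⟶ Z) (e : f ≫ g = k) (v : V.deg f) (w : W.deg g),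
      F (tm f g e v w) = F' (tm f g e v w)) : F = F' := by
  refine DirectSum.linearMap_ext ℂ fun p => TensorProduct.ext' fun v w => ?_
  exact h p.fst p.snd p.comp v w

/-- Linear maps out of `(V ⊗ W)_k` from bilinear maps out of the `V_f × W_g`. -/
def tlift {V W : GrVec α} {X Z : G} {k : X ⟶ Z} {M : Type} [AddCommGroup M] [Module ℂ M]
    (b : ∀ p : Fac k, V.deg p.fst →ₗ[ℂ] W.deg p.snd →ₗ[ℂ] M) :
    (tensor V W).deg k →ₗ[ℂ] M :=
  DirectSum.toModule ℂ (Fac k) M fun p => TensorProduct.lift (b p)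

@[simp] theorem tlift_tm {V W : GrVec α} {X Z : G} {k : X ⟶ Z} {M : Type} [AddCommGroup M]
    [Module ℂ M] (b : ∀ p : Fac k, V.deg p.fst →ₗ[ℂ] W.deg p.snd →ₗ[ℂ] M)
    {Y : G} (f : X ⟶ Y) (g : Y ⟶ Z) (e : f ≫ g = k) (v : V.deg f) (w : W.deg g) :
    tlift b (tm f g e v w) = b ⟨Y, f, g, e⟩ v w := by
  unfold tlift tm
  erw [DirectSum.toModule_lof]
  exact TensorProduct.lift.tmul _ _

/-- `tm` as a bilinear map. -/
def tmL {V W : GrVec α} {X Y Z : G} (f : X ⟶ Y) (g : Y ⟶ Z) {k : X ⟶ Z} (e : f ≫ g = k) :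
    V.deg f →ₗ[ℂ] W.deg g →ₗ[ℂ] (tensor V W).deg k :=
  LinearMap.compr₂ (TensorProduct.mk ℂ _ _)
    (DirectSum.lof ℂ (Fac k) (fun p => V.deg p.fst ⊗[ℂ] W.deg p.snd) ⟨Y, f, g, e⟩)

@[simp] theorem tmL_apply {V W : GrVec α} {X Y Z : G} (f : X ⟶ Y) (g : Y ⟶ Z) {k : X ⟶ Z}
    (e : f ≫ g = k) (v : V.deg f) (w : W.deg g) : tmL f g e v w = tm f g e v w := rfl

theorem tm_smul_left {V W : GrVec α} {X Y Z : G} (f : X ⟶ Y) (g : Y ⟶ Z) {k : X ⟶ Z}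
    (e : f ≫ g = k) (c : ℂ) (v : V.deg f) (w : W.deg g) :
    tm f g e (c • v) w = c • tm f g e v w := by
  simp only [← tmL_apply, map_smul, LinearMap.smul_apply]

theorem tm_smul_right {V W : GrVec α} {X Y Z : G} (f : X ⟶ Y) (g : Y ⟶ Z) {k : X ⟶ Z}
    (e : f ≫ g = k) (c : ℂ) (v : V.deg f) (w : W.deg g) :
    tm f g e v (c • w) = c • tm f g e v w := by
  simp only [← tmL_apply, map_smul]

/-- The tensor product of two grading-preserving maps. -/
def tensorMap {V V' W W' : GrVec α} (f : V ⟶ V') (g : W ⟶ W') : tensor V W ⟶ tensor V' W' where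
  app _ _ _ := tlift fun p => (tmL p.fst p.snd p.comp).compl₁₂ (f.app p.fst) (g.app p.snd)

@[simp] theorem tensorMap_tm {V V' W W' : GrVec α} (f : V ⟶ V') (g : W ⟶ W') {X Y Z : G}
    (a : X ⟶ Y) (b : Y ⟶ Z) {k : X ⟶ Z} (e : a ≫ b = k) (v : V.deg a) (w : W.deg b) :
    (tensorMap f g).app k (tm a b e v w) = tm a b e (f.app a v) (g.app b w) := by
  simp [tensorMap]

theorem tm_congr {U V W : GrVec α} {X Y Z T : G} {k : X ⟶ T} (f : X ⟶ Y) (g : Y ⟶ Z) (h : Z ⟶ T)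
    {m m' : Y ⟶ T} (e : g ≫ h = m) (e' : g ≫ h = m') (w : f ≫ m = k) (w' : f ≫ m' = k)
    (u : U.deg f) (v : V.deg g) (x : W.deg h) :
    tm (W := tensor V W) f m w u (tm g h e v x) = tm f m' w' u (tm g h e' v x) := by
  subst e; subst e'; rfl

theorem tm_congr' {U V W : GrVec α} {X Y Z T : G} {k : X ⟶ T} (f : X ⟶ Y) (g : Y ⟶ Z) (h : Z ⟶ T)
    {m m' : X ⟶ Z} (e : f ≫ g = m) (e' : f ≫ g = m') (w : m ≫ h = k) (w' : m' ≫ h = k)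
    (u : U.deg f) (v : V.deg g) (x : W.deg h) :
    tm (V := tensor U V) m h w (tm f g e u v) x = tm m' h w' (tm f g e' u v) x := by
  subst e; subst e'; rfl

/-- The associator `(u ⊗ v) ⊗ w ↦ α(f,g,h) · u ⊗ (v ⊗ w)` in degrees `f, g, h`. -/
def assocFwd (U V W : GrVec α) {X T : G} (k : X ⟶ T) :
    (tensor (tensor U V) W).deg k →ₗ[ℂ] (tensor U (tensor V W)).deg k :=
  tlift fun p => tlift fun q => (α.toFun q.fst q.snd p.snd : ℂ) •
    (LinearMap.llcomp ℂ _ _ _).compl₁₂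
      (tmL (W := tensor V W) q.fst (q.snd ≫ p.snd)
        (by rw [← Category.assoc, q.comp, p.comp]) :
          U.deg q.fst →ₗ[ℂ] (tensor V W).deg (q.snd ≫ p.snd) →ₗ[ℂ] (tensor U (tensor V W)).deg k)
      (tmL q.snd p.snd rfl)

theorem assocFwd_tm {U V W : GrVec α} {X Y Z T : G} {k : X ⟶ T} (f : X ⟶ Y) (g : Y ⟶ Z)
    (h : Z ⟶ T) {l : X ⟶ Z} {m : Y ⟶ T} (e : f ≫ g = l) (e' : l ≫ h = k) (e₁ : g ≫ h = m)
    (e₂ : f ≫ m = k) (u : U.deg f) (v : V.deg g) (w : W.deg h) :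
    assocFwd U V W k (tm (V := tensor U V) l h e' (tm f g e u v) w) =
      (α.toFun f g h : ℂ) • tm (W := tensor V W) f m e₂ u (tm g h e₁ v w) := by
  subst e; subst e₁
  simp [assocFwd]

/-- The inverse associator. -/
def assocBwd (U V W : GrVec α) {X T : G} (k : X ⟶ T) :
    (tensor U (tensor V W)).deg k →ₗ[ℂ] (tensor (tensor U V) W).deg k :=
  tlift fun p => LinearMap.flip <| tlift fun q => (((α.toFun p.fst q.fst q.snd)⁻¹ : Circle) : ℂ) •
    (LinearMap.llcomp ℂ _ _ _).flip.compl₁₂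
      (tmL p.fst q.fst rfl).flip
      (tmL (V := tensor U V) (p.fst ≫ q.fst) q.snd
        (by rw [Category.assoc, q.comp, p.comp]) :
          (tensor U V).deg (p.fst ≫ q.fst) →ₗ[ℂ] W.deg q.snd →ₗ[ℂ]
            (tensor (tensor U V) W).deg k).flip

theorem assocBwd_tm {U V W : GrVec α} {X Y Z T : G} {k : X ⟶ T} (f : X ⟶ Y) (g : Y ⟶ Z)
    (h : Z ⟶ T) {l : X ⟶ Z} {m : Y ⟶ T} (e : f ≫ g = l) (e' : l ≫ h = k) (e₁ : g ≫ h = m)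
    (e₂ : f ≫ m = k) (u : U.deg f) (v : V.deg g) (w : W.deg h) :
    assocBwd U V W k (tm (W := tensor V W) f m e₂ u (tm g h e₁ v w)) =
      (((α.toFun f g h)⁻¹ : Circle) : ℂ) • tm (V := tensor U V) l h e' (tm f g e u v) w := by
  subst e; subst e₁
  simp [assocBwd]

theorem tensor_ext₃ {U V W : GrVec α} {X T : G} {k : X ⟶ T} {M : Type} [AddCommGroup M]
    [Module ℂ M] {F F' : (tensor (tensor U V) W).deg k →ₗ[ℂ] M}
    (H : ∀ {Y Z : G} (f : X ⟶ Y) (g : Y ⟶ Z) (h : Z ⟶ T) (l : X ⟶ Z) (e : f ≫ g = l)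
      (e' : l ≫ h = k) (u : U.deg f) (v : V.deg g) (w : W.deg h),
      F (tm (V := tensor U V) l h e' (tm f g e u v) w) = F' (tm l h e' (tm f g e u v) w)) :
    F = F' := by
  apply tensor_ext
  intro Z l h e' t w
  have : F ∘ₗ (tmL (V := tensor U V) l h e').flip w = F' ∘ₗ (tmL l h e').flip w := by
    apply tensor_ext
    intro Y f g e u v
    exact H f g h l e e' u v w
  exact LinearMap.congr_fun this t

theorem tensor_ext₃' {U V W : GrVec α} {X T : G} {k : X ⟶ T} {M : Type} [AddCommGroup M]
    [Module ℂ M] {F F' : (tensor U (tensor V W)).deg k →ₗ[ℂ] M}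
    (H : ∀ {Y Z : G} (f : X ⟶ Y) (g : Y ⟶ Z) (h : Z ⟶ T) (m : Y ⟶ T) (e : g ≫ h = m)
      (e' : f ≫ m = k) (u : U.deg f) (v : V.deg g) (w : W.deg h),
      F (tm (W := tensor V W) f m e' u (tm g h e v w)) = F' (tm f m e' u (tm g h e v w))) :
    F = F' := by
  apply tensor_ext
  intro Y f m e' u t
  have : F ∘ₗ tmL (W := tensor V W) f m e' u = F' ∘ₗ tmL f m e' u := by
    apply tensor_ext
    intro Z g h e v w
    exact H f g h m e e' u v w
  exact LinearMap.congr_fun this t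

theorem circle_inv_mul (z : Circle) : ((z⁻¹ : Circle) : ℂ) * (z : ℂ) = 1 := by
  rw [← Circle.coe_mul, inv_mul_cancel, Circle.coe_one]

theorem circle_mul_inv (z : Circle) : (z : ℂ) * ((z⁻¹ : Circle) : ℂ) = 1 := by
  rw [← Circle.coe_mul, mul_inv_cancel, Circle.coe_one]

/-- The associator of `Vec_G^α`. -/
def assoc (U V W : GrVec α) : tensor (tensor U V) W ≅ tensor U (tensor V W) :=
  isoMk fun _ _ k => LinearEquiv.ofLinearMap (assocFwd U V W k) (assocBwd U V W k)
    (by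
      apply tensor_ext₃'
      intro Y Z f g h m e e' u v w
      simp only [LinearMap.comp_apply, LinearMap.id_apply]
      rw [assocBwd_tm f g h rfl (by rw [Category.assoc, e, e']) e e', map_smul,
        assocFwd_tm f g h rfl _ e e', smul_smul]
      rw [circle_inv_mul, one_smul])
    (by
      apply tensor_ext₃
      intro Y Z f g h l e e' u v w
      simp only [LinearMap.comp_apply, LinearMap.id_apply]
      rw [assocFwd_tm f g h e e' rfl (by rw [← Category.assoc, e, e']), map_smul,
        assocBwd_tm f g h e e' rfl, smul_smul]
      rw [circle_mul_inv, one_smul])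

/-- The subspace of `ℂ` which is `ℂ` if `P` holds and `0` otherwise. -/
def line (P : Prop) : Submodule ℂ ℂ where
  carrier := {c | c ≠ 0 → P}
  zero_mem' h := absurd rfl h
  add_mem' {a b} ha hb h := by
    by_cases h0 : a = 0
    · exact hb (by simpa [h0] using h)
    · exact ha h0
  smul_mem' c x hx h := hx (right_ne_zero_of_mul h)

/-- The basis vector of `line P`. -/
def line.one {P : Prop} (h : P) : line P := ⟨1, fun _ => h⟩

/-- The map `c ↦ z c` between lines. -/
def line.scale {P Q : Prop} (z : ℂ) (h : z ≠ 0 → Q) : line P →ₗ[ℂ] line Q where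
  toFun c := ⟨z * c.1, fun hz => h (left_ne_zero_of_mul hz)⟩
  map_add' c d := Subtype.ext (mul_add z c.1 d.1)
  map_smul' w c := Subtype.ext (mul_left_comm z w c.1)

/-- The map `c ⊗ d ↦ z c d` between lines. -/
def line.mul {P Q R : Prop} (z : ℂ) (h : z ≠ 0 → R) : line P →ₗ[ℂ] line Q →ₗ[ℂ] line R :=
  LinearMap.mk₂ ℂ (fun c d => ⟨z * (c.1 * d.1), fun hz => h (left_ne_zero_of_mul hz)⟩)
    (fun c c' d => Subtype.ext (by simp; ring))
    (fun w c d => Subtype.ext (by simp; ring))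
    (fun c d d' => Subtype.ext (by simp; ring))
    (fun w c d => Subtype.ext (by simp; ring))

theorem one_tmul_injective {P : Prop} (h : P) {M : Type} [AddCommGroup M] [Module ℂ M]
    {v w : M} (e : line.one h ⊗ₜ[ℂ] v = line.one h ⊗ₜ[ℂ] w) : v = w := by
  have := congrArg (fun t => TensorProduct.lid ℂ M (LinearMap.rTensor M (line P).subtype t)) e
  simpa [line.one] using this

theorem tmul_one_injective {P : Prop} (h : P) {M : Type} [AddCommGroup M] [Module ℂ M]
    {v w : M} (e : v ⊗ₜ[ℂ] line.one h = w ⊗ₜ[ℂ] line.one h) : v = w := by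
  have := congrArg (fun t => TensorProduct.rid ℂ M (LinearMap.lTensor M (line P).subtype t)) e
  simpa [line.one] using this

/-- The graded vector space `⨁_{g ∈ S} ℂ_g` for a set `S` of morphisms: its component in degree
`g` is `ℂ` if `g ∈ S` and `0` otherwise. -/
def span (α : Cocycle₃ G) (S : ∀ ⦃X Y : G⦄, (X ⟶ Y) → Prop) : GrVec α where
  deg _ _ g := FGModuleCat.of ℂ (line (S g))

/-- The tensor unit `⨁_X ℂ_{id_X}`. -/
def unit (α : Cocycle₃ G) : GrVec α := span α IsIdentity

/-- The basis vector of the unit in degree `id_X`. -/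
def unitVec (α : Cocycle₃ G) (X : G) : (unit α).deg (𝟙 X) := line.one (IsIdentity.id X)

theorem unit_eq_smul {X : G} (c : (unit α).deg (𝟙 X)) :
    c = (show line _ from c).1 • unitVec α X :=
  Subtype.ext (mul_one _).symm

theorem unit_eq_zero {X Y : G} {g : X ⟶ Y} (h : ¬ IsIdentity g) (c : (unit α).deg g) : c = 0 :=
  Subtype.ext (by by_contra h0; exact h ((show line _ from c).2 h0))

/-- `v ↦ 1 ⊗ v`. -/
def leftUnitInv (V : GrVec α) {X Y : G} (k : X ⟶ Y) : V.deg k →ₗ[ℂ] (tensor (unit α) V).deg k :=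
  tmL (V := unit α) (𝟙 X) k (Category.id_comp k) (unitVec α X)

/-- `v ↦ v ⊗ 1`. -/
def rightUnitInv (V : GrVec α) {X Y : G} (k : X ⟶ Y) : V.deg k →ₗ[ℂ] (tensor V (unit α)).deg k :=
  (tmL (W := unit α) k (𝟙 Y) (Category.comp_id k)).flip (unitVec α Y)

theorem leftUnitInv_bijective (V : GrVec α) {X Y : G} (k : X ⟶ Y) :
    Function.Bijective (leftUnitInv V k) := by
  constructor
  · have hc : ∀ v, DirectSum.component ℂ (Fac k)
        (fun p => (unit α).deg p.fst ⊗[ℂ] V.deg p.snd) ⟨X, 𝟙 X, k, Category.id_comp k⟩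
        (leftUnitInv V k v) = unitVec α X ⊗ₜ[ℂ] v := fun v =>
      DirectSum.component.lof_self ..
    intro v w h
    have h1 := (hc v).symm.trans ((congrArg (DirectSum.component ℂ (Fac k) _ _) h).trans (hc w))
    exact one_tmul_injective _ h1
  · rw [← LinearMap.range_eq_top, eq_top_iff]
    have key : (LinearMap.range (leftUnitInv V k)).mkQ = 0 := by
      apply tensor_ext
      intro Y f g e c v
      rw [LinearMap.zero_apply, Submodule.mkQ_apply, Submodule.Quotient.mk_eq_zero]
      by_cases hf : IsIdentity f
      · cases hf
        obtain rfl : g = k := by rw [← e, Category.id_comp]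
        refine ⟨(show line _ from c).1 • v, ?_⟩
        rw [map_smul, unit_eq_smul c]
        erw [tm_smul_left]
        rw [← unit_eq_smul c]
        rfl
      · rw [unit_eq_zero hf c, ← tmL_apply, map_zero, LinearMap.zero_apply]
        exact zero_mem _
    intro t _
    have := LinearMap.congr_fun key t
    rwa [LinearMap.zero_apply, Submodule.mkQ_apply, Submodule.Quotient.mk_eq_zero] at this

theorem rightUnitInv_bijective (V : GrVec α) {X Y : G} (k : X ⟶ Y) :
    Function.Bijective (rightUnitInv V k) := by
  constructor
  · have hc : ∀ v, DirectSum.component ℂ (Fac k)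
        (fun p => V.deg p.fst ⊗[ℂ] (unit α).deg p.snd) ⟨Y, k, 𝟙 Y, Category.comp_id k⟩
        (rightUnitInv V k v) = v ⊗ₜ[ℂ] unitVec α Y := fun v =>
      DirectSum.component.lof_self ..
    intro v w h
    have h1 := (hc v).symm.trans ((congrArg (DirectSum.component ℂ (Fac k) _ _) h).trans (hc w))
    exact tmul_one_injective _ h1
  · rw [← LinearMap.range_eq_top, eq_top_iff]
    have key : (LinearMap.range (rightUnitInv V k)).mkQ = 0 := by
      apply tensor_ext
      intro Y f g e v c
      rw [LinearMap.zero_apply, Submodule.mkQ_apply, Submodule.Quotient.mk_eq_zero]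
      by_cases hg : IsIdentity g
      · cases hg
        obtain rfl : f = k := by rw [← e, Category.comp_id]
        refine ⟨(show line _ from c).1 • v, ?_⟩
        rw [map_smul, unit_eq_smul c]
        erw [tm_smul_right]
        rw [← unit_eq_smul c]
        rfl
      · rw [unit_eq_zero hg c, ← tmL_apply, map_zero]
        exact zero_mem _
    intro t _
    have := LinearMap.congr_fun key t
    rwa [LinearMap.zero_apply, Submodule.mkQ_apply, Submodule.Quotient.mk_eq_zero] at this

/-- The left unitor, inverse to `v ↦ 1 ⊗ v`. -/
def leftUnitor (V : GrVec α) : tensor (unit α) V ≅ V :=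
  (isoMk fun _ _ k => LinearEquiv.ofBijective (leftUnitInv V k) (leftUnitInv_bijective V k)).symm

/-- The right unitor, inverse to `v ↦ v ⊗ 1`. -/
def rightUnitor (V : GrVec α) : tensor V (unit α) ≅ V :=
  (isoMk fun _ _ k => LinearEquiv.ofBijective (rightUnitInv V k) (rightUnitInv_bijective V k)).symm

theorem leftUnitor_inv_app (V : GrVec α) {X Y : G} (k : X ⟶ Y) (v : V.deg k) :
    (leftUnitor V).inv.app k v =
      tm (V := unit α) (𝟙 X) k (Category.id_comp k) (unitVec α X) v := rfl

theorem rightUnitor_inv_app (V : GrVec α) {X Y : G} (k : X ⟶ Y) (v : V.deg k) :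
    (rightUnitor V).inv.app k v =
      tm (W := unit α) k (𝟙 Y) (Category.comp_id k) v (unitVec α Y) := rfl

@[simps] instance : MonoidalCategoryStruct (GrVec α) where
  tensorObj := tensor
  whiskerLeft V _ _ f := tensorMap (𝟙 V) f
  whiskerRight f W := tensorMap f (𝟙 W)
  tensorHom := tensorMap
  tensorUnit := unit α
  associator := assoc
  leftUnitor := leftUnitor
  rightUnitor := rightUnitor

theorem assoc_hom_tm {U V W : GrVec α} {X Y Z T : G} {k : X ⟶ T} (f : X ⟶ Y) (g : Y ⟶ Z)
    (h : Z ⟶ T) {l : X ⟶ Z} {m : Y ⟶ T} (e : f ≫ g = l) (e' : l ≫ h = k) (e₁ : g ≫ h = m)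
    (e₂ : f ≫ m = k) (u : U.deg f) (v : V.deg g) (w : W.deg h) :
    (assoc U V W).hom.app k (tm (V := tensor U V) l h e' (tm f g e u v) w) =
      (α.toFun f g h : ℂ) • tm (W := tensor V W) f m e₂ u (tm g h e₁ v w) :=
  assocFwd_tm f g h e e' e₁ e₂ u v w

theorem tensorMap_comp {V V' V'' W W' W'' : GrVec α} (f : V ⟶ V') (g : W ⟶ W') (f' : V' ⟶ V'')
    (g' : W' ⟶ W'') : tensorMap f g ≫ tensorMap f' g' = tensorMap (f ≫ f') (g ≫ g') := by
  apply hom_ext; intro X Z k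
  apply tensor_ext
  intro Y a b e v w
  simp

theorem tensorMap_id (V W : GrVec α) : tensorMap (𝟙 V) (𝟙 W) = 𝟙 (tensor V W) := by
  apply hom_ext; intro X Z k
  apply tensor_ext
  intro Y a b e v w
  simp

theorem pentagon_coeff (α : Cocycle₃ G) {V W X Y Z : G} (f : V ⟶ W) (g : W ⟶ X) (h : X ⟶ Y)
    (k : Y ⟶ Z) : (α.toFun f g h : ℂ) * α.toFun f (g ≫ h) k * α.toFun g h k =
      α.toFun (f ≫ g) h k * α.toFun f g (h ≫ k) := by
  have h := α.cocycle f g h k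
  unfold d₃ at h
  rw [mul_inv_eq_one] at h
  simp only [← Circle.coe_mul]
  rw [← h, Circle.coe_inj]
  set x := α.toFun (f ≫ g) _ k
  rw [← mul_one (α.toFun f g _ * _ * _), ← mul_inv_cancel x]
  ac_rfl

theorem assoc_naturality {U V W U' V' W' : GrVec α} (f : U ⟶ U') (g : V ⟶ V') (h : W ⟶ W') :
    tensorMap (tensorMap f g) h ≫ (assoc U' V' W').hom =
      (assoc U V W).hom ≫ tensorMap f (tensorMap g h) := by
  apply hom_ext; intro X T k
  apply tensor_ext₃
  intro Y Z a b c l e e' u v w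
  have e₂ : a ≫ b ≫ c = k := by rw [← Category.assoc, e, e']
  simp only [comp_app, LinearMap.comp_apply]
  rw [assoc_hom_tm a b c e e' rfl e₂, map_smul]
  simp only [tensorMap_tm]
  rw [assoc_hom_tm a b c e e' rfl e₂]

theorem pentagon_aux (U V W X : GrVec α) :
    tensorMap (assoc U V W).hom (𝟙 X) ≫ (assoc U (tensor V W) X).hom ≫
        tensorMap (𝟙 U) (assoc V W X).hom =
      (assoc (tensor U V) W X).hom ≫ (assoc U V (tensor W X)).hom := by
  apply hom_ext; intro A E k
  apply tensor_ext
  intro D l d e t x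
  suffices H : ((tensorMap (assoc U V W).hom (𝟙 X) ≫ (assoc U (tensor V W) X).hom ≫
        tensorMap (𝟙 U) (assoc V W X).hom).app k) ∘ₗ
          (tmL (V := tensor (tensor U V) W) l d e).flip x =
      ((assoc (tensor U V) W X).hom ≫ (assoc U V (tensor W X)).hom).app k ∘ₗ
          (tmL (V := tensor (tensor U V) W) l d e).flip x from LinearMap.congr_fun H t
  apply tensor_ext₃
  intro B C a b c m e₁ e₂ u v w
  have e₃ : a ≫ b ≫ c = l := by rw [← Category.assoc, e₁, e₂]
  have e₄ : a ≫ (b ≫ c) ≫ d = k := by rw [← Category.assoc, e₃, e]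
  have e₅ : m ≫ c ≫ d = k := by rw [← Category.assoc, e₂, e]
  have e₆ : a ≫ b ≫ c ≫ d = k := by rw [← e₄, Category.assoc]
  simp only [comp_app, LinearMap.comp_apply, LinearMap.flip_apply, tmL_apply, tensorMap_tm]
  rw [assoc_hom_tm (U := tensor U V) m c d e₂ e rfl e₅, map_smul,
    assoc_hom_tm (W := tensor W X) a b (c ≫ d) e₁ e₅ rfl e₆,
    assoc_hom_tm a b c e₁ e₂ rfl e₃, tm_smul_left, map_smul, map_smul,
    assoc_hom_tm (V := tensor V W) a (b ≫ c) d e₃ e rfl e₄, map_smul, tensorMap_tm,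
    assoc_hom_tm b c d rfl rfl rfl (by rw [Category.assoc]), tm_smul_right]
  simp only [smul_smul, id_app, LinearMap.id_apply, ← mul_assoc]
  rw [pentagon_coeff, ← e₁]
  congr 1
  exact tm_congr _ _ _ _ _ _ _ _ _ _

theorem leftUnitor_inv_naturality {V W : GrVec α} (f : V ⟶ W) :
    (leftUnitor V).inv ≫ tensorMap (𝟙 (unit α)) f = f ≫ (leftUnitor W).inv := by
  apply hom_ext; intro X Y k
  apply LinearMap.ext; intro v
  simp only [comp_app, LinearMap.comp_apply, leftUnitor_inv_app, tensorMap_tm, id_app,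
    LinearMap.id_apply]

theorem rightUnitor_inv_naturality {V W : GrVec α} (f : V ⟶ W) :
    (rightUnitor V).inv ≫ tensorMap f (𝟙 (unit α)) = f ≫ (rightUnitor W).inv := by
  apply hom_ext; intro X Y k
  apply LinearMap.ext; intro v
  simp only [comp_app, LinearMap.comp_apply, rightUnitor_inv_app, tensorMap_tm, id_app,
    LinearMap.id_apply]

theorem triangle_inv (V W : GrVec α) :
    tensorMap (rightUnitor V).inv (𝟙 W) ≫ (assoc V (unit α) W).hom =
      tensorMap (𝟙 V) (leftUnitor W).inv := by
  apply hom_ext; intro X Z k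
  apply tensor_ext
  intro Y f g e v w
  simp only [comp_app, LinearMap.comp_apply, leftUnitor_inv_app, rightUnitor_inv_app,
    tensorMap_tm, id_app, LinearMap.id_apply]
  rw [assoc_hom_tm (V := unit α) f (𝟙 Y) g (Category.comp_id f) e (Category.id_comp g) e,
    α.id_mid, Circle.coe_one, one_smul]

instance : MonoidalCategory (GrVec α) := MonoidalCategory.ofTensorHom
  (id_tensorHom_id := tensorMap_id)
  (id_tensorHom := fun _ _ _ _ => rfl)
  (tensorHom_id := fun _ _ => rfl)
  (tensorHom_comp_tensorHom := tensorMap_comp)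
  (associator_naturality := assoc_naturality)
  (leftUnitor_naturality := fun {V W} f => by
    have h := leftUnitor_inv_naturality f
    rw [Iso.inv_comp_eq] at h
    change tensorMap (𝟙 (unit α)) f ≫ (leftUnitor W).hom = (leftUnitor V).hom ≫ f
    rw [h, Category.assoc, Category.assoc, Iso.inv_hom_id, Category.comp_id])
  (rightUnitor_naturality := fun {V W} f => by
    have h := rightUnitor_inv_naturality f
    rw [Iso.inv_comp_eq] at h
    change tensorMap f (𝟙 (unit α)) ≫ (rightUnitor W).hom = (rightUnitor V).hom ≫ f
    rw [h, Category.assoc, Category.assoc, Iso.inv_hom_id, Category.comp_id])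
  (pentagon := pentagon_aux)
  (triangle := fun V W => by
    change (assoc V (unit α) W).hom ≫ tensorMap (𝟙 V) (leftUnitor W).hom =
      tensorMap (rightUnitor V).hom (𝟙 W)
    have h : tensorMap (rightUnitor V).hom (𝟙 W) ≫ tensorMap (rightUnitor V).inv (𝟙 W) = 𝟙 _ := by
      rw [tensorMap_comp, Iso.hom_inv_id, Category.comp_id, tensorMap_id]
    rw [← Category.id_comp ((assoc V (unit α) W).hom ≫ _)]
    erw [← h]
    rw [Category.assoc, ← Category.assoc (tensorMap (rightUnitor V).inv (𝟙 W)), triangle_inv,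
      tensorMap_comp, Iso.inv_hom_id, Category.comp_id, tensorMap_id]
    exact Category.comp_id _)

end Tensor

end GrVec

/-! ### `(G, α)`-subgroupoids and their algebra objects -/

/-- A subgroupoid `A` of `G` with a normalised 2-cochain `φ` such that `d φ = α⁻¹` on `A`. -/
structure TwistedSubgroupoid (α : Cocycle₃ G) where
  sub : Subgroupoid G
  φ : Cochain₂ sub.objs
  normalised : IsNormalised₂ φ
  d_eq : ∀ {W X Y Z : sub.objs} (a : W ⟶ X) (b : X ⟶ Y) (c : Y ⟶ Z),
    d₂ φ a b c = (α.toFun a.val b.val c.val)⁻¹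

namespace TwistedSubgroupoid

variable {α : Cocycle₃ G} (P : TwistedSubgroupoid α)

/-- The morphism of the subgroupoid given by a morphism of `G` that belongs to it. -/
def lift {X Y : G} (g : X ⟶ Y) (h : g ∈ P.sub.arrows X Y) :
    (⟨X, P.sub.mem_objs_of_src h⟩ : P.sub.objs) ⟶ ⟨Y, P.sub.mem_objs_of_tgt h⟩ :=
  ⟨g, h⟩

/-- The value of `φ` at two composable morphisms of `G` which lie in the subgroupoid. -/
def ev {X Y Z : G} (f : X ⟶ Y) (g : Y ⟶ Z) (hf : f ∈ P.sub.arrows X Y)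
    (hg : g ∈ P.sub.arrows Y Z) : Circle :=
  P.φ (P.lift f hf) (P.lift g hg)

open Classical in
/-- The extension of `φ` by zero. -/
def coeff {X Y Z : G} (f : X ⟶ Y) (g : Y ⟶ Z) : ℂ :=
  if h : f ∈ P.sub.arrows X Y ∧ g ∈ P.sub.arrows Y Z then (P.ev f g h.1 h.2 : ℂ) else 0

theorem coeff_of_mem {X Y Z : G} {f : X ⟶ Y} {g : Y ⟶ Z} (hf : f ∈ P.sub.arrows X Y)
    (hg : g ∈ P.sub.arrows Y Z) : P.coeff f g = P.ev f g hf hg := dif_pos ⟨hf, hg⟩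

theorem mem_of_coeff_ne_zero {X Y Z : G} {f : X ⟶ Y} {g : Y ⟶ Z} (h : P.coeff f g ≠ 0) :
    f ∈ P.sub.arrows X Y ∧ g ∈ P.sub.arrows Y Z := by
  by_contra hn
  exact h (dif_neg hn)

theorem ev_assoc {W X Y Z : G} {f : W ⟶ X} {g : X ⟶ Y} {h : Y ⟶ Z} (hf : f ∈ P.sub.arrows W X)
    (hg : g ∈ P.sub.arrows X Y) (hh : h ∈ P.sub.arrows Y Z) :
    P.ev f g hf hg * P.ev (f ≫ g) h (P.sub.mul hf hg) hh =
      α.toFun f g h * (P.ev g h hg hh * P.ev f (g ≫ h) hf (P.sub.mul hg hh)) := by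
  have h0 := P.d_eq (P.lift f hf) (P.lift g hg) (P.lift h hh)
  have h1 : P.ev g h hg hh * (P.ev f g hf hg)⁻¹ * (P.ev (f ≫ g) h (P.sub.mul hf hg) hh)⁻¹ *
      P.ev f (g ≫ h) hf (P.sub.mul hg hh) = (α.toFun f g h)⁻¹ := h0
  rw [eq_inv_iff_mul_eq_one] at h1
  set x := P.ev f g hf hg
  set y := P.ev (f ≫ g) h (P.sub.mul hf hg) hh
  calc x * y = (x * y) * (P.ev g h hg hh * x⁻¹ * y⁻¹ * P.ev f (g ≫ h) hf (P.sub.mul hg hh) *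
          α.toFun f g h) := by rw [h1, mul_one]
    _ = (x * x⁻¹) * (y * y⁻¹) *
          (α.toFun f g h * (P.ev g h hg hh * P.ev f (g ≫ h) hf (P.sub.mul hg hh))) := by ac_rfl
    _ = _ := by rw [mul_inv_cancel, mul_inv_cancel, one_mul, one_mul]

variable [Fintype G] [∀ X Y : G, Fintype (X ⟶ Y)]

/-- The graded vector space `⨁_{a ∈ Hom(A)} ℂ_a`. -/
def obj : GrVec α := GrVec.span α fun X Y g => g ∈ P.sub.arrows X Y

open GrVec

/-- The basis vector of `P.obj` in degree `a ∈ Hom(A)`, and `0` in the other degrees. -/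
def vec {X Y : G} (g : X ⟶ Y) : P.obj.deg g :=
  line.scale (P := True) (Set.indicator (P.sub.arrows X Y) 1 g)
    (fun h => Set.mem_of_indicator_ne_zero h) (line.one trivial)

/-- The coordinate of a homogeneous vector of `P.obj`. -/
def val {X Y : G} (g : X ⟶ Y) : P.obj.deg g →ₗ[ℂ] ℂ := (line (g ∈ P.sub.arrows X Y)).subtype

theorem val_injective {X Y : G} (g : X ⟶ Y) : Function.Injective (P.val g) :=
  Subtype.val_injective

theorem mem_of_val_ne_zero {X Y : G} {g : X ⟶ Y} {c : P.obj.deg g} (h : P.val g c ≠ 0) :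
    g ∈ P.sub.arrows X Y := (show line (g ∈ P.sub.arrows X Y) from c).2 h

/-- The multiplication in degrees `f`, `g` with `fg = k`. -/
def mulAt {X Y Z : G} (f : X ⟶ Y) (g : Y ⟶ Z) {k : X ⟶ Z} (e : f ≫ g = k) :
    P.obj.deg f →ₗ[ℂ] P.obj.deg g →ₗ[ℂ] P.obj.deg k :=
  (line.mul (P.coeff f g) (fun h => by
      have := P.mem_of_coeff_ne_zero h
      simpa only [e] using P.sub.mul this.1 this.2) :
    line (f ∈ P.sub.arrows X Y) →ₗ[ℂ] line (g ∈ P.sub.arrows Y Z) →ₗ[ℂ]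
      line (k ∈ P.sub.arrows X Z))

/-- The multiplication `a ⊗ a' ↦ φ(a,a') aa'`. -/
def mul : P.obj ⊗ P.obj ⟶ P.obj where
  app _ _ _ := tlift fun p => P.mulAt p.fst p.snd p.comp

/-- The unit `1 ↦ ∑_{X ∈ Ob(A)} id_X`. -/
def one : 𝟙_ (GrVec α) ⟶ P.obj where
  app X Y k :=
    (line.scale (Set.indicator (P.sub.arrows X Y) 1 k) (fun h => Set.mem_of_indicator_ne_zero h) :
      line (IsIdentity k) →ₗ[ℂ] line (k ∈ P.sub.arrows X Y))

theorem val_mul {X Y Z : G} (f : X ⟶ Y) (g : Y ⟶ Z) {k : X ⟶ Z} (e : f ≫ g = k)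
    (c : P.obj.deg f) (d : P.obj.deg g) :
    P.val k (P.mul.app k (tm (V := P.obj) (W := P.obj) f g e c d)) =
      P.coeff f g * (P.val f c * P.val g d) := by
  unfold mul
  rw [tlift_tm]
  rfl

theorem val_one (X : G) :
    P.val (𝟙 X) (P.one.app (𝟙 X) (unitVec α X)) = Set.indicator (P.sub.arrows X X) 1 (𝟙 X) :=
  mul_one _

theorem one_mul_aux : (GrVec.leftUnitor P.obj).inv ≫ tensorMap P.one (𝟙 P.obj) ≫ P.mul = 𝟙 P.obj := by
  apply hom_ext; intro X Y k
  apply LinearMap.ext; intro v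
  apply P.val_injective
  rw [comp_app, comp_app, LinearMap.comp_apply, LinearMap.comp_apply, leftUnitor_inv_app,
    tensorMap_tm]
  erw [P.val_mul, P.val_one]
  simp only [id_app, LinearMap.id_apply]
  by_cases h : P.val k v = 0
  · rw [h, mul_zero, mul_zero]
  · have hk := P.mem_of_val_ne_zero h
    have h1 := P.sub.id_mem_of_src hk
    rw [Set.indicator_of_mem h1, P.coeff_of_mem h1 hk]
    have : P.ev (𝟙 X) k h1 hk = 1 := P.normalised.id_left (P.lift k hk)
    rw [this]
    simp

theorem mul_one_aux : (GrVec.rightUnitor P.obj).inv ≫ tensorMap (𝟙 P.obj) P.one ≫ P.mul = 𝟙 P.obj := by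
  apply hom_ext; intro X Y k
  apply LinearMap.ext; intro v
  apply P.val_injective
  rw [comp_app, comp_app, LinearMap.comp_apply, LinearMap.comp_apply, rightUnitor_inv_app,
    tensorMap_tm]
  erw [P.val_mul, P.val_one]
  simp only [id_app, LinearMap.id_apply]
  by_cases h : P.val k v = 0
  · rw [h, zero_mul, mul_zero]
  · have hk := P.mem_of_val_ne_zero h
    have h1 := P.sub.id_mem_of_tgt hk
    rw [Set.indicator_of_mem h1, P.coeff_of_mem hk h1]
    have : P.ev k (𝟙 Y) hk h1 = 1 := P.normalised.id_right (P.lift k hk)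
    rw [this]
    simp

theorem mul_assoc_aux : tensorMap P.mul (𝟙 P.obj) ≫ P.mul =
    (assoc P.obj P.obj P.obj).hom ≫ tensorMap (𝟙 P.obj) P.mul ≫ P.mul := by
  apply hom_ext; intro W Z k
  apply tensor_ext₃
  intro X Y f g h l e e' u v w
  have e₂ : f ≫ g ≫ h = k := by rw [← Category.assoc, e, e']
  apply P.val_injective
  simp only [comp_app, LinearMap.comp_apply]
  rw [assoc_hom_tm f g h e e' rfl e₂, tensorMap_tm, map_smul, tensorMap_tm, map_smul, map_smul]
  erw [P.val_mul, P.val_mul, P.val_mul, P.val_mul]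
  simp only [id_app, LinearMap.id_apply, smul_eq_mul]
  subst e
  by_cases hu : P.val f u = 0
  · simp [hu]
  by_cases hv : P.val g v = 0
  · simp [hv]
  by_cases hw : P.val h w = 0
  · simp [hw]
  have hf := P.mem_of_val_ne_zero hu
  have hg := P.mem_of_val_ne_zero hv
  have hh := P.mem_of_val_ne_zero hw
  rw [P.coeff_of_mem hf hg, P.coeff_of_mem (P.sub.mul hf hg) hh, P.coeff_of_mem hg hh,
    P.coeff_of_mem hf (P.sub.mul hg hh)]
  have := congrArg (fun z : Circle => (z : ℂ)) (P.ev_assoc hf hg hh)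
  simp only [Circle.coe_mul] at this
  linear_combination (P.val f u * P.val g v * P.val h w) * this

/-- The algebra object `A_φ` of `Vec_G^α`. -/
def alg : Mon (GrVec α) where
  X := P.obj
  mon :=
    { one := P.one
      mul := P.mul
      one_mul := by
        have h := P.one_mul_aux
        rw [Iso.inv_comp_eq, Category.comp_id] at h
        exact h
      mul_one := by
        have h := P.mul_one_aux
        rw [Iso.inv_comp_eq, Category.comp_id] at h
        exact h
      mul_assoc := P.mul_assoc_aux }

/-- The number `|Hom_A(X, -)|` of morphisms of the subgroupoid with source `X`. -/
def outDegree (X : G) : ℕ := Nat.card (Σ Y : G, P.sub.arrows X Y)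

/-- The section `a ↦ |Hom_A(s(a), -)|⁻¹ ∑_{a₁ a₂ = a} φ(a₁, a₂)⁻¹ a₁ ⊗ a₂` of the multiplication,
the sum being over `a₁, a₂ ∈ Hom(A)`. -/
def section_ : P.obj ⟶ P.obj ⊗ P.obj where
  app X _ k := (P.val k).smulRight ((P.outDegree X : ℂ)⁻¹ •
    ∑ p : Fac k, (P.coeff p.fst p.snd)⁻¹ • tm p.fst p.snd p.comp (P.vec p.fst) (P.vec p.snd))

end TwistedSubgroupoid

/-! ### Twisted groupoid algebras -/

/-- The twisted groupoid algebra `ℂ[𝒢]^ϑ` of a finite groupoid: functions on the set of morphisms. -/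
def TwistedAlgebra {𝒢 : Type} [Groupoid.{0} 𝒢] (_ϑ : Cocycle₂ 𝒢) : Type :=
  (Σ X Y : 𝒢, X ⟶ Y) → ℂ

namespace TwistedAlgebra

variable {𝒢 : Type} [Groupoid.{0} 𝒢] {ϑ : Cocycle₂ 𝒢}

instance : AddCommGroup (TwistedAlgebra ϑ) := inferInstanceAs (AddCommGroup (_ → ℂ))

instance : Module ℂ (TwistedAlgebra ϑ) := inferInstanceAs (Module ℂ (_ → ℂ))

/-- The coefficient of a morphism. -/
def coeff (x : TwistedAlgebra ϑ) {X Y : 𝒢} (f : X ⟶ Y) : ℂ := x ⟨X, Y, f⟩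

@[ext] theorem ext {x y : TwistedAlgebra ϑ}
    (h : ∀ ⦃X Y : 𝒢⦄ (f : X ⟶ Y), x.coeff f = y.coeff f) : x = y :=
  funext fun ⟨_, _, f⟩ => h f

@[simp] theorem coeff_add (x y : TwistedAlgebra ϑ) {X Y : 𝒢} (f : X ⟶ Y) :
    (x + y).coeff f = x.coeff f + y.coeff f := rfl

@[simp] theorem coeff_zero {X Y : 𝒢} (f : X ⟶ Y) : (0 : TwistedAlgebra ϑ).coeff f = 0 := rfl

@[simp] theorem coeff_smul (c : ℂ) (x : TwistedAlgebra ϑ) {X Y : 𝒢} (f : X ⟶ Y) :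
    (c • x).coeff f = c * x.coeff f := rfl

open Classical in
/-- The basis vector `|f⟩`. -/
def ket {X Y : 𝒢} (f : X ⟶ Y) : TwistedAlgebra ϑ := Pi.single (⟨X, Y, f⟩ : Σ X Y : 𝒢, X ⟶ Y) (1 : ℂ)

open Classical in
/-- The unit `∑_X |id_X⟩`. -/
instance : One (TwistedAlgebra ϑ) := ⟨fun f => if IsIdentity f.2.2 then 1 else 0⟩

open Classical in
theorem coeff_one {X Y : 𝒢} (f : X ⟶ Y) :
    (1 : TwistedAlgebra ϑ).coeff f = if IsIdentity f then 1 else 0 := rfl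

variable [Fintype 𝒢] [∀ X Y : 𝒢, Fintype (X ⟶ Y)]

/-- The bilinear product with `|f⟩ ⋆ |g⟩ = ϑ(f, g) |fg⟩` for composable `f`, `g`, and `0` otherwise. -/
instance : Mul (TwistedAlgebra ϑ) :=
  ⟨fun x y k => ∑ p : Fac k.2.2, (ϑ.toFun p.fst p.snd : ℂ) * (x.coeff p.fst * y.coeff p.snd)⟩

theorem coeff_mul (x y : TwistedAlgebra ϑ) {X Y : 𝒢} (k : X ⟶ Y) :
    (x * y).coeff k = ∑ p : Fac k, (ϑ.toFun p.fst p.snd : ℂ) * (x.coeff p.fst * y.coeff p.snd) :=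
  rfl

theorem cocycle_coeff {W X Y Z : 𝒢} (f : W ⟶ X) (g : X ⟶ Y) (h : Y ⟶ Z) :
    (ϑ.toFun (f ≫ g) h : ℂ) * ϑ.toFun f g = ϑ.toFun f (g ≫ h) * ϑ.toFun g h := by
  have h0 := ϑ.cocycle f g h
  unfold d₂ at h0
  simp only [← Circle.coe_mul]
  rw [Circle.coe_inj]
  set x := ϑ.toFun f g
  set y := ϑ.toFun (f ≫ g) h
  calc y * x = y * x * (ϑ.toFun g h * x⁻¹ * y⁻¹ * ϑ.toFun f (g ≫ h)) := by rw [h0, mul_one]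
    _ = (x * x⁻¹) * (y * y⁻¹) * (ϑ.toFun f (g ≫ h) * ϑ.toFun g h) := by ac_rfl
    _ = _ := by rw [mul_inv_cancel, mul_inv_cancel, one_mul, one_mul]

theorem mul_assoc' (x y z : TwistedAlgebra ϑ) : x * y * z = x * (y * z) := by
  ext W Z k
  simp only [coeff_mul, Finset.mul_sum, Finset.sum_mul]
  rw [Finset.sum_sigma', Finset.sum_sigma']
  refine Finset.sum_bij'
    (fun s _ => ⟨⟨s.2.mid, s.2.fst, s.2.snd ≫ s.1.snd, by
      rw [← Category.assoc, s.2.comp, s.1.comp]⟩, ⟨s.1.mid, s.2.snd, s.1.snd, rfl⟩⟩)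
    (fun s _ => ⟨⟨s.2.mid, s.1.fst ≫ s.2.fst, s.2.snd, by
      rw [Category.assoc, s.2.comp, s.1.comp]⟩, ⟨s.1.mid, s.1.fst, s.2.fst, rfl⟩⟩)
    (fun _ _ => Finset.mem_univ _) (fun _ _ => Finset.mem_univ _) ?_ ?_ ?_
  · rintro ⟨⟨Y, l, h, e⟩, q⟩ _
    change Fac l at q
    obtain ⟨X, f, g, e'⟩ := q
    subst e' e
    rfl
  · rintro ⟨⟨X, f, l, e⟩, q⟩ _
    change Fac l at q
    obtain ⟨Y, g, h, e'⟩ := q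
    subst e' e
    rfl
  · rintro ⟨⟨Y, l, h, e⟩, q⟩ _
    change Fac l at q
    obtain ⟨X, f, g, e'⟩ := q
    subst e' e
    have := cocycle_coeff (ϑ := ϑ) f g h
    dsimp only
    linear_combination (x.coeff f * y.coeff g * z.coeff h) * this

theorem one_mul' (x : TwistedAlgebra ϑ) : 1 * x = x := by
  ext X Y k
  rw [coeff_mul, Finset.sum_eq_single (⟨X, 𝟙 X, k, Category.id_comp k⟩ : Fac k)]
  · rw [coeff_one, if_pos (IsIdentity.id X), ϑ.normalised.id_left, Circle.coe_one, one_mul, one_mul]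
  · rintro ⟨Z, f, g, e⟩ _ hne
    rw [coeff_one, if_neg, zero_mul, mul_zero]
    intro hf
    dsimp only at hf
    cases hf
    obtain rfl : g = k := by rw [← e, Category.id_comp]
    exact hne rfl
  · exact fun h => absurd (Finset.mem_univ _) h

theorem mul_one' (x : TwistedAlgebra ϑ) : x * 1 = x := by
  ext X Y k
  rw [coeff_mul, Finset.sum_eq_single (⟨Y, k, 𝟙 Y, Category.comp_id k⟩ : Fac k)]
  · rw [coeff_one, if_pos (IsIdentity.id Y), ϑ.normalised.id_right, Circle.coe_one, one_mul,
      mul_one]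
  · rintro ⟨Z, f, g, e⟩ _ hne
    rw [coeff_one, if_neg, mul_zero, mul_zero]
    intro hg
    dsimp only at hg
    cases hg
    obtain rfl : f = k := by rw [← e, Category.comp_id]
    exact hne rfl
  · exact fun h => absurd (Finset.mem_univ _) h

instance : Ring (TwistedAlgebra ϑ) :=
  { (inferInstance : AddCommGroup (TwistedAlgebra ϑ)) with
    mul := (· * ·)
    one := 1
    mul_assoc := mul_assoc'
    one_mul := one_mul'
    mul_one := mul_one'
    left_distrib := fun x y z => by
      ext X Y k; simp only [coeff_mul, coeff_add, mul_add, Finset.sum_add_distrib]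
    right_distrib := fun x y z => by
      ext X Y k; simp only [coeff_mul, coeff_add, add_mul, mul_add, Finset.sum_add_distrib]
    zero_mul := fun x => by
      ext X Y k; simp only [coeff_mul, coeff_zero, zero_mul, mul_zero, Finset.sum_const_zero]
    mul_zero := fun x => by
      ext X Y k; simp only [coeff_mul, coeff_zero, mul_zero, Finset.sum_const_zero] }

instance : Algebra ℂ (TwistedAlgebra ϑ) := Algebra.ofModule
  (fun c x y => by
    ext X Y k
    simp only [coeff_mul, coeff_smul, Finset.mul_sum]
    exact Finset.sum_congr rfl fun _ _ => by ring)
  (fun c x y => by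
    ext X Y k
    simp only [coeff_mul, coeff_smul, Finset.mul_sum]
    exact Finset.sum_congr rfl fun _ _ => by ring)

end TwistedAlgebra

/-! ### The groupoid `G̃_{AB}` and its 2-cocycle -/

section Tilde

variable {α : Cocycle₃ G}

/-- Objects of `G̃_{AB}`: morphisms of `G` from an object of `A` to an object of `B`. -/
structure Tilde (P Q : TwistedSubgroupoid α) where
  src : P.sub.objs
  tgt : Q.sub.objs
  mor : src.val ⟶ tgt.val

namespace Tilde

variable {P Q : TwistedSubgroupoid α}

/-- Morphisms `g → a g b` of `G̃_{AB}`, with `a ∈ Hom_A(-, s(g))` and `b ∈ Hom_B(t(g), -)`. -/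
@[ext]
structure Hom (g g' : Tilde P Q) where
  a : g'.src ⟶ g.src
  b : g.tgt ⟶ g'.tgt
  comm : a.val ≫ g.mor ≫ b.val = g'.mor

/-- Composition is `(a, b)` followed by `(a', b')` equals `(a'a, bb')`. -/
instance : Groupoid.{0} (Tilde P Q) where
  Hom := Hom
  id g := ⟨𝟙 _, 𝟙 _, by
    change 𝟙 _ ≫ g.mor ≫ 𝟙 _ = g.mor
    simp⟩
  comp f f' := ⟨f'.a ≫ f.a, f.b ≫ f'.b, by
    rw [← f'.comm, ← f.comm]
    change (f'.a.val ≫ f.a.val) ≫ _ ≫ (f.b.val ≫ f'.b.val) = _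
    simp only [Category.assoc]⟩
  inv {g g'} f := ⟨Groupoid.inv f.a, Groupoid.inv f.b, by
    rw [← f.comm]
    change Groupoid.inv f.a.val ≫ _ ≫ Groupoid.inv f.b.val = _
    simp⟩
  id_comp f := Hom.ext (Category.comp_id f.a) (Category.id_comp f.b)
  comp_id f := Hom.ext (Category.id_comp f.a) (Category.comp_id f.b)
  assoc f g h := Hom.ext (Category.assoc h.a g.a f.a).symm (Category.assoc f.b g.b h.b)
  inv_comp f := Hom.ext (Groupoid.comp_inv f.a) (Groupoid.inv_comp f.b)
  comp_inv f := Hom.ext (Groupoid.inv_comp f.a) (Groupoid.comp_inv f.b)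

/-- The function `ϖ^{AB}`, for `(a, b)` starting at `g` followed by `(a', b')`. -/
def varpiFun (P Q : TwistedSubgroupoid α) : Cochain₂ (Tilde P Q) := fun g _ _ f f' =>
  α.toFun f.a.val (g.mor ≫ f.b.val) f'.b.val * α.toFun g.mor f.b.val f'.b.val *
    (α.toFun f'.a.val f.a.val (g.mor ≫ f.b.val ≫ f'.b.val))⁻¹ * P.φ f'.a f.a * Q.φ f.b f'.b

theorem varpiFun_normalised : IsNormalised₂ (varpiFun P Q) where
  id_left {g g'} f := by
    have h1 : P.φ f.a (𝟙 g.src) = 1 := P.normalised.id_right f.a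
    have h2 : Q.φ (𝟙 g.tgt) f.b = 1 := Q.normalised.id_left f.b
    change α.toFun (𝟙 g.src.val) (g.mor ≫ 𝟙 g.tgt.val) f.b.val * α.toFun g.mor (𝟙 g.tgt.val) f.b.val *
      (α.toFun f.a.val (𝟙 g.src.val) (g.mor ≫ 𝟙 g.tgt.val ≫ f.b.val))⁻¹ * P.φ f.a (𝟙 g.src) *
        Q.φ (𝟙 g.tgt) f.b = 1
    rw [α.id_left, α.id_mid, α.id_mid, h1, h2]
    simp
  id_right {g g'} f := by
    have h1 : P.φ (𝟙 g'.src) f.a = 1 := P.normalised.id_left f.a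
    have h2 : Q.φ f.b (𝟙 g'.tgt) = 1 := Q.normalised.id_right f.b
    change α.toFun f.a.val (g.mor ≫ f.b.val) (𝟙 g'.tgt.val) * α.toFun g.mor f.b.val (𝟙 g'.tgt.val) *
      (α.toFun (𝟙 g'.src.val) f.a.val (g.mor ≫ f.b.val ≫ 𝟙 g'.tgt.val))⁻¹ * P.φ (𝟙 g'.src) f.a *
        Q.φ f.b (𝟙 g'.tgt) = 1
    rw [α.id_left, α.id_right, α.id_right, h1, h2]
    simp

theorem varpiFun_cocycle {g g₁ g₂ g₃ : Tilde P Q} (f : g ⟶ g₁) (f' : g₁ ⟶ g₂) (f'' : g₂ ⟶ g₃) :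
    d₂ (varpiFun P Q) f f' f'' = 1 := by
  have h1 := P.d_eq f''.a f'.a f.a
  have h2 := Q.d_eq f.b f'.b f''.b
  have h3 := α.cocycle g.mor f.b.val f'.b.val f''.b.val
  have h4 := α.cocycle f.a.val (g.mor ≫ f.b.val) f'.b.val f''.b.val
  have h5 := α.cocycle f'.a.val f.a.val (g.mor ≫ f.b.val ≫ f'.b.val) f''.b.val
  have h6 := α.cocycle f''.a.val f'.a.val f.a.val (g.mor ≫ f.b.val ≫ f'.b.val ≫ f''.b.val)
  have c1 : (f ≫ f').a = f'.a ≫ f.a := rfl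
  have c2 : (f ≫ f').b = f.b ≫ f'.b := rfl
  have c3 : (f' ≫ f'').a = f''.a ≫ f'.a := rfl
  have c4 : (f' ≫ f'').b = f'.b ≫ f''.b := rfl
  have v1 : (f'.a ≫ f.a).val = f'.a.val ≫ f.a.val := rfl
  have v2 : (f.b ≫ f'.b).val = f.b.val ≫ f'.b.val := rfl
  have v3 : (f''.a ≫ f'.a).val = f''.a.val ≫ f'.a.val := rfl
  have v4 : (f'.b ≫ f''.b).val = f'.b.val ≫ f''.b.val := rfl
  unfold d₂ varpiFun
  unfold d₂ at h1 h2
  unfold d₃ at h3 h4 h5 h6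
  rw [c1, c2, c3, c4, v1, v2, v3, v4, ← f.comm]
  simp only [Category.assoc] at h1 h2 h3 h4 h5 h6 ⊢
  replace h1 := congrArg Additive.ofMul h1
  replace h2 := congrArg Additive.ofMul h2
  replace h3 := congrArg Additive.ofMul h3
  replace h4 := congrArg Additive.ofMul h4
  replace h5 := congrArg Additive.ofMul h5
  replace h6 := congrArg Additive.ofMul h6
  apply Additive.ofMul.injective
  simp only [ofMul_mul, ofMul_inv, ofMul_one] at h1 h2 h3 h4 h5 h6 ⊢
  linear_combination (norm := abel) -h1 + h2 - h3 - h4 + h5 + h6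

/-- The normalised 2-cocycle `ϖ^{AB}` of `G̃_{AB}`. -/
def varpi (P Q : TwistedSubgroupoid α) : Cocycle₂ (Tilde P Q) where
  toFun := varpiFun P Q
  normalised := varpiFun_normalised
  cocycle := varpiFun_cocycle

variable [Fintype G] [∀ X Y : G, Fintype (X ⟶ Y)]

instance : Fintype P.sub.objs := Fintype.ofFinite _

instance (X Y : P.sub.objs) : Fintype (X ⟶ Y) :=
  have : Finite (X ⟶ Y) := Finite.of_injective (fun f : X ⟶ Y => f.val) Subtype.val_injective
  Fintype.ofFinite _

instance : Fintype (Tilde P Q) :=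
  have : Finite (Tilde P Q) := Finite.of_injective
    (fun g : Tilde P Q => (⟨(g.src, g.tgt), g.mor⟩ :
      Σ p : P.sub.objs × Q.sub.objs, (p.1.val ⟶ p.2.val)))
    (by rintro ⟨X, Y, f⟩ ⟨X', Y', f'⟩ e
        simp only [Sigma.mk.injEq, Prod.mk.injEq] at e
        obtain ⟨⟨rfl, rfl⟩, e⟩ := e
        rw [eq_of_heq e])
  Fintype.ofFinite _

instance (g g' : Tilde P Q) : Fintype (g ⟶ g') :=
  have : Finite (g ⟶ g') := Finite.of_injective
    (fun f : g ⟶ g' => ((f.a, f.b) : (g'.src ⟶ g.src) × (g.tgt ⟶ g'.tgt)))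
    (fun _ _ e => Hom.ext (congrArg Prod.fst e) (congrArg Prod.snd e))
  Fintype.ofFinite _

end Tilde

end Tilde

/-! ### Separable algebra objects and relative tensor products of bimodule objects -/

section Monoidal

open MonObj

variable {C : Type*} [Category C] [MonoidalCategory C]

/-- `Δ : A → A ⊗ A` is a section of the multiplication and a map of `(A, A)`-bimodules. -/
structure IsSeparableSection (A : Mon C) (Δ : A.X ⟶ A.X ⊗ A.X) : Prop where
  isSection : Δ ≫ μ[A.X] = 𝟙 A.X
  left_linear : A.X ◁ Δ ≫ (α_ A.X A.X A.X).inv ≫ μ[A.X] ▷ A.X = μ[A.X] ≫ Δ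
  right_linear : Δ ▷ A.X ≫ (α_ A.X A.X A.X).hom ≫ A.X ◁ μ[A.X] = μ[A.X] ≫ Δ

/-- Separability of an algebra object. -/
def IsSeparable (A : Mon C) : Prop := ∃ Δ : A.X ⟶ A.X ⊗ A.X, IsSeparableSection A Δ

variable {A B D : Mon C}

/-- The simultaneous left and right action `A ⊗ (M ⊗ B) → M`. -/
def biact (M : Bimod A B) : A.X ⊗ (M.X ⊗ B.X) ⟶ M.X := A.X ◁ M.actRight ≫ M.actLeft

/-- The morphism `A ⊗ ((M ⊗ N) ⊗ D) → M ⊗ N` which inserts `Δ ∘ η` between `M` and `N` and then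
acts on both factors. -/
def tensorBiact (Δ : B.X ⟶ B.X ⊗ B.X) (M : Bimod A B) (N : Bimod B D) :
    A.X ⊗ ((M.X ⊗ N.X) ⊗ D.X) ⟶ M.X ⊗ N.X :=
  A.X ◁ (α_ M.X N.X D.X).hom ≫
  (α_ A.X M.X (N.X ⊗ D.X)).inv ≫
  (ρ_ (A.X ⊗ M.X)).inv ▷ (N.X ⊗ D.X) ≫
  ((A.X ⊗ M.X) ◁ η[B.X]) ▷ (N.X ⊗ D.X) ≫
  ((A.X ⊗ M.X) ◁ Δ) ▷ (N.X ⊗ D.X) ≫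
  (α_ (A.X ⊗ M.X) B.X B.X).inv ▷ (N.X ⊗ D.X) ≫
  ((α_ A.X M.X B.X).hom ▷ B.X) ▷ (N.X ⊗ D.X) ≫
  (α_ (A.X ⊗ (M.X ⊗ B.X)) B.X (N.X ⊗ D.X)).hom ≫
  (biact M ⊗ₘ biact N)

/-- The endomorphism of `M ⊗ N` obtained from `tensorBiact` by inserting the units of `A` and `D`. -/
def sepIdem (Δ : B.X ⟶ B.X ⊗ B.X) (M : Bimod A B) (N : Bimod B D) : M.X ⊗ N.X ⟶ M.X ⊗ N.X :=
  (ρ_ (M.X ⊗ N.X)).inv ≫ (λ_ ((M.X ⊗ N.X) ⊗ 𝟙_ C)).inv ≫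
    (η[A.X] ⊗ₘ (𝟙 (M.X ⊗ N.X) ⊗ₘ η[D.X])) ≫ tensorBiact Δ M N

/-- `T` together with `s : M ⊗ N → T` and `r : T → M ⊗ N` is a relative tensor product
`M ⊗_B N`: it splits the idempotent `sepIdem Δ M N`, and its action is the one
induced by `tensorBiact Δ M N`. -/
structure IsRelTensor (Δ : B.X ⟶ B.X ⊗ B.X) (M : Bimod A B) (N : Bimod B D) (T : Bimod A D)
    (s : M.X ⊗ N.X ⟶ T.X) (r : T.X ⟶ M.X ⊗ N.X) : Prop where
  split : s ≫ r = sepIdem Δ M N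
  retract : r ≫ s = 𝟙 T.X
  action : biact T = A.X ◁ (r ▷ D.X) ≫ tensorBiact Δ M N ≫ s

end Monoidal

/-! ### Total spaces -/

namespace GrVec

variable {α : Cocycle₃ G}

/-- The direct sum of all homogeneous components. -/
abbrev total (V : GrVec α) : Type := ⨁ k : (Σ X Y : G, X ⟶ Y), V.deg k.2.2

open Classical in
/-- The inclusion of a homogeneous component. -/
def incl (V : GrVec α) {X Y : G} (k : X ⟶ Y) : V.deg k →ₗ[ℂ] V.total :=
  DirectSum.lof ℂ (Σ X Y : G, X ⟶ Y) (fun k => V.deg k.2.2) ⟨X, Y, k⟩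

open Classical in
/-- The map of total spaces induced by a grading-preserving map. -/
def totalMap {V W : GrVec α} (f : V ⟶ W) : V.total →ₗ[ℂ] W.total :=
  DirectSum.toModule ℂ _ _ fun k => W.incl k.2.2 ∘ₗ f.app k.2.2

variable [Fintype G] [∀ X Y : G, Fintype (X ⟶ Y)]

open Classical in
/-- The canonical map `v ⊗ w ↦ v ⊗ w` from the total space of the graded tensor product to the
tensor product of the total spaces. -/
def totTensor (V W : GrVec α) : (V ⊗ W).total →ₗ[ℂ] V.total ⊗[ℂ] W.total :=
  DirectSum.toModule ℂ _ _ fun _ => tlift fun p =>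
    (TensorProduct.mk ℂ V.total W.total).compl₁₂ (V.incl p.fst) (W.incl p.snd)

end GrVec

section Main

variable {α : Cocycle₃ G} [Fintype G] [∀ X Y : G, Fintype (X ⟶ Y)]

open GrVec

/-- The action of a morphism `(a, b) : g → g' = a g b` of `G̃_{AB}` on a bimodule: it takes `v` in
degree `g` to the image of `a ⊗ (v ⊗ b)` in degree `g'`. -/
def biactAt {P Q : TwistedSubgroupoid α} (M : Bimod P.alg Q.alg) {g g' : Tilde P Q} (f : g ⟶ g')
    (v : M.X.deg g.mor) : M.X.deg g'.mor :=
  (biact M).app g'.mor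
    (tm (V := P.obj) (W := M.X ⊗ Q.obj) f.a.val (g.mor ≫ f.b.val) f.comm (P.vec f.a.val)
      (tm (V := M.X) (W := Q.obj) g.mor f.b.val rfl v (Q.vec f.b.val)))

/-- The coefficient of `|a, b⟩_{g₁} ⊗ |b⁻¹, c⟩_{g₂}` in the comultiplication. -/
def comulCoeff (Q : TwistedSubgroupoid α) {X' X Z Z' : G} {Y Y' : Q.sub.objs} (a : X' ⟶ X)
    (g₁ : X ⟶ Y.val) (g₂ : Y.val ⟶ Z) (c : Z ⟶ Z') (b : Y ⟶ Y') : Circle :=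
  α.toFun g₁ g₂ c * α.toFun a g₁ b.val *
      α.toFun (a ≫ g₁ ≫ b.val) (Groupoid.inv b.val) (g₂ ≫ c) *
    (Q.φ b (Groupoid.inv b) * α.toFun a g₁ (g₂ ≫ c) *
      α.toFun (a ≫ g₁) b.val (Groupoid.inv b.val))⁻¹

open TwistedAlgebra in
/-- The value of the comultiplication on a basis vector `|a, c⟩_g`: the sum over all factorisations
`g = g₁ g₂` through an object of `B` and all `b` in `Hom_B(t(g₁), -)`. -/
def comulKet (P Q R : TwistedSubgroupoid α) {g g' : Tilde P R} (f : g ⟶ g') :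
    TwistedAlgebra (Tilde.varpi P Q) ⊗[ℂ] TwistedAlgebra (Tilde.varpi Q R) :=
  ∑ Y : Q.sub.objs, ∑ g₁ : g.src.val ⟶ Y.val, ∑ Y' : Q.sub.objs, ∑ b : Y ⟶ Y',
    ((Q.outDegree Y.val : ℂ)⁻¹ *
        (comulCoeff Q f.a.val g₁ (Groupoid.inv g₁ ≫ g.mor) f.b.val b : ℂ)) •
      (ket (show (⟨g.src, Y, g₁⟩ : Tilde P Q) ⟶ ⟨g'.src, Y', f.a.val ≫ g₁ ≫ b.val⟩ from
          ⟨f.a, b, rfl⟩) ⊗ₜ[ℂ]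
        ket (show (⟨Y, g.tgt, Groupoid.inv g₁ ≫ g.mor⟩ : Tilde Q R) ⟶
            ⟨Y', g'.tgt, Groupoid.inv b.val ≫ (Groupoid.inv g₁ ≫ g.mor) ≫ f.b.val⟩ from
          ⟨Groupoid.inv b, f.b, rfl⟩))

/-- The comultiplication, by linear extension. -/
def comul (P Q R : TwistedSubgroupoid α) : TwistedAlgebra (Tilde.varpi P R) →ₗ[ℂ]
    TwistedAlgebra (Tilde.varpi P Q) ⊗[ℂ] TwistedAlgebra (Tilde.varpi Q R) where
  toFun x := ∑ g : Tilde P R, ∑ g' : Tilde P R, ∑ f : g ⟶ g', x.coeff f • comulKet P Q R f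
  map_add' x y := by
    simp only [TwistedAlgebra.coeff_add, add_smul, Finset.sum_add_distrib]
  map_smul' c x := by
    simp only [TwistedAlgebra.coeff_smul, mul_smul, Finset.smul_sum, RingHom.id_apply]

/-- `A = B`, and `φ`, `ψ` differ by the coboundary of a 1-cochain of `A`. -/
def Cohomologous (P Q : TwistedSubgroupoid α) : Prop :=
  P.sub = Q.sub ∧ ∃ l : ∀ ⦃X Y : G⦄, (X ⟶ Y) → Circle, ∀ {X Y Z : G} (f : X ⟶ Y) (g : Y ⟶ Z)
    (hf : f ∈ P.sub.arrows X Y) (hg : g ∈ P.sub.arrows Y Z) (hf' : f ∈ Q.sub.arrows X Y)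
    (hg' : g ∈ Q.sub.arrows Y Z), P.ev f g hf hg * l (f ≫ g) = Q.ev f g hf' hg' * (l f * l g)

end Main

section RightModules

/-- The endomorphism `v ↦ v ◁ x` of a right module over a complex algebra `R`. -/
def rAct (R V : Type) [Ring R] [Algebra ℂ R] [AddCommGroup V] [Module ℂ V] [Module Rᵐᵒᵖ V]
    [IsScalarTower ℂ Rᵐᵒᵖ V] : R →ₗ[ℂ] V →ₗ[ℂ] V :=
  (Algebra.lsmul ℂ ℂ V : Rᵐᵒᵖ →ₐ[ℂ] Module.End ℂ V).toLinearMap ∘ₗ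
    (MulOpposite.opLinearEquiv ℂ : R ≃ₗ[ℂ] Rᵐᵒᵖ).toLinearMap

/-- The right action of `R ⊗ S` on `V ⊗ W`, `(v ⊗ w) ◁ (x ⊗ y) = (v ◁ x) ⊗ (w ◁ y)`. -/
def rAct₂ (R S V W : Type) [Ring R] [Algebra ℂ R] [Ring S] [Algebra ℂ S]
    [AddCommGroup V] [Module ℂ V] [Module Rᵐᵒᵖ V] [IsScalarTower ℂ Rᵐᵒᵖ V]
    [AddCommGroup W] [Module ℂ W] [Module Sᵐᵒᵖ W] [IsScalarTower ℂ Sᵐᵒᵖ W] :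
    R ⊗[ℂ] S →ₗ[ℂ] (V ⊗[ℂ] W →ₗ[ℂ] V ⊗[ℂ] W) :=
  TensorProduct.lift ((TensorProduct.mapBilinear (RingHom.id ℂ) V W V W).compl₁₂ (rAct R V) (rAct S W))

end RightModules

section RelIncl

variable {α : Cocycle₃ G} [Fintype G] [∀ X Y : G, Fintype (X ⟶ Y)]

/-- The map `U → V ⊗ W` induced by `r : T → M ⊗ N` when `V`, `W`, `U` are identified with the total
spaces of `M`, `N`, `T`. -/
def relMap {M N T : GrVec α} {U V W : Type} [AddCommGroup U] [Module ℂ U] [AddCommGroup V]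
    [Module ℂ V] [AddCommGroup W] [Module ℂ W] (θM : V ≃ₗ[ℂ] M.total) (θN : W ≃ₗ[ℂ] N.total)
    (θT : U ≃ₗ[ℂ] T.total) (r : T ⟶ M ⊗ N) : U →ₗ[ℂ] V ⊗[ℂ] W :=
  TensorProduct.map θM.symm.toLinearMap θN.symm.toLinearMap ∘ₗ GrVec.totTensor M N ∘ₗ
    GrVec.totalMap r ∘ₗ θT.toLinearMap

end RelIncl

end GroupoidGraded

end

open GroupoidGraded GroupoidGraded.GrVec
open scoped ModuleCat

noncomputable section

/-! Everything is reduced to homogeneous vectors: `P.alg` has one basis vector for each morphism of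
the subgroupoid, and every associator is a scalar value of `α`.

Algebra objects. Composition with `a` identifies the factorisations of `b` with those of `ab`, the
coefficients of `Δ` match because `dφ = α⁻¹`, and `m ∘ Δ` counts the factorisations of a morphism
inside the subgroupoid; this is `isSeparableSection_asec`. Conversely, if all components are at most
one-dimensional, choose generators `e g`, equal to the unit in identity degrees, with structure
constants `m f g`. Associativity reads `m(f,g) m(fg,h) = α(f,g,h) m(g,h) m(f,gh)`. Comparing `e_g ·
Δ(1)` with `Δ(1) · e_g` coefficient by coefficient (`section_transport`) shows that `m f g` is
nonzero whenever `e f` and `e g` are (`m_ne_zero`), so the support is a subgroupoid. Since `α` has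
modulus one, `log ‖m‖` is a real 2-cocycle of a finite groupoid, hence a coboundary by averaging
(`log_m`). Rescaling the generators leaves only the phases of `m`, which form the required cochain.
An isomorphism between two such algebras multiplies each basis vector by a nonzero scalar, and the
phases of these scalars give the 1-cochain `λ`.

Bimodules. A bimodule vanishes in degrees that are not objects of `Tilde P Q`, and on the others the
pairs `(a, b)` act. Composing two such actions requires one exchange of a left with a right action
and two associativity moves; their scalars multiply to `ϖ` (`bact_comp`), so the total space is a
right module over the twisted algebra. The kets of identities are orthogonal idempotents with sum
`1`. They project to the homogeneous components, so module maps preserve degrees, and conversely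
they split every module into components. Each ket factors as a right move followed by a left move
(`rKet_mul_lKet`), and the relations among these moves are the bimodule axioms. This gives full
faithfulness and essential surjectivity.

Relative tensor products. On `outer M N` (the object `M ⊗ N` with its outer actions) let `J =
insertSection Δ M N` be the insertion of `Δ(1)` in the middle. It is a bimodule endomorphism; the
linearity of `Δ` lets elements of `B` cross it, and `m ∘ Δ = id` then makes it idempotent. Since
`tensorBiact` is the outer action followed by `J` (`tensorBiact_eq`), a relative tensor product is a
splitting of `J`, and degreewise images provide one. The formula for the comultiplication is the
outer action followed by `J`, written on basis vectors: `rho₂_comul_apply` says that `comul x` acts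
on the product of total spaces as projection to the composable part, outer action of `x`, `J`, and
inclusion. Idempotence of `J` and its commutation with the outer action make this multiplicative in
`x`, and the faithful action on regular bimodules transfers this to `comul` itself. Injectivity,
image and equivariance of the map induced by `r` follow from the same description. -/

namespace GroupoidGraded

/-! ### Splitting the separability idempotent in a monoidal category -/

section Monoidal

open MonObj

variable {C : Type*} [Category C] [MonoidalCategory C] {A B D : Mon C}

/-- The object `M ⊗ N` with the left action on `M` and the right action on `N`. -/
def outer (M : Bimod A B) (N : Bimod B D) : Bimod A D where
  X := M.X ⊗ N.X
  actLeft := (α_ A.X M.X N.X).inv ≫ M.actLeft ▷ N.X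
  actRight := (α_ M.X N.X D.X).hom ≫ M.X ◁ N.actRight
  one_actLeft := by
    rw [associator_inv_naturality_left_assoc, ← comp_whiskerRight, M.one_actLeft]
    monoidal
  left_assoc := by
    rw [associator_inv_naturality_left_assoc, ← comp_whiskerRight, M.left_assoc]
    simp only [comp_whiskerRight, whiskerLeft_comp, Category.assoc]
    rw [associator_inv_naturality_middle_assoc]
    monoidal
  actRight_one := by
    rw [associator_naturality_right_assoc, ← whiskerLeft_comp, N.actRight_one]
    monoidal
  right_assoc := by
    rw [associator_naturality_right_assoc, ← whiskerLeft_comp, N.right_assoc]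
    simp only [comp_whiskerRight, whiskerLeft_comp, Category.assoc]
    rw [associator_naturality_middle_assoc]
    monoidal
  middle_assoc := by
    simp only [comp_whiskerRight, whiskerLeft_comp, Category.assoc]
    rw [associator_naturality_left_assoc, ← whisker_exchange, associator_inv_naturality_right_assoc]
    monoidal

/-- Acting on `M` and `N` with the two factors in the middle of `(M ⊗ (B ⊗ B)) ⊗ N`. -/
def midAct (M : Bimod A B) (N : Bimod B D) : (M.X ⊗ (B.X ⊗ B.X)) ⊗ N.X ⟶ M.X ⊗ N.X :=
  (α_ M.X B.X B.X).inv ▷ N.X ≫ (α_ (M.X ⊗ B.X) B.X N.X).hom ≫ (M.actRight ⊗ₘ N.actLeft)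

/-- Insertion of `Δ ∘ η` between `M` and `N`. -/
def insertSection (Δ : B.X ⟶ B.X ⊗ B.X) (M : Bimod A B) (N : Bimod B D) :
    M.X ⊗ N.X ⟶ M.X ⊗ N.X :=
  (ρ_ M.X).inv ▷ N.X ≫ (M.X ◁ (η[B.X] ≫ Δ)) ▷ N.X ≫ midAct M N

variable {Δ : B.X ⟶ B.X ⊗ B.X} (M : Bimod A B) (N : Bimod B D)

/-- The axiom `middle_assoc` of `M` exchanges the action of `A` with that of `B` on `M`; the action
of `B` on `N` takes place in another tensor factor. `midAct_actRight` is the mirror image, with the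
axiom of `N`. -/
theorem actLeft_midAct : (A.X ◁ midAct M N) ≫ (α_ A.X M.X N.X).inv ≫ M.actLeft ▷ N.X =
    (α_ _ _ _).inv ≫ (α_ _ _ _).inv ▷ N.X ≫ (M.actLeft ▷ (B.X ⊗ B.X)) ▷ N.X ≫ midAct M N := by
  have h : (A.X ◁ M.actRight) ≫ M.actLeft = (α_ _ _ _).inv ≫ M.actLeft ▷ B.X ≫ M.actRight := by
    rw [M.middle_assoc, Iso.inv_hom_id_assoc]
  simp only [midAct, MonoidalCategory.tensorHom_def', whiskerLeft_comp, Category.assoc]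
  rw [associator_inv_naturality_middle_assoc, ← comp_whiskerRight, h,
    associator_inv_naturality_right_assoc]
  simp only [comp_whiskerRight]
  rw [whisker_exchange_assoc, whisker_exchange_assoc, ← comp_whiskerRight_assoc (M.actLeft ▷ _),
    associator_inv_naturality_left, comp_whiskerRight_assoc, associator_naturality_left_assoc]
  monoidal

theorem midAct_actRight : (midAct M N ▷ D.X) ≫ (α_ M.X N.X D.X).hom ≫ M.X ◁ N.actRight =
    (α_ _ _ _).hom ≫ (M.X ⊗ (B.X ⊗ B.X)) ◁ N.actRight ≫ midAct M N := by
  simp only [midAct, MonoidalCategory.tensorHom_def, comp_whiskerRight, Category.assoc]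
  rw [associator_naturality_middle_assoc, ← whiskerLeft_comp, N.middle_assoc,
    associator_naturality_left_assoc, whisker_exchange_assoc]
  simp only [whiskerLeft_comp]
  rw [← whisker_exchange_assoc, ← whisker_exchange_assoc, associator_naturality_right_assoc]
  monoidal

/-- Outer actions and the insertion happen at opposite ends of `M`, so naturality and the bimodule
axioms suffice, for an arbitrary `Δ`. With `insertSection_actRight` this makes the insertion an
endomorphism of the bimodule `outer M N`. -/
theorem actLeft_insertSection :
    (A.X ◁ insertSection Δ M N) ≫ (outer M N).actLeft =
      (outer M N).actLeft ≫ insertSection Δ M N := by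
  change (A.X ◁ insertSection Δ M N) ≫ (α_ _ _ _).inv ≫ M.actLeft ▷ N.X =
    ((α_ _ _ _).inv ≫ M.actLeft ▷ N.X) ≫ insertSection Δ M N
  simp only [insertSection, Category.assoc]
  -- Making the inserted morphism opaque keeps `simp` from distributing whiskerings over `η ≫ Δ`.
  generalize η[B.X] ≫ Δ = J
  simp only [whiskerLeft_comp, Category.assoc]
  rw [actLeft_midAct, associator_inv_naturality_middle_assoc]
  simp only [← comp_whiskerRight_assoc, Category.assoc]
  rw [associator_inv_naturality_right_assoc, whisker_exchange,
    rightUnitor_inv_naturality_assoc, associator_inv_naturality_middle_assoc]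
  simp only [← comp_whiskerRight_assoc, Category.assoc]
  rw [← Category.assoc (A.X ◁ (ρ_ M.X).inv)]
  congr 3
  monoidal

theorem insertSection_actRight :
    (insertSection Δ M N ▷ D.X) ≫ (outer M N).actRight =
      (outer M N).actRight ≫ insertSection Δ M N := by
  change (insertSection Δ M N ▷ D.X) ≫ (α_ _ _ _).hom ≫ M.X ◁ N.actRight =
    ((α_ _ _ _).hom ≫ M.X ◁ N.actRight) ≫ insertSection Δ M N
  simp only [insertSection, Category.assoc]
  generalize η[B.X] ≫ Δ = J
  simp only [comp_whiskerRight, Category.assoc]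
  rw [midAct_actRight, whisker_exchange_assoc, whisker_exchange_assoc,
    associator_naturality_left_assoc, associator_naturality_left_assoc]

/-- By associativity of the right action on `M`, a preceding action of `b` becomes left
multiplication by `b` on the first factor of `B ⊗ B`. `midAct_actLeft` is the analogue for `N` and
the second factor. -/
theorem actRight_midAct : (M.actRight ▷ (B.X ⊗ B.X)) ▷ N.X ≫ midAct M N =
    (α_ M.X B.X (B.X ⊗ B.X)).hom ▷ N.X ≫
      (M.X ◁ ((α_ _ _ _).inv ≫ μ[B.X] ▷ B.X)) ▷ N.X ≫ midAct M N := by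
  have h : M.actRight ▷ B.X ≫ M.actRight = (α_ _ _ _).hom ≫ M.X ◁ μ[B.X] ≫ M.actRight := by
    rw [M.right_assoc, Iso.hom_inv_id_assoc]
  simp only [midAct, MonoidalCategory.tensorHom_def, Category.assoc]
  rw [← comp_whiskerRight_assoc (M.actRight ▷ _), associator_inv_naturality_left,
    comp_whiskerRight_assoc, associator_naturality_left_assoc, ← comp_whiskerRight_assoc _ M.actRight,
    h]
  simp only [comp_whiskerRight, whiskerLeft_comp, Category.assoc]
  rw [← comp_whiskerRight_assoc (M.X ◁ μ[B.X] ▷ B.X), associator_inv_naturality_middle,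
    comp_whiskerRight_assoc, associator_naturality_left_assoc]
  monoidal

theorem midAct_actLeft : ((M.X ⊗ (B.X ⊗ B.X)) ◁ N.actLeft) ≫ midAct M N =
    (α_ _ _ _).inv ≫ (α_ _ _ _).hom ▷ N.X ≫
      (M.X ◁ ((α_ _ _ _).hom ≫ B.X ◁ μ[B.X])) ▷ N.X ≫ midAct M N := by
  have h : B.X ◁ N.actLeft ≫ N.actLeft = (α_ _ _ _).inv ≫ μ[B.X] ▷ N.X ≫ N.actLeft := by
    rw [N.left_assoc, Iso.inv_hom_id_assoc]
  simp only [midAct, MonoidalCategory.tensorHom_def', Category.assoc]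
  rw [whisker_exchange_assoc, associator_naturality_right_assoc, ← whiskerLeft_comp_assoc _ _ N.actLeft,
    h]
  simp only [comp_whiskerRight, whiskerLeft_comp, Category.assoc]
  rw [← comp_whiskerRight_assoc (M.X ◁ B.X ◁ μ[B.X]), associator_inv_naturality_right,
    comp_whiskerRight_assoc, associator_naturality_middle_assoc]
  monoidal

/-- Left linearity gives `b · Δ(1) = Δ(b)`, so an element acting on `M` before the insertion is
absorbed into `Δ`. -/
theorem actRight_insertSection (h : IsSeparableSection B Δ) :
    (M.actRight ▷ N.X) ≫ insertSection Δ M N = (M.X ◁ Δ) ▷ N.X ≫ midAct M N := by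
  have h1 : B.X ◁ (η[B.X] ≫ Δ) ≫ (α_ _ _ _).inv ≫ μ[B.X] ▷ B.X = (ρ_ _).hom ≫ Δ := by
    rw [whiskerLeft_comp, Category.assoc, h.left_linear, mul_one_assoc]
  simp only [insertSection]
  generalize η[B.X] ≫ Δ = J at h1 ⊢
  simp only [← comp_whiskerRight_assoc, Category.assoc]
  rw [rightUnitor_inv_naturality_assoc, ← whisker_exchange, ← Category.assoc,
    comp_whiskerRight_assoc, actRight_midAct]
  simp only [← comp_whiskerRight_assoc, Category.assoc]
  rw [associator_naturality_right_assoc, ← whiskerLeft_comp, h1, whiskerLeft_comp]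
  congr 2
  monoidal

/-- Here `Δ(1) · b = Δ(b)`. Since the right side is that of `actRight_insertSection`, an element of
`B` may be moved from `M` to `N` in front of the insertion: the insertion is balanced over `B`. -/
theorem actLeft_insertSection' (h : IsSeparableSection B Δ) :
    (α_ _ _ _).hom ≫ (M.X ◁ N.actLeft) ≫ insertSection Δ M N = (M.X ◁ Δ) ▷ N.X ≫ midAct M N := by
  have h1 : (η[B.X] ≫ Δ) ▷ B.X ≫ (α_ _ _ _).hom ≫ B.X ◁ μ[B.X] = (λ_ _).hom ≫ Δ := by
    rw [comp_whiskerRight, Category.assoc, h.right_linear, one_mul_assoc]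
  simp only [insertSection]
  generalize η[B.X] ≫ Δ = J at h1 ⊢
  rw [whisker_exchange_assoc, whisker_exchange_assoc, midAct_actLeft,
    associator_inv_naturality_left_assoc, ← associator_naturality_left_assoc]
  simp only [← comp_whiskerRight_assoc, Category.assoc]
  rw [associator_naturality_middle_assoc, ← whiskerLeft_comp, h1, whiskerLeft_comp,
    Iso.hom_inv_id_assoc]
  simp only [comp_whiskerRight_assoc, comp_whiskerRight, Category.assoc]
  monoidal

/-- Write `Δ(1) = ∑ bᵢ ⊗ bᵢ'`. By balancedness, in front of a second insertion all of `bᵢ` can be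
moved over to `N`, where `∑ bᵢ bᵢ' = 1` acts trivially. -/
theorem insertSection_idem (h : IsSeparableSection B Δ) :
    insertSection Δ M N ≫ insertSection Δ M N = insertSection Δ M N := by
  -- A middle action followed by an insertion only depends on the product of the two factors from
  -- `B`.
  have h1 : midAct M N ≫ insertSection Δ M N =
      (M.X ◁ μ[B.X]) ▷ N.X ≫ (α_ _ _ _).hom ≫ M.X ◁ N.actLeft ≫ insertSection Δ M N := by
    simp only [midAct, MonoidalCategory.tensorHom_def', Category.assoc]
    rw [actRight_insertSection M N h, ← actLeft_insertSection' M N h]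
    rw [associator_naturality_middle_assoc, ← whiskerLeft_comp_assoc, N.left_assoc]
    simp only [whiskerLeft_comp, Category.assoc]
    rw [associator_naturality_right_assoc]
    monoidal
  have h2 : insertSection Δ M N ≫ insertSection Δ M N = (ρ_ M.X).inv ▷ N.X ≫
      (M.X ◁ (η[B.X] ≫ Δ)) ▷ N.X ≫ midAct M N ≫ insertSection Δ M N := by
    conv_lhs => enter [1]; rw [insertSection]
    simp only [Category.assoc]
  rw [h2, h1, ← comp_whiskerRight_assoc (M.X ◁ _), ← whiskerLeft_comp, Category.assoc, h.isSection,
    Category.comp_id, associator_naturality_middle_assoc, ← whiskerLeft_comp_assoc, N.one_actLeft]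
  monoidal

/-- Separates the outer actions from the insertion. The only exchange needed is between the actions
of `A` and `B` on `M`: `biact N` already applies the outer action of `D` before that of `B`. -/
theorem tensorBiact_eq : tensorBiact Δ M N = biact (outer M N) ≫ insertSection Δ M N := by
  have h : A.X ◁ M.actRight ≫ M.actLeft = (α_ _ _ _).inv ≫ M.actLeft ▷ B.X ≫ M.actRight := by
    rw [M.middle_assoc, Iso.inv_hom_id_assoc]
  have h2 : (biact M ⊗ₘ biact N) = (α_ A.X M.X B.X).inv ▷ (B.X ⊗ (N.X ⊗ D.X)) ≫
      (M.actLeft ▷ B.X) ▷ (B.X ⊗ (N.X ⊗ D.X)) ≫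
      (M.X ⊗ B.X) ◁ (B.X ◁ N.actRight) ≫ (M.actRight ⊗ₘ N.actLeft) := by
    rw [biact, biact, h]
    simp only [MonoidalCategory.tensorHom_def, comp_whiskerRight, whiskerLeft_comp, Category.assoc]
    rw [whisker_exchange_assoc]
  change _ = (A.X ◁ ((α_ _ _ _).hom ≫ M.X ◁ N.actRight) ≫ (α_ _ _ _).inv ≫ M.actLeft ▷ N.X) ≫ _
  rw [tensorBiact, h2]
  simp only [insertSection, midAct, Category.assoc, whiskerLeft_comp]
  generalize η[B.X] = e
  rw [associator_inv_naturality_right_assoc, whisker_exchange_assoc]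
  simp only [← comp_whiskerRight_assoc]
  simp only [Category.assoc]
  rw [whisker_exchange_assoc _ N.actRight, associator_naturality_right_assoc,
    ← comp_whiskerRight_assoc M.actLeft, rightUnitor_inv_naturality_assoc,
    ← whisker_exchange_assoc M.actLeft, ← whisker_exchange_assoc M.actLeft,
    associator_inv_naturality_left]
  simp only [comp_whiskerRight, Category.assoc, associator_naturality_left_assoc]
  monoidal

theorem unit_biact (O : Bimod A D) : (ρ_ O.X).inv ≫ (λ_ (O.X ⊗ 𝟙_ C)).inv ≫
    (η[A.X] ⊗ₘ (𝟙 O.X ⊗ₘ η[D.X])) ≫ biact O = 𝟙 O.X := by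
  rw [biact, MonoidalCategory.tensorHom_def, id_tensorHom, Category.assoc, ← whiskerLeft_comp_assoc, O.actRight_one,
    ← whisker_exchange_assoc, O.one_actLeft]
  monoidal

theorem sepIdem_eq : sepIdem Δ M N = insertSection Δ M N := by
  -- Stated for arbitrary `b` because `(outer M N).X` agrees with `M.X ⊗ N.X` only after unfolding,
  -- which blocks direct rewriting.
  have key : ∀ b : A.X ⊗ ((M.X ⊗ N.X) ⊗ D.X) ⟶ M.X ⊗ N.X,
      (ρ_ (M.X ⊗ N.X)).inv ≫ (λ_ ((M.X ⊗ N.X) ⊗ 𝟙_ C)).inv ≫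
        (η[A.X] ⊗ₘ (𝟙 (M.X ⊗ N.X) ⊗ₘ η[D.X])) ≫ b = 𝟙 _ →
      (ρ_ (M.X ⊗ N.X)).inv ≫ (λ_ ((M.X ⊗ N.X) ⊗ 𝟙_ C)).inv ≫
        (η[A.X] ⊗ₘ (𝟙 (M.X ⊗ N.X) ⊗ₘ η[D.X])) ≫ b ≫ insertSection Δ M N =
      insertSection Δ M N := fun b hb => by rw [reassoc_of% hb]
  rw [sepIdem, tensorBiact_eq]
  exact key _ (unit_biact (outer M N))

theorem insertSection_naturality {M M' : Bimod A B} {N N' : Bimod B D} (f : M ⟶ M') (g : N ⟶ N') :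
    (f.hom ⊗ₘ g.hom) ≫ insertSection Δ M' N' = insertSection Δ M N ≫ (f.hom ⊗ₘ g.hom) := by
  have h : (M.actRight ⊗ₘ N.actLeft) ≫ (f.hom ⊗ₘ g.hom) =
      (f.hom ▷ B.X ⊗ₘ B.X ◁ g.hom) ≫ (M'.actRight ⊗ₘ N'.actLeft) := by
    rw [tensorHom_comp_tensorHom, tensorHom_comp_tensorHom]
    exact congrArg₂ _ f.right_act_hom g.left_act_hom
  simp only [insertSection, midAct, Category.assoc, h]
  simp only [MonoidalCategory.tensorHom_def, Category.assoc]
  rw [whisker_exchange_assoc, whisker_exchange_assoc, whisker_exchange_assoc,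
    associator_naturality_right_assoc, ← associator_naturality_left_assoc]
  simp only [← comp_whiskerRight_assoc, Category.assoc]
  rw [rightUnitor_inv_naturality_assoc, ← whisker_exchange_assoc, associator_inv_naturality_left]

/-- A bimodule structure on a retract of the underlying object of a bimodule. -/
def retract (O : Bimod A D) {e : O.X ⟶ O.X} (hl : A.X ◁ e ≫ O.actLeft = O.actLeft ≫ e)
    (hr : e ▷ D.X ≫ O.actRight = O.actRight ≫ e) {T : C} (s : O.X ⟶ T) (r : T ⟶ O.X)
    (hsr : s ≫ r = e) (hrs : r ≫ s = 𝟙 T) : Bimod A D where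
  X := T
  actLeft := A.X ◁ r ≫ O.actLeft ≫ s
  actRight := r ▷ D.X ≫ O.actRight ≫ s
  one_actLeft := by
    rw [← whisker_exchange_assoc, O.one_actLeft_assoc, leftUnitor_naturality_assoc, hrs,
      Category.comp_id]
  actRight_one := by
    rw [whisker_exchange_assoc, O.actRight_one_assoc, rightUnitor_naturality_assoc, hrs,
      Category.comp_id]
  left_assoc := by
    have h1 : e ≫ s = s := by rw [← hsr, Category.assoc, hrs, Category.comp_id]
    -- The composite `s ≫ r = e` commutes with the action and is absorbed by `s`, so `s` is
    -- equivariant.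
    have h2 : A.X ◁ s ≫ A.X ◁ r ≫ O.actLeft ≫ s = O.actLeft ≫ s := by
      rw [← whiskerLeft_comp_assoc, hsr, reassoc_of% hl, h1]
    simp only [whiskerLeft_comp, Category.assoc]
    rw [h2, ← whisker_exchange_assoc, O.left_assoc_assoc, associator_naturality_right_assoc]
  right_assoc := by
    have h1 : e ≫ s = s := by rw [← hsr, Category.assoc, hrs, Category.comp_id]
    have h2 : s ▷ D.X ≫ r ▷ D.X ≫ O.actRight ≫ s = O.actRight ≫ s := by
      rw [← comp_whiskerRight_assoc, hsr, reassoc_of% hr, h1]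
    simp only [comp_whiskerRight, Category.assoc]
    rw [h2, whisker_exchange_assoc, O.right_assoc_assoc, associator_inv_naturality_left_assoc]
  middle_assoc := by
    have h1 : e ≫ s = s := by rw [← hsr, Category.assoc, hrs, Category.comp_id]
    have h2 : s ▷ D.X ≫ r ▷ D.X ≫ O.actRight ≫ s = O.actRight ≫ s := by
      rw [← comp_whiskerRight_assoc, hsr, reassoc_of% hr, h1]
    have h3 : A.X ◁ s ≫ A.X ◁ r ≫ O.actLeft ≫ s = O.actLeft ≫ s := by
      rw [← whiskerLeft_comp_assoc, hsr, reassoc_of% hl, h1]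
    simp only [comp_whiskerRight, whiskerLeft_comp, Category.assoc]
    rw [h2, h3, O.middle_assoc_assoc, associator_naturality_middle_assoc]

theorem retract_biact (O : Bimod A D) {e : O.X ⟶ O.X} (hl : A.X ◁ e ≫ O.actLeft = O.actLeft ≫ e)
    (hr : e ▷ D.X ≫ O.actRight = O.actRight ≫ e) {T : C} (s : O.X ⟶ T) (r : T ⟶ O.X)
    (hsr : s ≫ r = e) (hrs : r ≫ s = 𝟙 T) :
    biact (retract O hl hr s r hsr hrs) = A.X ◁ (r ▷ D.X) ≫ biact O ≫ s := by
  have h1 : e ≫ s = s := by rw [← hsr, Category.assoc, hrs, Category.comp_id]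
  change A.X ◁ (r ▷ D.X ≫ O.actRight ≫ s) ≫ A.X ◁ r ≫ O.actLeft ≫ s = _
  rw [biact]
  simp only [whiskerLeft_comp, Category.assoc]
  rw [← whiskerLeft_comp_assoc _ s, hsr, reassoc_of% hl, h1]

end Monoidal

/-! ### Structure maps on homogeneous vectors -/

section Elementwise

variable {G : Type} [Groupoid.{0} G] {α : Cocycle₃ G} [Fintype G] [∀ X Y : G, Fintype (X ⟶ Y)]

namespace GrVec

/-- The vector `v ⊗ w` in degree `k = fg`. -/
def tn {V W : GrVec α} {X Y Z : G} (f : X ⟶ Y) (g : Y ⟶ Z) {k : X ⟶ Z} (e : f ≫ g = k)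
    (v : V.deg f) (w : W.deg g) : (V ⊗ W).deg k := tm f g e v w

/-- `tn` as a bilinear map. -/
def tnL {V W : GrVec α} {X Y Z : G} (f : X ⟶ Y) (g : Y ⟶ Z) {k : X ⟶ Z} (e : f ≫ g = k) :
    V.deg f →ₗ[ℂ] W.deg g →ₗ[ℂ] (V ⊗ W).deg k := tmL f g e

/-- The basis vector of the tensor unit in degree `id_X`. -/
def uvec (α : Cocycle₃ G) (X : G) : (𝟙_ (GrVec α)).deg (𝟙 X) := unitVec α X

variable {U V W V' W' : GrVec α} {X Y Z T : G}

@[simp] theorem tnL_apply (a : X ⟶ Y) (b : Y ⟶ Z) {k : X ⟶ Z} (e : a ≫ b = k)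
    (v : V.deg a) (w : W.deg b) : tnL a b e v w = tn a b e v w := rfl

theorem whiskerLeft_tn (f : W ⟶ W') (a : X ⟶ Y) (b : Y ⟶ Z) {k : X ⟶ Z} (e : a ≫ b = k)
    (v : V.deg a) (w : W.deg b) :
    Hom.app (V ◁ f) k (tn a b e v w) = tn a b e v (f.app b w) :=
  tensorMap_tm (𝟙 V) f a b e v w

theorem whiskerRight_tn (f : V ⟶ V') (a : X ⟶ Y) (b : Y ⟶ Z) {k : X ⟶ Z} (e : a ≫ b = k)
    (v : V.deg a) (w : W.deg b) :
    Hom.app (f ▷ W) k (tn a b e v w) = tn a b e (f.app a v) w :=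
  tensorMap_tm f (𝟙 W) a b e v w

theorem tensorHom_tn (f : V ⟶ V') (g : W ⟶ W') (a : X ⟶ Y) (b : Y ⟶ Z) {k : X ⟶ Z}
    (e : a ≫ b = k) (v : V.deg a) (w : W.deg b) :
    Hom.app (f ⊗ₘ g) k (tn a b e v w) = tn a b e (f.app a v) (g.app b w) :=
  tensorMap_tm f g a b e v w

theorem associator_hom_tn (f : X ⟶ Y) (g : Y ⟶ Z)
    (h : Z ⟶ T) {k : X ⟶ T} {l : X ⟶ Z} {m : Y ⟶ T} (e : f ≫ g = l) (e' : l ≫ h = k)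
    (e₁ : g ≫ h = m) (e₂ : f ≫ m = k) (u : U.deg f) (v : V.deg g) (w : W.deg h) :
    Hom.app (α_ U V W).hom k (tn l h e' (tn f g e u v) w) =
      (α.toFun f g h : ℂ) • tn f m e₂ u (tn g h e₁ v w) :=
  assocFwd_tm f g h e e' e₁ e₂ u v w

theorem associator_inv_tn (f : X ⟶ Y) (g : Y ⟶ Z)
    (h : Z ⟶ T) {k : X ⟶ T} {l : X ⟶ Z} {m : Y ⟶ T} (e : f ≫ g = l) (e' : l ≫ h = k)
    (e₁ : g ≫ h = m) (e₂ : f ≫ m = k) (u : U.deg f) (v : V.deg g) (w : W.deg h) :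
    Hom.app (α_ U V W).inv k (tn f m e₂ u (tn g h e₁ v w)) =
      (((α.toFun f g h)⁻¹ : Circle) : ℂ) • tn l h e' (tn f g e u v) w :=
  assocBwd_tm f g h e e' e₁ e₂ u v w

theorem leftUnitor_inv_tn (k : X ⟶ Y) (v : V.deg k) :
    Hom.app (λ_ V).inv k v = tn (𝟙 X) k (Category.id_comp k) (uvec α X) v := rfl

theorem rightUnitor_inv_tn (k : X ⟶ Y) (v : V.deg k) :
    Hom.app (ρ_ V).inv k v = tn k (𝟙 Y) (Category.comp_id k) v (uvec α Y) := rfl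

theorem app_congr {f g : V ⟶ W} (h : f = g) {k : X ⟶ Y} (v : V.deg k) : f.app k v = g.app k v := by
  rw [h]

theorem comp_app_apply (f : U ⟶ V) (g : V ⟶ W) {k : X ⟶ Y} (v : U.deg k) :
    (f ≫ g).app k v = g.app k (f.app k v) := rfl

theorem id_app_apply {k : X ⟶ Y} (v : U.deg k) : Hom.app (𝟙 U) k v = v := rfl

theorem leftUnitor_hom_tn (k : X ⟶ Y) (v : V.deg k) :
    Hom.app (λ_ V).hom k (tn (𝟙 X) k (Category.id_comp k) (uvec α X) v) = v :=
  app_congr (λ_ V).inv_hom_id v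

theorem rightUnitor_hom_tn (k : X ⟶ Y) (v : V.deg k) :
    Hom.app (ρ_ V).hom k (tn k (𝟙 Y) (Category.comp_id k) v (uvec α Y)) = v :=
  app_congr (ρ_ V).inv_hom_id v

section

variable (a : X ⟶ Y) (b : Y ⟶ Z) {k : X ⟶ Z} (e : a ≫ b = k)

theorem tn_zero_left (w : W.deg b) : tn (V := V) a b e 0 w = 0 := by
  rw [← tnL_apply, map_zero, LinearMap.zero_apply]

theorem tn_zero_right (v : V.deg a) : tn (W := W) a b e v 0 = 0 := by
  rw [← tnL_apply, map_zero]

theorem tn_smul_left (c : ℂ) (v : V.deg a) (w : W.deg b) :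
    tn a b e (c • v) w = c • tn a b e v w := by
  simp only [← tnL_apply, map_smul, LinearMap.smul_apply]

theorem tn_smul_right (c : ℂ) (v : V.deg a) (w : W.deg b) :
    tn a b e v (c • w) = c • tn a b e v w := by
  simp only [← tnL_apply, map_smul]

theorem tn_sum_left {ι : Type} (s : Finset ι) (v : ι → V.deg a) (w : W.deg b) :
    tn a b e (∑ i ∈ s, v i) w = ∑ i ∈ s, tn a b e (v i) w := by
  simp only [← tnL_apply, map_sum, LinearMap.sum_apply]

theorem tn_sum_right {ι : Type} (s : Finset ι) (v : V.deg a) (w : ι → W.deg b) :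
    tn a b e v (∑ i ∈ s, w i) = ∑ i ∈ s, tn a b e v (w i) := by
  simp only [← tnL_apply, map_sum]

end

theorem tensor_hom_ext {f g : V ⊗ W ⟶ U}
    (h : ∀ {X Y Z : G} (a : X ⟶ Y) (b : Y ⟶ Z) (v : V.deg a) (w : W.deg b),
      f.app (a ≫ b) (tn a b rfl v w) = g.app (a ≫ b) (tn a b rfl v w)) : f = g := by
  apply hom_ext; intro X Z k
  apply tensor_ext
  rintro Y a b e v w
  cases e
  exact h a b v w

end GrVec

namespace TwistedSubgroupoid

variable (P : TwistedSubgroupoid α) {X Y Z : G}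

/-- The basis vector of `P.alg` in degree `a ∈ Hom(A)`, and `0` in the other degrees. -/
def avec (g : X ⟶ Y) : P.alg.X.deg g := P.vec g

/-- The coordinate of a homogeneous vector of `P.alg`. -/
def aval (g : X ⟶ Y) : P.alg.X.deg g →ₗ[ℂ] ℂ := P.val g

theorem aval_injective (g : X ⟶ Y) : Function.Injective (P.aval g) := P.val_injective g

theorem aval_avec {g : X ⟶ Y} (h : g ∈ P.sub.arrows X Y) : P.aval g (P.avec g) = 1 := by
  change Set.indicator (P.sub.arrows X Y) 1 g * (1 : ℂ) = 1
  rw [Set.indicator_of_mem h, Pi.one_apply, _root_.mul_one]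

theorem avec_eq_zero {g : X ⟶ Y} (h : g ∉ P.sub.arrows X Y) : P.avec g = 0 := by
  apply P.aval_injective
  change Set.indicator (P.sub.arrows X Y) 1 g * (1 : ℂ) = 0
  rw [Set.indicator_of_notMem h, zero_mul]

theorem eq_zero_of_notMem {g : X ⟶ Y} (h : g ∉ P.sub.arrows X Y) (c : P.alg.X.deg g) : c = 0 := by
  apply P.aval_injective
  rw [map_zero]
  by_contra h0
  exact h (P.mem_of_val_ne_zero h0)

/-- Valid in every degree, because `avec` and the components of the algebra vanish outside the
subgroupoid. The same extension by zero lets `mul_avec` be stated without membership hypotheses. -/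
theorem eq_smul_avec {g : X ⟶ Y} (c : P.alg.X.deg g) : c = P.aval g c • P.avec g := by
  by_cases h : g ∈ P.sub.arrows X Y
  · apply P.aval_injective
    rw [map_smul, P.aval_avec h, smul_eq_mul, _root_.mul_one]
  · rw [P.avec_eq_zero h, smul_zero, P.eq_zero_of_notMem h c]

theorem mul_avec (f : X ⟶ Y) (g : Y ⟶ Z) {k : X ⟶ Z} (e : f ≫ g = k) :
    Hom.app (MonObj.mul (X := P.alg.X)) k (tn f g e (P.avec f) (P.avec g)) =
      P.coeff f g • P.avec k := by
  apply P.aval_injective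
  rw [map_smul, smul_eq_mul]
  refine (P.val_mul f g e (P.vec f) (P.vec g)).trans ?_
  by_cases h : f ∈ P.sub.arrows X Y ∧ g ∈ P.sub.arrows Y Z
  · have h' : k ∈ P.sub.arrows X Z := e ▸ P.sub.mul h.1 h.2
    erw [P.aval_avec h.1, P.aval_avec h.2, P.aval_avec h', _root_.mul_one]
  · rw [coeff, dif_neg h, zero_mul, zero_mul]

theorem one_uvec (X : G) :
    Hom.app (MonObj.one (X := P.alg.X)) (𝟙 X) (uvec α X) = P.avec (𝟙 X) := rfl

theorem coeff_ne_zero {f : X ⟶ Y} {g : Y ⟶ Z} (hf : f ∈ P.sub.arrows X Y)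
    (hg : g ∈ P.sub.arrows Y Z) : P.coeff f g ≠ 0 := by
  rw [P.coeff_of_mem hf hg]
  exact Circle.coe_ne_zero _

theorem id_mem_iff (X : G) : 𝟙 X ∈ P.sub.arrows X X ↔ X ∈ P.sub.objs :=
  ⟨fun h => ⟨_, h⟩, fun ⟨_, h⟩ => P.sub.id_mem_of_src h⟩

theorem coeff_eq_zero {f : X ⟶ Y} {g : Y ⟶ Z}
    (h : ¬(f ∈ P.sub.arrows X Y ∧ g ∈ P.sub.arrows Y Z)) : P.coeff f g = 0 := dif_neg h

theorem coeff_id_left {g : X ⟶ Y} (h : g ∈ P.sub.arrows X Y) : P.coeff (𝟙 X) g = 1 := by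
  rw [P.coeff_of_mem (P.sub.id_mem_of_src h) h]
  exact congrArg _ (P.normalised.id_left (P.lift g h))

theorem coeff_id_right {g : X ⟶ Y} (h : g ∈ P.sub.arrows X Y) : P.coeff g (𝟙 Y) = 1 := by
  rw [P.coeff_of_mem h (P.sub.id_mem_of_tgt h)]
  exact congrArg _ (P.normalised.id_right (P.lift g h))

/-- Maps out of `A_φ ⊗ V` are determined on the basis vectors of `A_φ`. -/
theorem ext_left {V W : GrVec α} {f g : P.alg.X ⊗ V ⟶ W}
    (h : ∀ {X Y Z : G} (a : X ⟶ Y) (b : Y ⟶ Z), a ∈ P.sub.arrows X Y → ∀ v : V.deg b,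
      f.app (a ≫ b) (tn a b rfl (P.avec a) v) = g.app (a ≫ b) (tn a b rfl (P.avec a) v)) :
    f = g := by
  apply tensor_hom_ext
  intro X Y Z a b c v
  by_cases ha : a ∈ P.sub.arrows X Y
  · rw [P.eq_smul_avec c, tn_smul_left, map_smul, map_smul, h a b ha]
  · rw [P.eq_zero_of_notMem ha c, tn_zero_left, map_zero, map_zero]

/-- Maps out of `V ⊗ A_φ` are determined on the basis vectors of `A_φ`. -/
theorem ext_right {V W : GrVec α} {f g : V ⊗ P.alg.X ⟶ W}
    (h : ∀ {X Y Z : G} (a : X ⟶ Y) (b : Y ⟶ Z), b ∈ P.sub.arrows Y Z → ∀ v : V.deg a,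
      f.app (a ≫ b) (tn a b rfl v (P.avec b)) = g.app (a ≫ b) (tn a b rfl v (P.avec b))) :
    f = g := by
  apply tensor_hom_ext
  intro X Y Z a b v c
  by_cases hb : b ∈ P.sub.arrows Y Z
  · rw [P.eq_smul_avec c, tn_smul_right, map_smul, map_smul, h a b hb]
  · rw [P.eq_zero_of_notMem hb c, tn_zero_right, map_zero, map_zero]

end TwistedSubgroupoid

/-! ### Bimodules over algebras of subgroupoids -/

section Bimodules

variable {P Q : TwistedSubgroupoid α} (M : Bimod P.alg Q.alg) {W X Y Z T : G}

/-- The left action of a basis vector of `P.alg` in degree `a`. -/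
def lact (a : X ⟶ Y) (g : Y ⟶ Z) {k : X ⟶ Z} (e : a ≫ g = k) : M.X.deg g →ₗ[ℂ] M.X.deg k :=
  M.actLeft.app k ∘ₗ tnL a g e (P.avec a)

/-- The right action of a basis vector of `Q.alg` in degree `b`. -/
def ract (g : X ⟶ Y) (b : Y ⟶ Z) {k : X ⟶ Z} (e : g ≫ b = k) : M.X.deg g →ₗ[ℂ] M.X.deg k :=
  M.actRight.app k ∘ₗ (tnL g b e).flip (Q.avec b)

theorem actLeft_tn (a : X ⟶ Y) (g : Y ⟶ Z) {k : X ⟶ Z} (e : a ≫ g = k) (v : M.X.deg g) :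
    M.actLeft.app k (tn a g e (P.avec a) v) = lact M a g e v := rfl

theorem actRight_tn (g : X ⟶ Y) (b : Y ⟶ Z) {k : X ⟶ Z} (e : g ≫ b = k) (v : M.X.deg g) :
    M.actRight.app k (tn g b e v (Q.avec b)) = ract M g b e v := rfl

theorem biact_tn (a : W ⟶ X) (g : X ⟶ Y) (b : Y ⟶ Z) {l : X ⟶ Z} {k : W ⟶ Z} (e : g ≫ b = l)
    (e' : a ≫ l = k) (v : M.X.deg g) :
    (biact M).app k (tn a l e' (P.avec a) (tn g b e v (Q.avec b))) =
      lact M a l e' (ract M g b e v) := by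
  rw [biact, comp_app_apply, whiskerLeft_tn, actRight_tn, actLeft_tn]

theorem lact_id (g : X ⟶ Y) (v : M.X.deg g) : lact M (𝟙 X) g (Category.id_comp g) v = v := by
  have h := app_congr M.one_actLeft (tn (𝟙 X) g (Category.id_comp g) (uvec α X) v)
  rwa [leftUnitor_hom_tn, comp_app_apply, whiskerRight_tn] at h

theorem ract_id (g : X ⟶ Y) (v : M.X.deg g) : ract M g (𝟙 Y) (Category.comp_id g) v = v := by
  have h := app_congr M.actRight_one (tn g (𝟙 Y) (Category.comp_id g) v (uvec α Y))
  rwa [rightUnitor_hom_tn, comp_app_apply, whiskerLeft_tn] at h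

/-- Left associativity, with the value of `α` kept on the left so that no inverse occurs. In
`ract_ract` the inverse associator has been moved to the other side for the same reason. -/
theorem lact_lact (a' : W ⟶ X) (a : X ⟶ Y) (g : Y ⟶ Z) {k : X ⟶ Z} {l : W ⟶ Z} {c : W ⟶ Y}
    (e : a ≫ g = k) (e' : a' ≫ k = l) (e₁ : a' ≫ a = c) (e₂ : c ≫ g = l) (v : M.X.deg g) :
    (α.toFun a' a g : ℂ) • lact M a' k e' (lact M a g e v) = P.coeff a' a • lact M c g e₂ v := by
  have h := app_congr M.left_assoc (tn c g e₂ (tn a' a e₁ (P.avec a') (P.avec a)) v)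
  rw [comp_app_apply, comp_app_apply, comp_app_apply, associator_hom_tn a' a g e₁ e₂ e e',
    map_smul, map_smul, whiskerRight_tn, whiskerLeft_tn, P.mul_avec, tn_smul_left, map_smul] at h
  exact h.symm

theorem ract_ract (g : W ⟶ X) (b : X ⟶ Y) (b' : Y ⟶ Z) {k : W ⟶ Y} {l : W ⟶ Z} {c : X ⟶ Z}
    (e : g ≫ b = k) (e' : k ≫ b' = l) (e₁ : b ≫ b' = c) (e₂ : g ≫ c = l) (v : M.X.deg g) :
    ract M k b' e' (ract M g b e v) =
      ((α.toFun g b b' : ℂ) * Q.coeff b b') • ract M g c e₂ v := by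
  have h := app_congr M.right_assoc (tn g c e₂ v (tn b b' e₁ (Q.avec b) (Q.avec b')))
  rw [comp_app_apply, comp_app_apply, comp_app_apply, associator_inv_tn g b b' e e' e₁ e₂,
    map_smul, map_smul, whiskerRight_tn, whiskerLeft_tn, Q.mul_avec, tn_smul_right, map_smul] at h
  have h' := congrArg ((α.toFun g b b' : ℂ) • ·) h
  rw [smul_smul, smul_smul, circle_mul_inv, one_smul] at h'
  exact h'.symm

theorem ract_lact (a : W ⟶ X) (g : X ⟶ Y) (b : Y ⟶ Z) {k : W ⟶ Y} {l : W ⟶ Z} {c : X ⟶ Z}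
    (e : a ≫ g = k) (e' : k ≫ b = l) (e₁ : g ≫ b = c) (e₂ : a ≫ c = l) (v : M.X.deg g) :
    ract M k b e' (lact M a g e v) = (α.toFun a g b : ℂ) • lact M a c e₂ (ract M g b e₁ v) := by
  have h := app_congr M.middle_assoc (tn k b e' (tn a g e (P.avec a) v) (Q.avec b))
  rwa [comp_app_apply, comp_app_apply, comp_app_apply, associator_hom_tn a g b e e' e₁ e₂,
    map_smul, map_smul, whiskerRight_tn, whiskerLeft_tn] at h

theorem lact_eq_zero {a : X ⟶ Y} (h : a ∉ P.sub.arrows X Y) (g : Y ⟶ Z) {k : X ⟶ Z}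
    (e : a ≫ g = k) : lact M a g e = 0 := by
  rw [lact, P.avec_eq_zero h, map_zero, LinearMap.comp_zero]

theorem ract_eq_zero {b : Y ⟶ Z} (h : b ∉ Q.sub.arrows Y Z) (g : X ⟶ Y) {k : X ⟶ Z}
    (e : g ≫ b = k) : ract M g b e = 0 := by
  rw [ract, Q.avec_eq_zero h, map_zero, LinearMap.comp_zero]

/-- The units act as the identity, but the unit of `P.alg` has no component at an object outside the
subgroupoid. Hence a bimodule is supported on the degrees that are objects of `Tilde P Q`. -/
theorem deg_eq_zero {g : X ⟶ Y} (h : ¬(X ∈ P.sub.objs ∧ Y ∈ Q.sub.objs)) (v : M.X.deg g) :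
    v = 0 := by
  rw [not_and_or, ← P.id_mem_iff, ← Q.id_mem_iff] at h
  rcases h with h | h
  · rw [← lact_id M g v, lact_eq_zero M h, LinearMap.zero_apply]
  · rw [← ract_id M g v, ract_eq_zero M h, LinearMap.zero_apply]

end Bimodules

end Elementwise

/-! ### The algebra of a twisted subgroupoid is separable -/

section Separable

variable {G : Type} [Groupoid.{0} G] {α : Cocycle₃ G} [Fintype G] [∀ X Y : G, Fintype (X ⟶ Y)]

/-- Factorisations of `k` correspond to factorisations of `a ≫ k`. -/
def Fac.precomp {X Y Z : G} (a : X ⟶ Y) (k : Y ⟶ Z) : Fac k ≃ Fac (a ≫ k) where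
  toFun p := ⟨p.mid, a ≫ p.fst, p.snd, by rw [Category.assoc, p.comp]⟩
  invFun p := ⟨p.mid, Groupoid.inv a ≫ p.fst, p.snd, by simp [p.comp]⟩
  left_inv p := by cases p; simp
  right_inv p := by cases p; simp

/-- Factorisations of `k` correspond to factorisations of `k ≫ b`. -/
def Fac.postcomp {X Y Z : G} (k : X ⟶ Y) (b : Y ⟶ Z) : Fac k ≃ Fac (k ≫ b) where
  toFun p := ⟨p.mid, p.fst, p.snd ≫ b, by rw [← Category.assoc, p.comp]⟩
  invFun p := ⟨p.mid, p.fst, p.snd ≫ Groupoid.inv b, by simp [← Category.assoc, p.comp]⟩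
  left_inv p := by cases p; simp
  right_inv p := by cases p; simp

namespace TwistedSubgroupoid

variable (P : TwistedSubgroupoid α) {W X Y Z : G}

/-- The section of the multiplication of `P.alg`. -/
def asec : P.alg.X ⟶ P.alg.X ⊗ P.alg.X := P.section_

theorem asec_avec {k : X ⟶ Z} (hk : k ∈ P.sub.arrows X Z) :
    P.asec.app k (P.avec k) = (P.outDegree X : ℂ)⁻¹ •
      ∑ p : Fac k, (P.coeff p.fst p.snd)⁻¹ • tn p.fst p.snd p.comp (P.avec p.fst) (P.avec p.snd) := by
  refine (congrArg (· • _) (P.aval_avec hk)).trans (one_smul _ _)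

/-- Composition with `k` is a bijection between the morphisms out of its two ends. This makes the
normalising factor of `Δ` compatible with left multiplication. -/
theorem outDegree_eq {k : X ⟶ Y} (hk : k ∈ P.sub.arrows X Y) : P.outDegree X = P.outDegree Y :=
  Nat.card_congr
    { toFun := fun g => ⟨g.1, Groupoid.inv k ≫ g.2.1, P.sub.mul (P.sub.inv hk) g.2.2⟩
      invFun := fun g => ⟨g.1, k ≫ g.2.1, P.sub.mul hk g.2.2⟩
      left_inv := fun ⟨_, _, _⟩ => by simp
      right_inv := fun ⟨_, _, _⟩ => by simp }

theorem outDegree_ne_zero (hX : X ∈ P.sub.objs) : P.outDegree X ≠ 0 := by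
  have : Finite (Σ Y : G, P.sub.arrows X Y) := inferInstance
  have : Nonempty (Σ Y : G, P.sub.arrows X Y) := ⟨⟨X, 𝟙 X, (P.id_mem_iff X).2 hX⟩⟩
  exact Nat.card_pos.ne'

open Classical in
-- A factorisation of `k` is determined by its first factor `f`, the second being `f⁻¹k`.
theorem card_fac {k : X ⟶ Z} (hk : k ∈ P.sub.arrows X Z) :
    ((Finset.univ.filter fun p : Fac k => p.fst ∈ P.sub.arrows X p.mid).card) = P.outDegree X := by
  rw [outDegree, ← Fintype.card_subtype, ← Nat.card_eq_fintype_card]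
  refine Nat.card_congr
    { toFun := fun p => ⟨p.1.mid, p.1.fst, p.2⟩
      invFun := fun g => ⟨⟨g.1, g.2.1, Groupoid.inv g.2.1 ≫ k, by simp⟩, g.2.2⟩
      left_inv := ?_
      right_inv := fun ⟨_, _, _⟩ => rfl }
  rintro ⟨⟨Y, f, g, e⟩, h⟩
  subst e
  simp

theorem coeff_assoc (f : W ⟶ X) (g : X ⟶ Y) (h : Y ⟶ Z) (hf : f ∈ P.sub.arrows W X)
    (hg : g ∈ P.sub.arrows X Y) (hh : h ∈ P.sub.arrows Y Z) :
    P.coeff f g * P.coeff (f ≫ g) h = α.toFun f g h * (P.coeff g h * P.coeff f (g ≫ h)) := by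
  rw [P.coeff_of_mem hf hg, P.coeff_of_mem (P.sub.mul hf hg) hh, P.coeff_of_mem hg hh,
    P.coeff_of_mem hf (P.sub.mul hg hh)]
  simpa only [Circle.coe_mul] using congrArg (fun z : Circle => (z : ℂ)) (P.ev_assoc hf hg hh)

theorem snd_mem {k : X ⟶ Z} (hk : k ∈ P.sub.arrows X Z) (p : Fac k)
    (h : p.fst ∈ P.sub.arrows X p.mid) : p.snd ∈ P.sub.arrows p.mid Z := by
  have : p.snd = Groupoid.inv p.fst ≫ k := by simp [← p.comp]
  rw [this]
  exact P.sub.mul (P.sub.inv h) hk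

open Classical in
-- In `m ∘ Δ` the coefficients `φ⁻¹` cancel against those of the multiplication, which leaves the
-- number of factorisations in the subgroupoid. Linearity on either side is a reindexing of
-- factorisations by composition, and the coefficients agree by the condition on `dφ`.
theorem isSeparableSection_asec : IsSeparableSection P.alg P.asec where
  isSection := by
    apply hom_ext; intro X Z k
    apply LinearMap.ext; intro v
    rw [P.eq_smul_avec v, map_smul, map_smul]
    by_cases hk : k ∈ P.sub.arrows X Z
    · congr 1
      rw [comp_app_apply, P.asec_avec hk, map_smul, map_sum]
      simp only [map_smul, P.mul_avec, smul_smul, ← Finset.sum_smul]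
      rw [id_app_apply]
      -- The extension of `φ` by zero and the convention `0⁻¹ = 0` turn this product into an
      -- indicator function.
      have h1 : ∀ p : Fac k, (P.coeff p.fst p.snd)⁻¹ * P.coeff p.fst p.snd =
          if p.fst ∈ P.sub.arrows X p.mid then 1 else 0 := by
        intro p
        split_ifs with h
        · exact inv_mul_cancel₀ (P.coeff_ne_zero h (P.snd_mem hk p h))
        · rw [P.coeff_eq_zero (fun h' => h h'.1), mul_zero]
      simp only [h1]
      rw [Finset.sum_boole, P.card_fac hk, inv_mul_cancel₀, one_smul]
      exact_mod_cast P.outDegree_ne_zero (P.sub.mem_objs_of_src hk)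
    · rw [P.avec_eq_zero hk, map_zero, map_zero]
  left_linear := by
    apply P.ext_left
    intro X Y Z a b ha v
    by_cases hb : b ∈ P.sub.arrows Y Z
    · rw [P.eq_smul_avec v, tn_smul_right, map_smul, map_smul]
      congr 1
      simp only [comp_app_apply]
      rw [whiskerLeft_tn, P.asec_avec hb, P.mul_avec, map_smul, P.asec_avec (P.sub.mul ha hb),
        tn_smul_right, tn_sum_right, map_smul, map_smul, map_sum, map_sum, P.outDegree_eq ha,
        smul_comm (P.coeff a b)]
      congr 1
      rw [Finset.smul_sum]
      refine Fintype.sum_equiv (Fac.precomp a b) _ _ fun p => ?_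
      obtain ⟨T, f, g, rfl⟩ := p
      rw [tn_smul_right, map_smul, map_smul,
        associator_inv_tn a f g rfl (Category.assoc a f g) rfl rfl, map_smul, whiskerRight_tn,
        P.mul_avec, tn_smul_left, smul_smul, smul_smul, smul_smul]
      by_cases hf : f ∈ P.sub.arrows Y T
      · have hg := P.snd_mem hb ⟨T, f, g, rfl⟩ hf
        congr 1
        -- This is `dφ = α⁻¹` for the triple `(a, f, g)`; the two coefficients differ from it only
        -- by cancelling factors of `φ`.
        have h1 := P.coeff_assoc a f g ha hf hg
        have h2 := P.coeff_ne_zero hf hg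
        have h3 := P.coeff_ne_zero (P.sub.mul ha hf) hg
        change _ = _ * (P.coeff (a ≫ f) g)⁻¹
        rw [Circle.coe_inv]
        have h4 := Circle.coe_ne_zero (α.toFun a f g)
        field_simp
        linear_combination h1
      -- If `f` is not in the subgroupoid then neither is `af`, so both summands vanish.
      · have : P.avec (a ≫ f) = 0 := P.avec_eq_zero fun h => hf (by
          simpa using P.sub.mul (P.sub.inv ha) h)
        change _ • tn (a ≫ f) g (Category.assoc a f g) (P.avec (a ≫ f)) (P.avec g) =
          _ • tn (a ≫ f) g (Category.assoc a f g) (P.avec (a ≫ f)) (P.avec g)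
        rw [this, tn_zero_left, smul_zero, smul_zero]
    · rw [P.eq_zero_of_notMem hb v, tn_zero_right, map_zero, map_zero]
  right_linear := by
    apply P.ext_right
    intro X Y Z a b hb v
    by_cases ha : a ∈ P.sub.arrows X Y
    · rw [P.eq_smul_avec v, tn_smul_left, map_smul, map_smul]
      congr 1
      simp only [comp_app_apply]
      rw [whiskerRight_tn, P.asec_avec ha, P.mul_avec, map_smul, P.asec_avec (P.sub.mul ha hb),
        tn_smul_left, tn_sum_left, map_smul, map_smul, map_sum, map_sum,
        smul_comm (P.coeff a b)]
      congr 1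
      rw [Finset.smul_sum]
      refine Fintype.sum_equiv (Fac.postcomp a b) _ _ fun p => ?_
      obtain ⟨T, f, g, rfl⟩ := p
      rw [tn_smul_left, map_smul, map_smul,
        associator_hom_tn f g b rfl rfl rfl (Category.assoc f g b).symm, map_smul, whiskerLeft_tn,
        P.mul_avec, tn_smul_right, smul_smul, smul_smul, smul_smul]
      by_cases hf : f ∈ P.sub.arrows X T
      · have hg := P.snd_mem ha ⟨T, f, g, rfl⟩ hf
        congr 1
        have h1 := P.coeff_assoc f g b hf hg hb
        have h2 := P.coeff_ne_zero hf hg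
        have h3 := P.coeff_ne_zero hf (P.sub.mul hg hb)
        change _ = _ * (P.coeff f (g ≫ b))⁻¹
        field_simp
        linear_combination -h1
      · change _ • tn f (g ≫ b) (Category.assoc f g b).symm (P.avec f) (P.avec (g ≫ b)) =
          _ • tn f (g ≫ b) (Category.assoc f g b).symm (P.avec f) (P.avec (g ≫ b))
        rw [P.avec_eq_zero hf, tn_zero_left, smul_zero, smul_zero]
    · rw [P.eq_zero_of_notMem ha v, tn_zero_left, map_zero, map_zero]

theorem isSeparableSection : IsSeparableSection P.alg P.section_ := P.isSeparableSection_asec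

end TwistedSubgroupoid

end Separable

/-! ### Algebra objects with homogeneous components of dimension at most one -/

section AlgebraBasis

variable {G : Type} [Groupoid.{0} G] {α : Cocycle₃ G} [Fintype G] [∀ X Y : G, Fintype (X ⟶ Y)]

/-- A linear section of `c ↦ c • e` serves as coordinate. The vector `e` may be zero, in which case
the whole space is zero. -/
theorem exists_coord {V : Type*} [AddCommGroup V] [Module ℂ V] {e : V}
    (h : ∀ w : V, ∃ c : ℂ, c • e = w) : ∃ f : V →ₗ[ℂ] ℂ, ∀ w, f w • e = w := by
  obtain ⟨f, hf⟩ := LinearMap.exists_rightInverse_of_surjective (LinearMap.toSpanSingleton ℂ V e)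
    (LinearMap.range_eq_top.2 h)
  exact ⟨f, fun w => LinearMap.congr_fun hf w⟩

theorem tensor_linearMap_ext {V W : GrVec α} {X Z : G} {k : X ⟶ Z} {M : Type} [AddCommGroup M]
    [Module ℂ M] {F F' : (V ⊗ W).deg k →ₗ[ℂ] M}
    (h : ∀ {Y : G} (f : X ⟶ Y) (g : Y ⟶ Z) (e : f ≫ g = k) (v : V.deg f) (w : W.deg g),
      F (tn f g e v w) = F' (tn f g e v w)) : F = F' :=
  tensor_ext h

/-- Generators of the homogeneous components of an algebra object, compatible with the unit, and
coordinates with respect to them. -/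
structure AlgebraBasis (A : Mon (GrVec α)) where
  e : ∀ ⦃X Y : G⦄ (g : X ⟶ Y), A.X.deg g
  ε : ∀ ⦃X Y : G⦄ (g : X ⟶ Y), A.X.deg g →ₗ[ℂ] ℂ
  coord : ∀ {X Y : G} (g : X ⟶ Y) (v : A.X.deg g), ε g v • e g = v
  one : ∀ X : G, Hom.app (MonObj.one (X := A.X)) (𝟙 X) (uvec α X) = e (𝟙 X)

theorem mul_one_tn (A : Mon (GrVec α)) {X Y : G} (g : X ⟶ Y) (v : A.X.deg g) :
    Hom.app (MonObj.mul (X := A.X)) g (tn g (𝟙 Y) (Category.comp_id g) v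
      (Hom.app (MonObj.one (X := A.X)) (𝟙 Y) (uvec α Y))) = v := by
  have h := app_congr (MonObj.mul_one A.X) (tn g (𝟙 Y) (Category.comp_id g) v (uvec α Y))
  rwa [rightUnitor_hom_tn, comp_app_apply, whiskerLeft_tn] at h

theorem one_mul_tn (A : Mon (GrVec α)) {X Y : G} (g : X ⟶ Y) (v : A.X.deg g) :
    Hom.app (MonObj.mul (X := A.X)) g (tn (𝟙 X) g (Category.id_comp g)
      (Hom.app (MonObj.one (X := A.X)) (𝟙 X) (uvec α X)) v) = v := by
  have h := app_congr (MonObj.one_mul A.X) (tn (𝟙 X) g (Category.id_comp g) (uvec α X) v)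
  rwa [leftUnitor_hom_tn, comp_app_apply, whiskerRight_tn] at h

open Classical in
-- Any generator will do away from identities. In degree `id_X` the unit component has to be used,
-- and it spans: `w · 1 = w` forces the component to vanish if the unit component does.
theorem AlgebraBasis.exists_of_finrank_le_one (A : Mon (GrVec α))
    (h : ∀ (X Y : G) (g : X ⟶ Y), Module.finrank ℂ (A.X.deg g) ≤ 1) :
    Nonempty (AlgebraBasis A) := by
  have h1 : ∀ X Y (g : X ⟶ Y), ∃ v : A.X.deg g, (∀ w, ∃ c : ℂ, c • v = w) := fun X Y g =>
    finrank_le_one_iff.1 (h X Y g)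
  choose e₀ he₀ using h1
  -- The unit vector, extended by zero to all degrees, allows `e` to be defined by cases on
  -- `IsIdentity g` without casts.
  let u : ∀ X Y (g : X ⟶ Y), (𝟙_ (GrVec α)).deg g := fun X Y g =>
    if h : IsIdentity g then line.one h else 0
  let e : ∀ X Y (g : X ⟶ Y), A.X.deg g := fun X Y g =>
    if IsIdentity g then Hom.app (MonObj.one (X := A.X)) g (u X Y g) else e₀ X Y g
  have he1 : ∀ X, e X X (𝟙 X) = Hom.app (MonObj.one (X := A.X)) (𝟙 X) (uvec α X) := fun X => by
    simp only [e, u, if_pos (IsIdentity.id X)]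
    exact congrArg _ (dif_pos (IsIdentity.id X))
  have he : ∀ X Y (g : X ⟶ Y) (w : A.X.deg g), ∃ c : ℂ, c • e X Y g = w := by
    intro X Y g w
    by_cases hg : IsIdentity g
    · cases hg
      rw [he1]
      by_cases h0 : Hom.app (MonObj.one (X := A.X)) (𝟙 X) (uvec α X) = 0
      · have := mul_one_tn A (𝟙 X) w
        rw [h0, tn_zero_right, map_zero] at this
        exact ⟨0, by rw [zero_smul, this]⟩
      · obtain ⟨c, hc⟩ := he₀ X X (𝟙 X) (Hom.app (MonObj.one (X := A.X)) (𝟙 X) (uvec α X))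
        obtain ⟨d, hd⟩ := he₀ X X (𝟙 X) w
        have hc0 : c ≠ 0 := by
          rintro rfl
          rw [zero_smul] at hc
          exact h0 hc.symm
        refine ⟨d * c⁻¹, ?_⟩
        rw [← hc, ← hd, smul_smul, mul_assoc, inv_mul_cancel₀ hc0, mul_one]
    · simp only [e, if_neg hg]
      exact he₀ X Y g w
  choose ε hε using fun X Y g => exists_coord (he X Y g)
  exact ⟨⟨fun X Y g => e X Y g, fun X Y g => ε X Y g, fun g v => hε _ _ g v, fun X => (he1 X).symm⟩⟩

namespace AlgebraBasis

variable {A : Mon (GrVec α)} (B : AlgebraBasis A) {W X Y Z : G}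

/-- Structure constants. -/
def m (f : X ⟶ Y) (g : Y ⟶ Z) : ℂ :=
  B.ε (f ≫ g) (Hom.app (MonObj.mul (X := A.X)) (f ≫ g) (tn f g rfl (B.e f) (B.e g)))

theorem mul_e (f : X ⟶ Y) (g : Y ⟶ Z) {k : X ⟶ Z} (h : f ≫ g = k) :
    Hom.app (MonObj.mul (X := A.X)) k (tn f g h (B.e f) (B.e g)) = B.m f g • B.e k := by
  cases h
  exact (B.coord _ _).symm

theorem ε_e {g : X ⟶ Y} (h : B.e g ≠ 0) : B.ε g (B.e g) = 1 := by
  have h1 : (B.ε g (B.e g) - 1) • B.e g = 0 := by rw [sub_smul, B.coord, one_smul, sub_self]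
  exact sub_eq_zero.1 ((smul_eq_zero.1 h1).resolve_right h)

theorem ε_eq_zero {g : X ⟶ Y} (h : B.e g = 0) (v : A.X.deg g) : B.ε g v = 0 := by
  rw [← B.coord g v, h, smul_zero, map_zero]

theorem e_ne_zero_of_m {f : X ⟶ Y} {g : Y ⟶ Z} (h : B.m f g ≠ 0) :
    B.e f ≠ 0 ∧ B.e g ≠ 0 ∧ B.e (f ≫ g) ≠ 0 := by
  refine ⟨?_, ?_, ?_⟩ <;> intro h0 <;> apply h
  · rw [m, h0, tn_zero_left, map_zero, map_zero]
  · rw [m, h0, tn_zero_right, map_zero, map_zero]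
  · exact B.ε_eq_zero h0 _

theorem m_id_left {g : X ⟶ Y} (h : B.e g ≠ 0) : B.m (𝟙 X) g = 1 := by
  have h1 := one_mul_tn A g (B.e g)
  rw [B.one, B.mul_e] at h1
  have h2 := congrArg (B.ε g) h1
  rwa [map_smul, B.ε_e h, smul_eq_mul, mul_one] at h2

theorem m_id_right {g : X ⟶ Y} (h : B.e g ≠ 0) : B.m g (𝟙 Y) = 1 := by
  have h1 := mul_one_tn A g (B.e g)
  rw [B.one, B.mul_e] at h1
  have h2 := congrArg (B.ε g) h1
  rwa [map_smul, B.ε_e h, smul_eq_mul, mul_one] at h2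

theorem e_id_right {g : X ⟶ Y} (h : B.e g ≠ 0) : B.e (𝟙 Y) ≠ 0 :=
  (B.e_ne_zero_of_m (B.m_id_right h ▸ one_ne_zero : B.m g (𝟙 Y) ≠ 0)).2.1

/-- This is the `e (fgh)`-coordinate of associativity; if that generator is zero, both sides vanish.
The composites `l` and `n` are free so that they can be supplied in simplified form. -/
theorem m_assoc (f : W ⟶ X) (g : X ⟶ Y) (h : Y ⟶ Z) {l : W ⟶ Y} {n : X ⟶ Z} (hl : f ≫ g = l)
    (hn : g ≫ h = n) : B.m f g * B.m l h = α.toFun f g h * (B.m g h * B.m f n) := by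
  subst hl hn
  by_cases h0 : B.e (f ≫ g ≫ h) = 0
  · have h1 : B.m f (g ≫ h) = 0 := B.ε_eq_zero h0 _
    have h2 : B.m (f ≫ g) h = 0 := B.ε_eq_zero (by rw [Category.assoc]; exact h0) _
    rw [h1, h2, mul_zero, mul_zero, mul_zero]
  · have h1 := app_congr (MonObj.mul_assoc A.X)
      (tn (f ≫ g) h (Category.assoc f g h) (tn f g rfl (B.e f) (B.e g)) (B.e h))
    rw [comp_app_apply, comp_app_apply, comp_app_apply, whiskerRight_tn, B.mul_e, tn_smul_left,
      map_smul, B.mul_e, associator_hom_tn f g h rfl _ rfl rfl, map_smul, map_smul, whiskerLeft_tn,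
      B.mul_e, tn_smul_right, map_smul, B.mul_e] at h1
    have h2 := congrArg (B.ε _) h1
    simpa only [map_smul, B.ε_e h0, smul_eq_mul, mul_one] using h2

/-! #### Consequences of separability -/

open Classical in
/-- The coefficient of `e p₁ ⊗ e p₂`. -/
def tcoeff {k : X ⟶ Z} (p : Fac k) : (A.X ⊗ A.X).deg k →ₗ[ℂ] ℂ :=
  tlift (V := A.X) (W := A.X) fun p' =>
    if p' = p then (LinearMap.mul ℂ ℂ).compl₁₂ (B.ε p'.fst) (B.ε p'.snd) else 0

open Classical in
theorem tcoeff_tn {k : X ⟶ Z} (p : Fac k) (f : X ⟶ Y) (g : Y ⟶ Z) (h : f ≫ g = k)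
    (v : A.X.deg f) (w : A.X.deg g) : B.tcoeff p (tn f g h v w) =
      if (⟨Y, f, g, h⟩ : Fac k) = p then B.ε f v * B.ε g w else 0 := by
  refine (tlift_tm _ f g h v w).trans ?_
  split_ifs <;> rfl

theorem tensor_coord {k : X ⟶ Z} (t : (A.X ⊗ A.X).deg k) :
    t = ∑ p : Fac k, B.tcoeff p t • tn p.fst p.snd p.comp (B.e p.fst) (B.e p.snd) := by
  have h : LinearMap.id = ∑ p : Fac k, (B.tcoeff p).smulRight
      (tn p.fst p.snd p.comp (B.e p.fst) (B.e p.snd)) := by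
    apply tensor_linearMap_ext
    intro Y f g e v w
    rw [LinearMap.id_apply, LinearMap.sum_apply, Finset.sum_eq_single (⟨Y, f, g, e⟩ : Fac k)]
    · rw [LinearMap.smulRight_apply, B.tcoeff_tn, if_pos rfl]
      dsimp only
      rw [mul_smul, ← tn_smul_right, ← tn_smul_left, B.coord, B.coord]
    · intro p _ hp
      rw [LinearMap.smulRight_apply, B.tcoeff_tn, if_neg (fun h => hp h.symm), zero_smul]
    · exact fun h => absurd (Finset.mem_univ _) h
  have := LinearMap.congr_fun h t
  rwa [LinearMap.id_apply, LinearMap.sum_apply] at this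

/-- The coefficients of `Δ(id_X)`. -/
def sc (Δ : A.X ⟶ A.X ⊗ A.X) (f : X ⟶ Y) (g : Y ⟶ X) (h : f ≫ g = 𝟙 X) : ℂ :=
  B.tcoeff ⟨Y, f, g, h⟩ (Δ.app (𝟙 X) (B.e (𝟙 X)))

theorem section_e {Δ : A.X ⟶ A.X ⊗ A.X} : Δ.app (𝟙 X) (B.e (𝟙 X)) =
    ∑ p : Fac (𝟙 X), B.sc Δ p.fst p.snd p.comp • tn p.fst p.snd p.comp (B.e p.fst) (B.e p.snd) :=
  B.tensor_coord _

theorem sum_sc {Δ : A.X ⟶ A.X ⊗ A.X} (hΔ : IsSeparableSection A Δ) (h : B.e (𝟙 X) ≠ 0) :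
    ∑ p : Fac (𝟙 X), B.sc Δ p.fst p.snd p.comp * B.m p.fst p.snd = 1 := by
  have h1 := app_congr hΔ.isSection (B.e (𝟙 X))
  rw [comp_app_apply, B.section_e, map_sum, id_app_apply] at h1
  simp only [map_smul, B.mul_e] at h1
  have h2 := congrArg (B.ε _) h1
  simpa only [map_sum, map_smul, B.ε_e h, smul_eq_mul, mul_one] using h2

/-- The products of coefficients of `Δ(1)` and structure constants sum to `1`, so one of them is
nonzero. -/
theorem exists_sc {Δ : A.X ⟶ A.X ⊗ A.X} (hΔ : IsSeparableSection A Δ) (h : B.e (𝟙 X) ≠ 0) :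
    ∃ (Y : G) (f : X ⟶ Y) (g : Y ⟶ X) (e : f ≫ g = 𝟙 X), B.sc Δ f g e ≠ 0 ∧ B.m f g ≠ 0 := by
  by_contra! hn
  have h1 := B.sum_sc hΔ h
  rw [Finset.sum_eq_zero] at h1
  · exact zero_ne_one h1
  · rintro ⟨Y, f, g, e⟩ _
    by_cases h0 : B.sc Δ f g e = 0
    · exact mul_eq_zero_of_left h0 _
    · exact mul_eq_zero_of_right _ (hn Y f g e h0)

/-- The coefficient of `e_{gp} ⊗ e_{p'}` in `Δ(e_g)` can be read off from `e_g · Δ(1)` and from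
`Δ(1) · e_g`. Up to phases this gives `m(g,p) · sc(p,p') = sc(gp,q) · m(q,g)` with `qg = p'`, so
nonvanishing passes from the left side to both factors on the right. -/
theorem section_transport {Δ : A.X ⟶ A.X ⊗ A.X} (hΔ : IsSeparableSection A Δ) (g : X ⟶ Y)
    (hg : B.e g ≠ 0) (p : Y ⟶ Z) (p' : Z ⟶ Y) (hp : p ≫ p' = 𝟙 Y) (r : X ⟶ Z) (hr : g ≫ p = r)
    (q : Z ⟶ X) (hq : q ≫ g = p') (hrq : r ≫ q = 𝟙 X) (h1 : B.sc Δ p p' hp ≠ 0)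
    (h2 : B.m g p ≠ 0) (h3 : B.e p' ≠ 0) : B.sc Δ r q hrq ≠ 0 ∧ B.m q g ≠ 0 := by
  subst hr
  have hk : (g ≫ p) ≫ p' = g := by rw [Category.assoc, hp, Category.comp_id]
  -- Left linearity: only the factorisation `(p, p')` of the identity contributes, because `g` can
  -- be cancelled on the left.
  have hl : B.tcoeff ⟨Z, g ≫ p, p', hk⟩ (Δ.app g (B.e g)) ≠ 0 := by
    have h4 := app_congr hΔ.left_linear (tn g (𝟙 Y) (Category.comp_id g) (B.e g) (B.e (𝟙 Y)))
    rw [comp_app_apply, comp_app_apply, comp_app_apply, B.mul_e, B.m_id_right hg, one_smul,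
      whiskerLeft_tn, B.section_e, tn_sum_right, map_sum, map_sum] at h4
    rw [← h4, map_sum, Finset.sum_eq_single (⟨Z, p, p', hp⟩ : Fac (𝟙 Y))]
    · simp only [tn_smul_right, map_smul]
      rw [associator_inv_tn g p p' rfl hk]
      simp only [map_smul, whiskerRight_tn, B.mul_e, tn_smul_left]
      rw [B.tcoeff_tn,
        if_pos rfl, B.ε_e h3, B.ε_e (B.e_ne_zero_of_m h2).2.2]
      simp [h1, h2]
    · rintro ⟨T, f, f', hf⟩ _ hne
      simp only [tn_smul_right, map_smul]
      rw [associator_inv_tn g f f' rfl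
        (by rw [Category.assoc, hf, Category.comp_id])]
      simp only [map_smul, whiskerRight_tn, B.mul_e, tn_smul_left]
      rw [B.tcoeff_tn,
        if_neg, smul_zero, smul_zero, smul_zero]
      intro h
      apply hne
      simp only [Fac.mk.injEq] at h ⊢
      obtain ⟨rfl, h5, h6⟩ := h
      exact ⟨rfl, heq_of_eq ((cancel_epi g).1 (eq_of_heq h5)), h6⟩
    · exact fun h => absurd (Finset.mem_univ _) h
  -- Right linearity expresses the same coefficient through `Δ(1_X)`, again with a single
  -- contribution.
  have hr := app_congr hΔ.right_linear (tn (𝟙 X) g (Category.id_comp g) (B.e (𝟙 X)) (B.e g))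
  rw [comp_app_apply, comp_app_apply, comp_app_apply, B.mul_e, B.m_id_left hg, one_smul,
    whiskerRight_tn, B.section_e, tn_sum_left, map_sum, map_sum] at hr
  rw [← hr, map_sum, Finset.sum_eq_single (⟨Z, g ≫ p, q, hrq⟩ : Fac (𝟙 X))] at hl
  · simp only [tn_smul_left, map_smul] at hl
    rw [associator_hom_tn (g ≫ p) q g hrq _ hq hk] at hl
    simp only [map_smul, whiskerLeft_tn, B.mul_e, tn_smul_right] at hl
    exact ⟨fun h0 => hl (by rw [h0, zero_smul]), fun h0 => hl (by
      rw [h0, zero_smul, smul_zero, smul_zero])⟩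
  · rintro ⟨T, f, f', hf⟩ _ hne
    simp only [tn_smul_left, map_smul]
    rw [associator_hom_tn f f' g hf _ rfl
      (by rw [← Category.assoc, hf, Category.id_comp])]
    simp only [map_smul, whiskerLeft_tn, B.mul_e, tn_smul_right]
    rw [B.tcoeff_tn,
      if_neg, smul_zero, smul_zero, smul_zero]
    intro h
    apply hne
    simp only [Fac.mk.injEq] at h ⊢
    obtain ⟨rfl, h5, h6⟩ := h
    have h6 := eq_of_heq h6
    rw [← hq] at h6
    exact ⟨rfl, h5, heq_of_eq ((cancel_mono g).1 h6)⟩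
  · exact fun h => absurd (Finset.mem_univ _) h

/-- Separability supplies some `k` out of the target of `g` for which `k, k⁻¹` contribute to
`m(Δ(1))`. Transport along `k⁻¹` gives a nonzero diagonal coefficient of `Δ(1)` at the end `Z` of
`k`, and transport along `gk` then gives `m((gk)⁻¹, gk) ≠ 0`. Associativity removes `k` again. -/
theorem m_inv_ne_zero {Δ : A.X ⟶ A.X ⊗ A.X} (hΔ : IsSeparableSection A Δ) (g : X ⟶ Y)
    (hg : B.e g ≠ 0) : B.m (Groupoid.inv g) g ≠ 0 := by
  have hα : ∀ {W X Y Z : G} (f : W ⟶ X) (g : X ⟶ Y) (h : Y ⟶ Z), (α.toFun f g h : ℂ) ≠ 0 :=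
    fun f g h => Circle.coe_ne_zero _
  obtain ⟨Z, k, k', hk, h1, h2⟩ := B.exists_sc hΔ (B.e_id_right hg)
  obtain rfl : k' = Groupoid.inv k := by
    rw [← cancel_epi k, hk, Groupoid.comp_inv]
  obtain ⟨hek, hek', -⟩ := B.e_ne_zero_of_m h2
  have h3 : B.m (Groupoid.inv k) k ≠ 0 := by
    have h := B.m_assoc k (Groupoid.inv k) k hk (Groupoid.inv_comp k)
    rw [B.m_id_left hek, B.m_id_right hek, mul_one] at h
    exact fun h0 => h2 (by rw [h, h0, zero_mul, mul_zero])
  -- Transport of the pair `(k, k⁻¹)` along `k⁻¹` lands on `(id, id)`.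
  have h4 : B.sc Δ (𝟙 Z) (𝟙 Z) (Category.comp_id _) ≠ 0 :=
    (B.section_transport hΔ (Groupoid.inv k) hek' k (Groupoid.inv k) hk (𝟙 Z) (Groupoid.inv_comp k)
      (𝟙 Z) (Category.id_comp _) (Category.comp_id _) h1 h3 hek').1
  have h5 : B.m g k ≠ 0 := by
    have h := B.m_assoc g k (Groupoid.inv k) rfl hk
    rw [B.m_id_right hg, mul_one] at h
    intro h0
    rw [h0, zero_mul] at h
    exact mul_ne_zero (hα _ _ _) h2 h.symm
  have hel := (B.e_ne_zero_of_m h5).2.2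
  have h6 : B.m (Groupoid.inv (g ≫ k)) (g ≫ k) ≠ 0 :=
    (B.section_transport hΔ (g ≫ k) hel (𝟙 Z) (𝟙 Z) (Category.comp_id _) (g ≫ k)
      (Category.comp_id _) (Groupoid.inv (g ≫ k)) (Groupoid.inv_comp _) (Groupoid.comp_inv _) h4
      (by rw [B.m_id_right hel]; exact one_ne_zero) (B.e_id_right hel)).2
  have h7 : B.m (Groupoid.inv (g ≫ k)) g ≠ 0 := by
    have h := B.m_assoc (Groupoid.inv (g ≫ k)) g k rfl rfl
    intro h0
    rw [h0, zero_mul] at h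
    exact mul_ne_zero (hα _ _ _) (mul_ne_zero h5 h6) h.symm
  -- Here `k (gk)⁻¹ = g⁻¹` and `(gk)⁻¹ g = k⁻¹`, so `m(g⁻¹, g)` divides a product of nonzero
  -- constants.
  have h8 := B.m_assoc k (Groupoid.inv (g ≫ k)) g (l := Groupoid.inv g) (n := Groupoid.inv k)
    (by simp) (by simp)
  intro h0
  rw [h0, mul_zero] at h8
  exact mul_ne_zero (hα _ _ _) (mul_ne_zero h7 h2) h8.symm

/-- Associativity for `f⁻¹, f, g` expresses `m(f⁻¹, f)`, which is nonzero, as a multiple of `m(f,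
g)`. -/
theorem m_ne_zero {Δ : A.X ⟶ A.X ⊗ A.X} (hΔ : IsSeparableSection A Δ) {f : X ⟶ Y} {g : Y ⟶ Z}
    (hf : B.e f ≠ 0) (hg : B.e g ≠ 0) : B.m f g ≠ 0 := by
  have h := B.m_assoc (Groupoid.inv f) f g (Groupoid.inv_comp f) rfl
  rw [B.m_id_left hg, mul_one] at h
  intro h0
  rw [h0, zero_mul, mul_zero] at h
  exact B.m_inv_ne_zero hΔ f hf h

/-- The support of a separable algebra object is a subgroupoid. -/
def support {Δ : A.X ⟶ A.X ⊗ A.X} (hΔ : IsSeparableSection A Δ) : Subgroupoid G where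
  arrows _ _ := {g | B.e g ≠ 0}
  inv h := (B.e_ne_zero_of_m (B.m_inv_ne_zero hΔ _ h)).1
  mul hf _ hg := (B.e_ne_zero_of_m (B.m_ne_zero hΔ hf hg)).2.2

end AlgebraBasis

end AlgebraBasis

/-! ### Unitary normalisation of structure constants and isomorphism classes of algebra objects -/

section AlgebraClassification

variable {G : Type} [Groupoid.{0} G] {α : Cocycle₃ G} [Fintype G] [∀ X Y : G, Fintype (X ⟶ Y)]

/-- The phase of a nonzero complex number. -/
def phase (z : ℂ) : Circle := Circle.exp z.arg

theorem norm_mul_phase (z : ℂ) : (‖z‖ : ℂ) * phase z = z := by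
  rw [phase, Circle.coe_exp]
  exact Complex.norm_mul_exp_arg_mul_I z

theorem phase_eq {z : ℂ} {r : ℝ} {c : Circle} (hr : 0 < r) (h : (r : ℂ) * c = z) : phase z = c := by
  have h1 := norm_mul_phase z
  have h2 : ‖z‖ = r := by
    rw [← h, norm_mul, Circle.norm_coe, mul_one, Complex.norm_real, Real.norm_eq_abs, abs_of_pos hr]
  rw [h2] at h1
  rw [← h] at h1 ⊢
  exact Circle.coe_injective (mul_left_cancel₀ (Complex.ofReal_ne_zero.2 hr.ne') h1)

theorem phase_coe (c : Circle) : phase (c : ℂ) = c :=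
  phase_eq one_pos (by rw [Complex.ofReal_one, one_mul])

theorem phase_mul {z w : ℂ} (hz : z ≠ 0) (hw : w ≠ 0) : phase (z * w) = phase z * phase w := by
  refine phase_eq (r := ‖z‖ * ‖w‖) (mul_pos (norm_pos_iff.2 hz) (norm_pos_iff.2 hw)) ?_
  conv_rhs => rw [← norm_mul_phase z, ← norm_mul_phase w]
  push_cast
  ring

theorem phase_one : phase 1 = 1 := by
  rw [← Circle.coe_one, phase_coe]

/-- An algebra object with the structure constants of `P.alg` is isomorphic to `P.alg`. -/
theorem nonempty_iso_alg (A : Mon (GrVec α)) (P : TwistedSubgroupoid α)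
    (e : ∀ ⦃X Y : G⦄ (g : X ⟶ Y), A.X.deg g)
    (he : ∀ {X Y : G} (g : X ⟶ Y) (v : A.X.deg g), ∃ c : ℂ, c • e g = v)
    (h0 : ∀ {X Y : G} (g : X ⟶ Y), e g ≠ 0 ↔ g ∈ P.sub.arrows X Y)
    (h1 : ∀ X : G, Hom.app (MonObj.one (X := A.X)) (𝟙 X) (uvec α X) = e (𝟙 X))
    (hm : ∀ {X Y Z : G} (f : X ⟶ Y) (g : Y ⟶ Z), f ∈ P.sub.arrows X Y → g ∈ P.sub.arrows Y Z →
      Hom.app (MonObj.mul (X := A.X)) (f ≫ g) (tn f g rfl (e f) (e g)) =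
        P.coeff f g • e (f ≫ g)) : Nonempty (A ≅ P.alg) := by
  have hb : ∀ {X Y : G} (g : X ⟶ Y), Function.Bijective ((P.aval g).smulRight (e g)) := by
    intro X Y g
    constructor
    · rw [← LinearMap.ker_eq_bot, LinearMap.ker_eq_bot']
      intro v hv
      rw [LinearMap.smulRight_apply, smul_eq_zero] at hv
      rcases hv with hv | hv
      · exact P.aval_injective g (by rw [hv, map_zero])
      · exact P.eq_zero_of_notMem (fun h => (h0 g).2 h hv) v
    · intro v
      obtain ⟨c, rfl⟩ := he g v
      by_cases h : e g = 0
      · exact ⟨0, by rw [map_zero, h, smul_zero]⟩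
      · refine ⟨c • P.avec g, ?_⟩
        rw [LinearMap.smulRight_apply, map_smul, P.aval_avec ((h0 g).1 h), smul_eq_mul, mul_one]
  let E : P.alg.X ≅ A.X := isoMk fun X Y g => LinearEquiv.ofBijective _ (hb g)
  have hE : ∀ {X Y : G} (g : X ⟶ Y), E.hom.app g (P.avec g) = e g := by
    intro X Y g
    change P.aval g (P.avec g) • e g = e g
    by_cases h : g ∈ P.sub.arrows X Y
    · rw [P.aval_avec h, one_smul]
    · rw [not_not.1 (mt (h0 g).1 h), smul_zero]
  refine ⟨(Mon.mkIso E ?_ ?_).symm⟩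
  · apply hom_ext; intro X Y k
    apply LinearMap.ext; intro v
    by_cases hk : IsIdentity k
    · cases hk
      have hv : v = (show line _ from v).1 • uvec α X := unit_eq_smul v
      rw [hv, map_smul, map_smul, comp_app_apply, P.one_uvec, hE, h1]
    · have hv : v = 0 := unit_eq_zero hk v
      rw [hv, map_zero, map_zero]
  · apply P.ext_left
    intro X Y Z a b ha v
    rw [P.eq_smul_avec v, tn_smul_right, map_smul, map_smul]
    by_cases hb : b ∈ P.sub.arrows Y Z
    · rw [comp_app_apply, comp_app_apply, tensorHom_tn, P.mul_avec, map_smul, hE, hE, hE,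
        hm a b ha hb]
    · rw [P.avec_eq_zero hb, tn_zero_right, map_zero, map_zero]

/-- The section `Δ` is conjugated to `f ≫ Δ ≫ (g ⊗ g)`; both linearity conditions follow from
multiplicativity of the isomorphism and its inverse. -/
theorem IsSeparable.of_iso {C : Type*} [Category C] [MonoidalCategory C] {A B : Mon C} (e : A ≅ B)
    (h : IsSeparable B) : IsSeparable A := by
  obtain ⟨Δ, h1, h2, h3⟩ := h
  have hm : MonObj.mul (X := A.X) ≫ e.hom.hom = (e.hom.hom ⊗ₘ e.hom.hom) ≫ MonObj.mul (X := B.X) :=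
    IsMonHom.mul_hom e.hom.hom
  have hm' : MonObj.mul (X := B.X) ≫ e.inv.hom = (e.inv.hom ⊗ₘ e.inv.hom) ≫ MonObj.mul (X := A.X) :=
    IsMonHom.mul_hom e.inv.hom
  have hfg : e.hom.hom ≫ e.inv.hom = 𝟙 A.X := congrArg Mon.Hom.hom e.hom_inv_id
  have hgf : e.inv.hom ≫ e.hom.hom = 𝟙 B.X := congrArg Mon.Hom.hom e.inv_hom_id
  generalize e.hom.hom = f at *
  generalize e.inv.hom = g at *
  have hl : A.X ◁ (f ≫ Δ ≫ (g ⊗ₘ g)) = (f ⊗ₘ f) ≫ B.X ◁ Δ ≫ (g ⊗ₘ (g ⊗ₘ g)) := by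
    rw [← id_tensorHom, ← id_tensorHom, tensorHom_comp_tensorHom, tensorHom_comp_tensorHom,
      Category.id_comp, hfg]
  have hr : (f ≫ Δ ≫ (g ⊗ₘ g)) ▷ A.X = (f ⊗ₘ f) ≫ Δ ▷ B.X ≫ ((g ⊗ₘ g) ⊗ₘ g) := by
    rw [← tensorHom_id, ← tensorHom_id, tensorHom_comp_tensorHom, tensorHom_comp_tensorHom,
      Category.id_comp, hfg]
  refine ⟨f ≫ Δ ≫ (g ⊗ₘ g), ?_, ?_, ?_⟩
  · rw [Category.assoc, Category.assoc, ← hm', reassoc_of% h1, hfg]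
  · have h4 : ((g ⊗ₘ g) ⊗ₘ g) ≫ MonObj.mul (X := A.X) ▷ A.X =
        MonObj.mul (X := B.X) ▷ B.X ≫ (g ⊗ₘ g) := by
      rw [← tensorHom_id, ← tensorHom_id, tensorHom_comp_tensorHom, tensorHom_comp_tensorHom, hm',
        Category.comp_id, Category.id_comp]
    rw [hl, reassoc_of% hm, ← reassoc_of% h2]
    simp only [Category.assoc]
    rw [associator_inv_naturality_assoc, h4]
  · have h4 : (g ⊗ₘ (g ⊗ₘ g)) ≫ A.X ◁ MonObj.mul (X := A.X) =
        B.X ◁ MonObj.mul (X := B.X) ≫ (g ⊗ₘ g) := by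
      rw [← id_tensorHom, ← id_tensorHom, tensorHom_comp_tensorHom, tensorHom_comp_tensorHom, hm',
        Category.comp_id, Category.id_comp]
    rw [hr, reassoc_of% hm, ← reassoc_of% h3]
    simp only [Category.assoc]
    rw [associator_naturality_assoc, h4]

namespace AlgebraBasis

variable {A : Mon (GrVec α)} (B : AlgebraBasis A) {W X Y Z : G}

/-- The morphisms of the support with source `X`. -/
abbrev Out (X : G) : Type := Σ Y : G, {g : X ⟶ Y // B.e g ≠ 0}

open Classical in
/-- The average of the logarithms of `|m f h|` over all `h`. -/
def avg (f : X ⟶ Y) : ℝ := (Fintype.card (B.Out Y) : ℝ)⁻¹ * ∑ h : B.Out Y, Real.log ‖B.m f h.2.1‖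

theorem avg_id : B.avg (𝟙 X) = 0 := by
  rw [avg, Finset.sum_eq_zero, mul_zero]
  intro h _
  rw [B.m_id_left h.2.2, norm_one, Real.log_one]

variable {Δ : A.X ⟶ A.X ⊗ A.X} (hΔ : IsSeparableSection A Δ)

open Classical in
-- Since `α` has modulus one, `log ‖m‖` satisfies the untwisted cocycle identity `log‖m(f,g)‖ =
-- log‖m(g,h)‖ + log‖m(f,gh)‖ - log‖m(fg,h)‖`. Averaging over all `h` out of the target of `g`
-- exhibits it as a coboundary.
theorem log_m (hΔ : IsSeparableSection A Δ) {f : X ⟶ Y} {g : Y ⟶ Z} (hf : B.e f ≠ 0) (hg : B.e g ≠ 0) :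
    Real.log ‖B.m f g‖ = B.avg f + B.avg g - B.avg (f ≫ g) := by
  have hfg : B.e (f ≫ g) ≠ 0 := (B.e_ne_zero_of_m (B.m_ne_zero hΔ hf hg)).2.2
  -- The substitution `h ↦ gh` identifies the average of `log ‖m(f, gh)‖` with `avg f`.
  let E : B.Out Z ≃ B.Out Y :=
    { toFun := fun h => ⟨h.1, g ≫ h.2.1, (B.e_ne_zero_of_m (B.m_ne_zero hΔ hg h.2.2)).2.2⟩
      invFun := fun h => ⟨h.1, Groupoid.inv g ≫ h.2.1,
        (B.e_ne_zero_of_m (B.m_ne_zero hΔ ((B.support hΔ).inv hg) h.2.2)).2.2⟩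
      left_inv := fun ⟨_, _, _⟩ => by simp
      right_inv := fun ⟨_, _, _⟩ => by simp }
  have hn : (Fintype.card (B.Out Z) : ℝ) ≠ 0 := by
    have : Nonempty (B.Out Z) := ⟨⟨Z, 𝟙 Z, B.e_id_right hg⟩⟩
    exact_mod_cast Fintype.card_ne_zero
  have hs : ∑ h : B.Out Y, Real.log ‖B.m f h.2.1‖ = ∑ h : B.Out Z, Real.log ‖B.m f (g ≫ h.2.1)‖ :=
    (Fintype.sum_equiv E _ _ fun _ => rfl).symm
  have hc : ∀ h : B.Out Z, Real.log ‖B.m f g‖ = Real.log ‖B.m g h.2.1‖ +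
      Real.log ‖B.m f (g ≫ h.2.1)‖ - Real.log ‖B.m (f ≫ g) h.2.1‖ := by
    intro h
    have h1 := B.m_ne_zero hΔ hf hg
    have h2 := B.m_ne_zero hΔ hg h.2.2
    have h3 := B.m_ne_zero hΔ hfg h.2.2
    have h4 := B.m_ne_zero hΔ hf (B.e_ne_zero_of_m h2).2.2
    have h5 := congrArg (fun z => Real.log ‖z‖) (B.m_assoc f g h.2.1 rfl rfl)
    simp only [norm_mul, Circle.norm_coe, one_mul] at h5
    rw [Real.log_mul (norm_ne_zero_iff.2 h1) (norm_ne_zero_iff.2 h3),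
      Real.log_mul (norm_ne_zero_iff.2 h2) (norm_ne_zero_iff.2 h4)] at h5
    linarith
  have hsum := Finset.sum_congr (rfl : (Finset.univ : Finset (B.Out Z)) = Finset.univ)
    fun h _ => hc h
  rw [Finset.sum_sub_distrib, Finset.sum_add_distrib, Finset.sum_const, Finset.card_univ,
    nsmul_eq_mul] at hsum
  rw [avg, avg, avg, hs, Fintype.card_congr E.symm]
  field_simp
  linarith

/-- The support of a separable algebra object, with the phases of the structure constants. -/
def twistedSubgroupoid : TwistedSubgroupoid α where
  sub := B.support hΔ
  φ _ _ _ f g := phase (B.m f.val g.val)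
  normalised :=
    { id_left := fun f => (congrArg phase (B.m_id_left f.2)).trans phase_one
      id_right := fun f => (congrArg phase (B.m_id_right f.2)).trans phase_one }
  d_eq {W X Y Z} a b c := by
    have h := congrArg phase (B.m_assoc a.val b.val c.val rfl rfl)
    have ha : B.e a.val ≠ 0 := a.2
    have hb : B.e b.val ≠ 0 := b.2
    have hc : B.e c.val ≠ 0 := c.2
    have h1 := B.m_ne_zero hΔ ha hb
    have h2 := B.m_ne_zero hΔ hb hc
    have h3 := B.m_ne_zero hΔ (B.e_ne_zero_of_m h1).2.2 hc
    have h4 := B.m_ne_zero hΔ ha (B.e_ne_zero_of_m h2).2.2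
    rw [phase_mul h1 h3, phase_mul (Circle.coe_ne_zero _) (mul_ne_zero h2 h4), phase_mul h2 h4,
      phase_coe] at h
    change phase (B.m b.val c.val) * (phase (B.m a.val b.val))⁻¹ *
      (phase (B.m (a.val ≫ b.val) c.val))⁻¹ * phase (B.m a.val (b.val ≫ c.val)) = _
    rw [eq_comm, inv_eq_iff_mul_eq_one]
    refine Eq.trans ?_ (mul_inv_cancel (phase (B.m a.val b.val) * phase (B.m (a.val ≫ b.val) c.val)))
    -- The factor `x` in `x * x⁻¹` ends up as the side of `h` containing `α`, while the inverse is
    -- distributed over the other side.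
    conv_rhs => rw [h, ← h, mul_inv, h]
    ac_rfl

/-- Scaling `e g` by `exp (-avg g)` cancels the moduli of the structure constants by `log_m` and
leaves their phases. The unit is unaffected because `avg` vanishes on identities. -/
theorem nonempty_iso : Nonempty (A ≅ (B.twistedSubgroupoid hΔ).alg) := by
  refine nonempty_iso_alg A _ (fun X Y g => (Real.exp (-B.avg g) : ℂ) • B.e g) ?_ ?_ ?_ ?_
  · intro X Y g v
    refine ⟨B.ε g v * Real.exp (B.avg g), ?_⟩
    rw [smul_smul, mul_assoc, ← Complex.ofReal_mul, ← Real.exp_add, add_neg_cancel, Real.exp_zero,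
      Complex.ofReal_one, mul_one, B.coord]
  · intro X Y g
    rw [smul_ne_zero_iff]
    exact ⟨fun h => h.2, fun h => ⟨Complex.ofReal_ne_zero.2 (Real.exp_pos _).ne', h⟩⟩
  · intro X
    rw [B.avg_id, neg_zero, Real.exp_zero, Complex.ofReal_one, one_smul, B.one]
  · intro X Y Z f g hf hg
    have hm := B.m_ne_zero hΔ hf hg
    rw [TwistedSubgroupoid.coeff_of_mem _ hf hg]
    change _ = (phase (B.m f g) : ℂ) • _
    rw [tn_smul_left, tn_smul_right, map_smul, map_smul, B.mul_e, smul_smul, smul_smul, smul_smul]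
    congr 1
    have h1 : ‖B.m f g‖ = Real.exp (B.avg f + B.avg g - B.avg (f ≫ g)) := by
      rw [← B.log_m hΔ hf hg, Real.exp_log (norm_pos_iff.2 hm)]
    conv_lhs => rw [← norm_mul_phase (B.m f g), h1]
    have h2 : Real.exp (-B.avg f) * Real.exp (-B.avg g) *
        Real.exp (B.avg f + B.avg g - B.avg (f ≫ g)) = Real.exp (-B.avg (f ≫ g)) := by
      rw [← Real.exp_add, ← Real.exp_add]
      congr 1
      ring
    rw [← h2]
    push_cast
    ring

end AlgebraBasis

theorem exists_iso_alg_iff (A : Mon (GrVec α)) :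
    (∃ P : TwistedSubgroupoid α, Nonempty (A ≅ P.alg)) ↔
      IsSeparable A ∧ ∀ (X Y : G) (g : X ⟶ Y), Module.finrank ℂ (A.X.deg g) ≤ 1 := by
  constructor
  · rintro ⟨P, ⟨e⟩⟩
    refine ⟨IsSeparable.of_iso e ⟨_, P.isSeparableSection⟩, fun X Y g => ?_⟩
    refine finrank_le_one (e.inv.hom.app g (P.avec g)) fun w => ⟨P.aval g (e.hom.hom.app g w), ?_⟩
    rw [← map_smul, ← P.eq_smul_avec, ← comp_app_apply]
    exact app_congr (congrArg Mon.Hom.hom e.hom_inv_id) w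
  · rintro ⟨⟨Δ, hΔ⟩, h⟩
    obtain ⟨B⟩ := AlgebraBasis.exists_of_finrank_le_one A h
    exact ⟨_, B.nonempty_iso hΔ⟩

theorem TwistedSubgroupoid.avec_ne_zero_iff (P : TwistedSubgroupoid α) {X Y : G} (g : X ⟶ Y) :
    P.avec g ≠ 0 ↔ g ∈ P.sub.arrows X Y := by
  refine ⟨fun h => by_contra fun h' => h (P.avec_eq_zero h'), fun h h' => ?_⟩
  have := P.aval_avec h
  rw [h', map_zero] at this
  exact zero_ne_one this

/-- A retraction suffices, so the two composites of an isomorphism yield the two inclusions between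
the subgroupoids. -/
theorem mem_of_iso {P Q : TwistedSubgroupoid α} {f : P.alg.X ⟶ Q.alg.X} {g : Q.alg.X ⟶ P.alg.X}
    (h : f ≫ g = 𝟙 P.alg.X) {X Y : G} {k : X ⟶ Y} (hk : k ∈ P.sub.arrows X Y) :
    Q.aval k (f.app k (P.avec k)) ≠ 0 ∧ k ∈ Q.sub.arrows X Y := by
  have h1 : f.app k (P.avec k) ≠ 0 := fun h0 => by
    have h2 := app_congr h (P.avec k)
    rw [comp_app_apply, h0, map_zero, id_app_apply] at h2
    exact (P.avec_ne_zero_iff k).2 hk h2.symm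
  exact ⟨fun h2 => h1 (Q.aval_injective k (by rw [h2, map_zero])),
    by_contra fun h2 => h1 (Q.eq_zero_of_notMem h2 _)⟩

/-- An isomorphism multiplies each basis vector `a` by a nonzero scalar `c(a)`, and multiplicativity
says `φ(a,a') c(aa') = ψ(a,a') c(a) c(a')`. Taking phases, which is multiplicative, makes the
scalars unitary. For the converse, the vectors `λ(a)⁻¹ a` of `P.alg` have the structure constants of
`Q.alg`. -/
theorem nonempty_iso_alg_iff (P Q : TwistedSubgroupoid α) :
    Nonempty (P.alg ≅ Q.alg) ↔ Cohomologous P Q := by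
  constructor
  · rintro ⟨e⟩
    have hm : MonObj.mul (X := P.alg.X) ≫ e.hom.hom =
      (e.hom.hom ⊗ₘ e.hom.hom) ≫ MonObj.mul (X := Q.alg.X) := IsMonHom.mul_hom e.hom.hom
    have hfg : e.hom.hom ≫ e.inv.hom = 𝟙 P.alg.X := congrArg Mon.Hom.hom e.hom_inv_id
    have hgf : e.inv.hom ≫ e.hom.hom = 𝟙 Q.alg.X := congrArg Mon.Hom.hom e.inv_hom_id
    have hsub : P.sub = Q.sub := by
      refine Subgroupoid.ext ?_
      funext X Y
      ext k
      exact ⟨fun h => (mem_of_iso hfg h).2, fun h => (mem_of_iso hgf h).2⟩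
    refine ⟨hsub, fun X Y g => phase (Q.aval g (e.hom.hom.app g (P.avec g))), ?_⟩
    intro X Y Z f g hf hg hf' hg'
    have h1 := app_congr hm (tn f g rfl (P.avec f) (P.avec g))
    rw [comp_app_apply, comp_app_apply, tensorHom_tn, P.mul_avec, map_smul,
      Q.eq_smul_avec (e.hom.hom.app f (P.avec f)), Q.eq_smul_avec (e.hom.hom.app g (P.avec g)),
      tn_smul_left, tn_smul_right, map_smul, map_smul, Q.mul_avec, P.coeff_of_mem hf hg,
      Q.coeff_of_mem hf' hg'] at h1
    have h2 := congrArg (Q.aval (f ≫ g)) h1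
    rw [map_smul, map_smul, map_smul, map_smul, Q.aval_avec (Q.sub.mul hf' hg')] at h2
    simp only [smul_eq_mul, mul_one] at h2
    have hf0 := (mem_of_iso hfg hf).1
    have hg0 := (mem_of_iso hfg hg).1
    have h3 := congrArg phase h2
    rw [phase_mul (Circle.coe_ne_zero _) (mem_of_iso hfg (P.sub.mul hf hg)).1,
      phase_mul hf0 (mul_ne_zero hg0 (Circle.coe_ne_zero _)),
      phase_mul hg0 (Circle.coe_ne_zero _), phase_coe, phase_coe] at h3
    refine h3.trans ?_
    rw [← mul_assoc]
    exact mul_comm _ _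
  · rintro ⟨hsub, l, hl⟩
    have hsub' : ∀ {X Y : G} (f : X ⟶ Y), f ∈ P.sub.arrows X Y ↔ f ∈ Q.sub.arrows X Y :=
      fun f => by rw [hsub]
    have hl0 : ∀ {X Y : G} (f : X ⟶ Y), (l f : ℂ) ≠ 0 := fun f => Circle.coe_ne_zero _
    refine nonempty_iso_alg P.alg Q (fun X Y g => (l g : ℂ)⁻¹ • P.avec g) ?_ ?_ ?_ ?_
    · intro X Y g v
      refine ⟨P.aval g v * l g, ?_⟩
      rw [smul_smul, mul_assoc, mul_inv_cancel₀ (hl0 g), mul_one, ← P.eq_smul_avec]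
    · intro X Y g
      rw [smul_ne_zero_iff, P.avec_ne_zero_iff, hsub']
      exact and_iff_right (inv_ne_zero (hl0 g))
    · intro X
      rw [P.one_uvec]
      by_cases h : 𝟙 X ∈ P.sub.arrows X X
      -- Normalisation of both cochains reduces this instance to `λ(id) = λ(id)²`, so `λ(id) = 1`
      -- and the units agree.
      · have h1 := hl (𝟙 X) (𝟙 X) h h ((hsub' _).1 h) ((hsub' _).1 h)
        have h2 : P.ev (𝟙 X) (𝟙 X) h h = 1 := P.normalised.id_left (P.lift _ h)
        have h3 : Q.ev (𝟙 X) (𝟙 X) ((hsub' _).1 h) ((hsub' _).1 h) = 1 :=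
          Q.normalised.id_left (Q.lift _ ((hsub' _).1 h))
        rw [h2, h3, one_mul, one_mul, Category.id_comp, left_eq_mul] at h1
        rw [h1, Circle.coe_one, inv_one, one_smul]
      · rw [P.avec_eq_zero h, smul_zero]
    · intro X Y Z f g hf hg
      have hf' := (hsub' _).2 hf
      have hg' := (hsub' _).2 hg
      rw [tn_smul_left, tn_smul_right, map_smul, map_smul, P.mul_avec, smul_smul, smul_smul,
        smul_smul, P.coeff_of_mem hf' hg', Q.coeff_of_mem hf hg]
      congr 1
      have h1 := congrArg (fun z : Circle => (z : ℂ)) (hl f g hf' hg' hf hg)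
      simp only [Circle.coe_mul] at h1
      have h2 := hl0 f
      have h3 := hl0 g
      have h4 := hl0 (f ≫ g)
      field_simp
      linear_combination h1

end AlgebraClassification

namespace TwistedAlgebra

/-! ### Bases and products of twisted groupoid algebras -/

variable {𝒢 : Type} [Groupoid.{0} 𝒢] {ϑ : Cocycle₂ 𝒢}

open Classical in
theorem coeff_ket_self {X Y : 𝒢} (f : X ⟶ Y) : (ket f : TwistedAlgebra ϑ).coeff f = 1 :=
  Pi.single_eq_same (M := fun _ => ℂ) _ _

open Classical in
theorem coeff_ket_of_ne {X Y X' Y' : 𝒢} {f : X ⟶ Y} {f' : X' ⟶ Y'}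
    (h : (⟨X', Y', f'⟩ : Σ X Y : 𝒢, X ⟶ Y) ≠ ⟨X, Y, f⟩) :
    (ket f : TwistedAlgebra ϑ).coeff f' = 0 :=
  Pi.single_eq_of_ne (M := fun _ => ℂ) h _

variable [Fintype 𝒢] [∀ X Y : 𝒢, Fintype (X ⟶ Y)]

theorem sum_coeff_ket_smul {M : Type*} [AddCommMonoid M] [Module ℂ M]
    (F : ∀ ⦃X Y : 𝒢⦄, (X ⟶ Y) → M) {X Y : 𝒢} (f : X ⟶ Y) :
    ∑ X', ∑ Y', ∑ f' : X' ⟶ Y', (ket f : TwistedAlgebra ϑ).coeff f' • F f' = F f := by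
  rw [Finset.sum_eq_single X, Finset.sum_eq_single Y, Finset.sum_eq_single f, coeff_ket_self,
    one_smul]
  · intro f' _ h
    rw [coeff_ket_of_ne, zero_smul]
    simpa using h
  · simp
  · intro Y' _ h
    refine Finset.sum_eq_zero fun f' _ => ?_
    rw [coeff_ket_of_ne, zero_smul]
    rintro h'
    simp only [Sigma.mk.injEq, heq_eq_eq, true_and] at h'
    exact h h'.1
  · simp
  · intro X' _ h
    refine Finset.sum_eq_zero fun Y' _ => Finset.sum_eq_zero fun f' _ => ?_
    rw [coeff_ket_of_ne, zero_smul]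
    rintro h'
    simp only [Sigma.mk.injEq] at h'
    exact h h'.1
  · simp

/-- The linear map with prescribed values on the basis vectors. -/
def liftKet {M : Type*} [AddCommMonoid M] [Module ℂ M] (F : ∀ ⦃X Y : 𝒢⦄, (X ⟶ Y) → M) :
    TwistedAlgebra ϑ →ₗ[ℂ] M where
  toFun x := ∑ X, ∑ Y, ∑ f : X ⟶ Y, x.coeff f • F f
  map_add' x y := by simp only [coeff_add, add_smul, Finset.sum_add_distrib]
  map_smul' c x := by simp only [coeff_smul, mul_smul, Finset.smul_sum, RingHom.id_apply]

theorem liftKet_ket {M : Type*} [AddCommMonoid M] [Module ℂ M] (F : ∀ ⦃X Y : 𝒢⦄, (X ⟶ Y) → M)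
    {X Y : 𝒢} (f : X ⟶ Y) : liftKet (ϑ := ϑ) F (ket f) = F f :=
  sum_coeff_ket_smul F f

theorem eq_sum_ket (x : TwistedAlgebra ϑ) :
    x = ∑ X, ∑ Y, ∑ f : X ⟶ Y, x.coeff f • (ket f : TwistedAlgebra ϑ) := by
  let c {X Y : 𝒢} (f : X ⟶ Y) : TwistedAlgebra ϑ →ₗ[ℂ] ℂ :=
    { toFun := fun x => x.coeff f, map_add' := fun _ _ => rfl, map_smul' := fun _ _ => rfl }
  ext X Y f
  have h : ∀ y : TwistedAlgebra ϑ, y.coeff f = c f y := fun _ => rfl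
  rw [h (∑ X, ∑ Y, ∑ f : X ⟶ Y, x.coeff f • (ket f : TwistedAlgebra ϑ))]
  simp only [map_sum, map_smul]
  rw [Finset.sum_eq_single X, Finset.sum_eq_single Y, Finset.sum_eq_single f, ← h, coeff_ket_self,
    smul_eq_mul, mul_one]
  · intro f' _ h'
    rw [← h, coeff_ket_of_ne, smul_zero]
    simpa using h'.symm
  · simp
  · intro Y' _ h'
    refine Finset.sum_eq_zero fun f' _ => ?_
    rw [← h, coeff_ket_of_ne, smul_zero]
    rintro e
    simp only [Sigma.mk.injEq, heq_eq_eq, true_and] at e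
    exact h' e.1.symm
  · simp
  · intro X' _ h'
    refine Finset.sum_eq_zero fun Y' _ => Finset.sum_eq_zero fun f' _ => ?_
    rw [← h, coeff_ket_of_ne, smul_zero]
    rintro e
    simp only [Sigma.mk.injEq] at e
    exact h' e.1.symm
  · simp

@[elab_as_elim]
theorem ket_induction {p : TwistedAlgebra ϑ → Prop} (x : TwistedAlgebra ϑ)
    (ket : ∀ {X Y : 𝒢} (f : X ⟶ Y), p (ket f)) (zero : p 0) (add : ∀ x y, p x → p y → p (x + y))
    (smul : ∀ (c : ℂ) (x), p x → p (c • x)) : p x := by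
  rw [eq_sum_ket x]
  exact Finset.sum_induction _ p add zero fun X _ => Finset.sum_induction _ p add zero fun Y _ =>
    Finset.sum_induction _ p add zero fun f _ => smul _ _ (ket f)

theorem ket_mul_ket {X Y Z : 𝒢} (f : X ⟶ Y) (g : Y ⟶ Z) :
    (ket f * ket g : TwistedAlgebra ϑ) = (ϑ.toFun f g : ℂ) • ket (f ≫ g) := by
  ext X' Z' k
  rw [coeff_mul, coeff_smul]
  by_cases h : (⟨X', Z', k⟩ : Σ X Y : 𝒢, X ⟶ Y) = ⟨X, Z, f ≫ g⟩
  · simp only [Sigma.mk.injEq] at h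
    obtain ⟨rfl, h⟩ := h
    simp only [heq_eq_eq, Sigma.mk.injEq] at h
    obtain ⟨rfl, h⟩ := h
    obtain rfl := eq_of_heq h
    rw [Finset.sum_eq_single (⟨Y, f, g, rfl⟩ : Fac (f ≫ g)), coeff_ket_self, coeff_ket_self,
      coeff_ket_self, mul_one]
    · rintro ⟨Y', f', g', e⟩ _ hne
      by_cases h' : (⟨X', Y', f'⟩ : Σ X Y : 𝒢, X ⟶ Y) = ⟨X', Y, f⟩
      · simp only [Sigma.mk.injEq, heq_eq_eq, true_and] at h'
        obtain ⟨rfl, h'⟩ := h'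
        obtain rfl := eq_of_heq h'
        obtain rfl : g' = g := (cancel_epi f').1 e
        exact absurd rfl hne
      · rw [coeff_ket_of_ne h', zero_mul, mul_zero]
    · simp
  · rw [coeff_ket_of_ne h, mul_zero]
    refine Finset.sum_eq_zero ?_
    rintro ⟨Y', f', g', e⟩ _
    by_cases h₁ : (⟨X', Y', f'⟩ : Σ X Y : 𝒢, X ⟶ Y) = ⟨X, Y, f⟩
    · by_cases h₂ : (⟨Y', Z', g'⟩ : Σ X Y : 𝒢, X ⟶ Y) = ⟨Y, Z, g⟩
      · refine absurd ?_ h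
        simp only [Sigma.mk.injEq] at h₁
        obtain ⟨rfl, h₁⟩ := h₁
        simp only [heq_eq_eq, Sigma.mk.injEq] at h₁
        obtain ⟨rfl, h₁⟩ := h₁
        obtain rfl := eq_of_heq h₁
        simp only [heq_eq_eq, Sigma.mk.injEq, true_and] at h₂
        obtain ⟨rfl, h₂⟩ := h₂
        obtain rfl := eq_of_heq h₂
        rw [e]
      · rw [coeff_ket_of_ne h₂, mul_zero, mul_zero]
    · rw [coeff_ket_of_ne h₁, zero_mul, mul_zero]

theorem ket_mul_ket_of_ne {X Y Y' Z : 𝒢} (f : X ⟶ Y) (g : Y' ⟶ Z) (h : Y ≠ Y') :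
    (ket f * ket g : TwistedAlgebra ϑ) = 0 := by
  ext X₁ Z₁ k
  rw [coeff_mul, coeff_zero]
  refine Finset.sum_eq_zero ?_
  rintro ⟨Y₁, f', g', e⟩ _
  by_cases h₁ : (⟨X₁, Y₁, f'⟩ : Σ X Y : 𝒢, X ⟶ Y) = ⟨X, Y, f⟩
  · rw [coeff_ket_of_ne (f := g), mul_zero, mul_zero]
    intro h₂
    simp only [Sigma.mk.injEq] at h₁ h₂
    obtain ⟨rfl, h₁⟩ := h₁
    simp only [heq_eq_eq, Sigma.mk.injEq] at h₁
    exact h (h₁.1.symm.trans h₂.1)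
  · rw [coeff_ket_of_ne h₁, zero_mul, mul_zero]

theorem one_eq_sum_ket : (1 : TwistedAlgebra ϑ) = ∑ X : 𝒢, ket (𝟙 X) := by
  rw [eq_sum_ket 1]
  refine Finset.sum_congr rfl fun X _ => ?_
  rw [Finset.sum_eq_single X, Finset.sum_eq_single (𝟙 X), coeff_one, if_pos (IsIdentity.id X),
    one_smul]
  · intro f _ hf
    rw [coeff_one, if_neg, zero_smul]
    exact fun h => hf (by cases h; rfl)
  · simp
  · intro Y _ hY
    refine Finset.sum_eq_zero fun f _ => ?_
    rw [coeff_one, if_neg, zero_smul]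
    exact fun h => hY (by cases h; rfl)
  · simp

end TwistedAlgebra

variable {G : Type} [Groupoid.{0} G] {α : Cocycle₃ G}

namespace GrVec

/-! ### Homogeneous components of total spaces -/

section Total

variable (V W U : GrVec α) {X Y : G}

open Classical in
/-- The projection of the total space to a homogeneous component. -/
def comp (k : X ⟶ Y) : V.total →ₗ[ℂ] V.deg k :=
  DirectSum.component ℂ (Σ X Y : G, X ⟶ Y) (fun k => V.deg k.2.2) ⟨X, Y, k⟩

open Classical in
theorem comp_incl (k : X ⟶ Y) (v : V.deg k) : V.comp k (V.incl k v) = v :=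
  DirectSum.component.lof_self ℂ _ _

open Classical in
theorem comp_incl_of_ne {X' Y' : G} {k : X ⟶ Y} {l : X' ⟶ Y'}
    (h : (⟨X', Y', l⟩ : Σ X Y : G, X ⟶ Y) ≠ ⟨X, Y, k⟩) (v : V.deg l) :
    V.comp k (V.incl l v) = 0 :=
  (DirectSum.component.of ℂ _ _ _).trans (dif_neg h)

theorem incl_injective (k : X ⟶ Y) : Function.Injective (V.incl k) :=
  Function.LeftInverse.injective (V.comp_incl k)

variable {V W U}

open Classical in
theorem total_linearMap_ext {M : Type*} [AddCommMonoid M] [Module ℂ M] {F F' : V.total →ₗ[ℂ] M}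
    (h : ∀ {X Y : G} (k : X ⟶ Y) (v : V.deg k), F (V.incl k v) = F' (V.incl k v)) : F = F' :=
  DirectSum.linearMap_ext ℂ fun k => LinearMap.ext fun v => h k.2.2 v

open Classical in
theorem totalMap_incl (f : V ⟶ W) (k : X ⟶ Y) (v : V.deg k) :
    totalMap f (V.incl k v) = W.incl k (f.app k v) :=
  DirectSum.toModule_lof _ _ _

theorem totalMap_id : totalMap (𝟙 V) = LinearMap.id :=
  total_linearMap_ext fun k v => totalMap_incl _ k v

theorem totalMap_comp (f : U ⟶ V) (g : V ⟶ W) : totalMap (f ≫ g) = totalMap g ∘ₗ totalMap f :=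
  total_linearMap_ext fun k v => by
    rw [LinearMap.comp_apply, totalMap_incl, totalMap_incl, totalMap_incl]; rfl

theorem totalMap_injective {f g : V ⟶ W} (h : totalMap f = totalMap g) : f = g := by
  apply hom_ext; intro X Y k
  refine LinearMap.ext fun v => W.incl_injective k ?_
  rw [← totalMap_incl, h, totalMap_incl]

end Total

end GrVec

/-! ### The right action of the twisted groupoid algebra on the total space of a bimodule -/

section RightAction

variable [Fintype G] [∀ X Y : G, Fintype (X ⟶ Y)] {P Q : TwistedSubgroupoid α}
  (M N : Bimod P.alg Q.alg)

/-- The action of a morphism of `Tilde P Q`, as a linear map. -/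
def bact {g g' : Tilde P Q} (f : g ⟶ g') : M.X.deg g.mor →ₗ[ℂ] M.X.deg g'.mor :=
  lact M f.a.val (g.mor ≫ f.b.val) f.comm ∘ₗ ract M g.mor f.b.val rfl

theorem biactAt_eq {g g' : Tilde P Q} (f : g ⟶ g') (v : M.X.deg g.mor) :
    biactAt M f v = bact M f v :=
  biact_tn M f.a.val g.mor f.b.val rfl f.comm v

theorem bact_apply {g g' : Tilde P Q} (f : g ⟶ g') {l : g.src.val ⟶ g'.tgt.val}
    (e : g.mor ≫ f.b.val = l) (e' : f.a.val ≫ l = g'.mor) (v : M.X.deg g.mor) :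
    bact M f v = lact M f.a.val l e' (ract M g.mor f.b.val e v) := by
  subst e; rfl

theorem bact_id (g : Tilde P Q) (v : M.X.deg g.mor) : bact M (𝟙 g) v = v := by
  rw [bact_apply M (𝟙 g) (Category.comp_id g.mor) (Category.id_comp g.mor)]
  exact (lact_id M g.mor _).trans (ract_id M g.mor v)

/-- The defining formula of `ϖ` with its denominator cleared, which matches the form of `lact_lact`.
-/
theorem varpi_coe {g g' g'' : Tilde P Q} (f : g ⟶ g') (f' : g' ⟶ g'') :
    (((Tilde.varpi P Q).toFun f f' : Circle) : ℂ) *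
        α.toFun f'.a.val f.a.val (g.mor ≫ f.b.val ≫ f'.b.val) =
      α.toFun f.a.val (g.mor ≫ f.b.val) f'.b.val * α.toFun g.mor f.b.val f'.b.val *
        P.coeff f'.a.val f.a.val * Q.coeff f.b.val f'.b.val := by
  have h₁ : P.coeff f'.a.val f.a.val = P.φ f'.a f.a := P.coeff_of_mem f'.a.2 f.a.2
  have h₂ : Q.coeff f.b.val f'.b.val = Q.φ f.b f'.b := Q.coeff_of_mem f.b.2 f'.b.2
  rw [h₁, h₂]
  simp only [← Circle.coe_mul, Circle.coe_inj]
  change α.toFun f.a.val (g.mor ≫ f.b.val) f'.b.val * α.toFun g.mor f.b.val f'.b.val *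
    (α.toFun f'.a.val f.a.val (g.mor ≫ f.b.val ≫ f'.b.val))⁻¹ * P.φ f'.a f.a * Q.φ f.b f'.b * _ = _
  generalize α.toFun f'.a.val f.a.val (g.mor ≫ f.b.val ≫ f'.b.val) = x
  generalize P.φ f'.a f.a = y
  generalize Q.φ f.b f'.b = z
  rw [mul_right_comm, mul_right_comm _ y x, inv_mul_cancel_right]

/-- Moving `b'` past `a` costs `α(a, gb, b')`, merging `b` with `b'` costs `α(g,b,b') ψ(b,b')`, and
merging `a'` with `a` costs `φ(a',a) / α(a',a,gbb')`. The product of these scalars is `ϖ`. -/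
theorem bact_comp {g g' g'' : Tilde P Q} (f : g ⟶ g') (f' : g' ⟶ g'') (v : M.X.deg g.mor) :
    bact M f' (bact M f v) = ((Tilde.varpi P Q).toFun f f' : ℂ) • bact M (f ≫ f') v := by
  have e₁ : g.mor ≫ f.b.val ≫ f'.b.val = (g.mor ≫ f.b.val) ≫ f'.b.val := by simp
  have e₂ : f.a.val ≫ (g.mor ≫ f.b.val) ≫ f'.b.val = g'.mor ≫ f'.b.val := by
    rw [← f.comm]; simp
  have e₃ : (f'.a.val ≫ f.a.val) ≫ (g.mor ≫ f.b.val) ≫ f'.b.val = g''.mor := by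
    rw [← f'.comm, ← f.comm]; simp
  have h₁ := ract_lact M f.a.val (g.mor ≫ f.b.val) f'.b.val f.comm rfl rfl e₂
    (ract M g.mor f.b.val rfl v)
  have h₂ := ract_ract M g.mor f.b.val f'.b.val rfl rfl rfl e₁ v
  have h₃ := lact_lact M f'.a.val f.a.val ((g.mor ≫ f.b.val) ≫ f'.b.val) e₂ f'.comm rfl e₃
    (ract M g.mor (f.b.val ≫ f'.b.val) e₁ v)
  have h₄ : bact M (f ≫ f') v = lact M (f'.a.val ≫ f.a.val) ((g.mor ≫ f.b.val) ≫ f'.b.val) e₃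
    (ract M g.mor (f.b.val ≫ f'.b.val) e₁ v) := bact_apply M (f ≫ f') e₁ e₃ v
  have h₅ := varpi_coe f f'
  rw [e₁] at h₅
  -- Both sides are multiplied by `α(a', a, gbb')`, the factor which `lact_lact` carries on its
  -- left.
  refine smul_right_injective _ (r := (α.toFun f'.a.val f.a.val ((g.mor ≫ f.b.val) ≫ f'.b.val) : ℂ))
    (Circle.coe_ne_zero _) ?_
  dsimp only
  rw [h₄, smul_smul, mul_comm, h₅]
  rw [bact_apply M f' rfl f'.comm, bact_apply M f rfl f.comm, h₁, h₂]
  simp only [map_smul]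
  rw [smul_comm _ (α.toFun f.a.val _ _ : ℂ), smul_comm _ (_ * _ : ℂ), h₃]
  simp only [smul_smul]
  congr 1
  ring

/-- The right action of a basis vector on the total space. -/
def actKet ⦃g g' : Tilde P Q⦄ (f : g ⟶ g') : M.X.total →ₗ[ℂ] M.X.total :=
  M.X.incl g'.mor ∘ₗ bact M f ∘ₗ M.X.comp g.mor

/-- The right action of the twisted groupoid algebra on the total space. -/
def rho : TwistedAlgebra (Tilde.varpi P Q) →ₗ[ℂ] M.X.total →ₗ[ℂ] M.X.total :=
  TwistedAlgebra.liftKet (actKet M)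

theorem rho_ket_incl {g g' : Tilde P Q} (f : g ⟶ g') (v : M.X.deg g.mor) :
    rho M (TwistedAlgebra.ket f) (M.X.incl g.mor v) = M.X.incl g'.mor (bact M f v) := by
  rw [rho, TwistedAlgebra.liftKet_ket, actKet, LinearMap.comp_apply, LinearMap.comp_apply,
    comp_incl]

theorem rho_ket_incl_of_ne {g g' : Tilde P Q} (f : g ⟶ g') {X Y : G} (k : X ⟶ Y)
    (h : (⟨X, Y, k⟩ : Σ X Y : G, X ⟶ Y) ≠ ⟨g.src.val, g.tgt.val, g.mor⟩) (v : M.X.deg k) :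
    rho M (TwistedAlgebra.ket f) (M.X.incl k v) = 0 := by
  rw [rho, TwistedAlgebra.liftKet_ket, actKet, LinearMap.comp_apply, LinearMap.comp_apply,
    comp_incl_of_ne _ h, map_zero, map_zero]

theorem Tilde.ext_sigma {g g' : Tilde P Q} (h : (⟨g.src.val, g.tgt.val, g.mor⟩ : Σ X Y : G, X ⟶ Y) =
    ⟨g'.src.val, g'.tgt.val, g'.mor⟩) : g = g' := by
  obtain ⟨⟨s, hs⟩, ⟨t, ht⟩, k⟩ := g
  obtain ⟨⟨s', hs'⟩, ⟨t', ht'⟩, k'⟩ := g'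
  simp only [Sigma.mk.injEq] at h
  obtain ⟨rfl, h⟩ := h
  simp only [heq_eq_eq, Sigma.mk.injEq] at h
  obtain ⟨rfl, h⟩ := h
  obtain rfl := eq_of_heq h
  rfl

/-- By `deg_eq_zero` the remaining degrees of the total space are zero. -/
theorem total_ext_tilde {E : Type*} [AddCommMonoid E] [Module ℂ E] {F F' : M.X.total →ₗ[ℂ] E}
    (h : ∀ (g : Tilde P Q) (v : M.X.deg g.mor), F (M.X.incl g.mor v) = F' (M.X.incl g.mor v)) :
    F = F' := by
  refine total_linearMap_ext fun {X Y} k v => ?_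
  by_cases hk : X ∈ P.sub.objs ∧ Y ∈ Q.sub.objs
  · exact h ⟨⟨X, hk.1⟩, ⟨Y, hk.2⟩, k⟩ v
  · rw [deg_eq_zero M hk v, map_zero, map_zero, map_zero]

/-- On kets with matching ends this is `bact_comp`; otherwise both sides vanish. The reversed order
expresses a right action. -/
theorem rho_mul (x y : TwistedAlgebra (Tilde.varpi P Q)) : rho M (x * y) = rho M y ∘ₗ rho M x := by
  refine TwistedAlgebra.ket_induction x (fun {g₀ g₁} f => ?_) ?_ ?_ ?_
  rotate_left
  · rw [zero_mul, map_zero, LinearMap.comp_zero]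
  · intro x x' h h'
    rw [add_mul, map_add, map_add, h, h', LinearMap.comp_add]
  · intro c x h
    rw [smul_mul_assoc, map_smul, map_smul, h, LinearMap.comp_smul]
  refine TwistedAlgebra.ket_induction y (fun {g₂ g₃} f' => ?_) ?_ ?_ ?_
  rotate_left
  · rw [mul_zero, map_zero, LinearMap.zero_comp]
  · intro x x' h h'
    rw [mul_add, map_add, map_add, h, h', LinearMap.add_comp]
  · intro c x h
    rw [mul_smul_comm, map_smul, map_smul, h, LinearMap.smul_comp]
  refine total_ext_tilde M fun g v => ?_
  rw [LinearMap.comp_apply]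
  by_cases h₀ : g = g₀
  · subst h₀
    rw [rho_ket_incl]
    by_cases h₁ : g₁ = g₂
    · subst h₁
      rw [TwistedAlgebra.ket_mul_ket, rho_ket_incl, map_smul, LinearMap.smul_apply, rho_ket_incl,
        bact_comp, map_smul]
    · rw [TwistedAlgebra.ket_mul_ket_of_ne _ _ h₁, map_zero, LinearMap.zero_apply,
        rho_ket_incl_of_ne]
      exact fun h => h₁ (Tilde.ext_sigma h)
  · have h₂ := fun h => h₀ (Tilde.ext_sigma h)
    rw [rho_ket_incl_of_ne M f _ h₂, map_zero]
    by_cases h₁ : g₁ = g₂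
    · subst h₁
      rw [TwistedAlgebra.ket_mul_ket, map_smul, LinearMap.smul_apply, rho_ket_incl_of_ne M _ _ h₂,
        smul_zero]
    · rw [TwistedAlgebra.ket_mul_ket_of_ne _ _ h₁, map_zero, LinearMap.zero_apply]

theorem rho_one : rho M 1 = LinearMap.id := by
  refine total_ext_tilde M fun g v => ?_
  rw [TwistedAlgebra.one_eq_sum_ket, map_sum, LinearMap.sum_apply, Finset.sum_eq_single g,
    rho_ket_incl, bact_id, LinearMap.id_apply]
  · exact fun g' _ h => rho_ket_incl_of_ne M _ _ (fun h' => h (Tilde.ext_sigma h').symm) _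
  · simp

variable {M N}

theorem bact_hom (h : M ⟶ N) {g g' : Tilde P Q} (f : g ⟶ g') (v : M.X.deg g.mor) :
    h.hom.app g'.mor (bact M f v) = bact N f (h.hom.app g.mor v) := by
  have h₁ : ∀ {X Y Z : G} (a : X ⟶ Y) (g : Y ⟶ Z) {k : X ⟶ Z} (e : a ≫ g = k) (v : M.X.deg g),
      h.hom.app k (lact M a g e v) = lact N a g e (h.hom.app g v) := by
    intro X Y Z a g k e v
    have := app_congr h.left_act_hom (tn a g e (P.avec a) v)
    rwa [comp_app_apply, comp_app_apply, whiskerLeft_tn] at this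
  have h₂ : ∀ {X Y Z : G} (g : X ⟶ Y) (b : Y ⟶ Z) {k : X ⟶ Z} (e : g ≫ b = k) (v : M.X.deg g),
      h.hom.app k (ract M g b e v) = ract N g b e (h.hom.app g v) := by
    intro X Y Z g b k e v
    have := app_congr h.right_act_hom (tn g b e v (Q.avec b))
    rwa [comp_app_apply, comp_app_apply, whiskerRight_tn] at this
  rw [bact_apply M f rfl f.comm, bact_apply N f rfl f.comm, h₁, h₂]

theorem totalMap_rho (h : M ⟶ N) (x : TwistedAlgebra (Tilde.varpi P Q)) (t : M.X.total) :
    totalMap h.hom (rho M x t) = rho N x (totalMap h.hom t) := by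
  suffices H : totalMap h.hom ∘ₗ rho M x = rho N x ∘ₗ totalMap h.hom from LinearMap.congr_fun H t
  refine TwistedAlgebra.ket_induction x (fun {g₀ g₁} f => ?_) ?_ ?_ ?_
  rotate_left
  · rw [map_zero, map_zero, LinearMap.comp_zero, LinearMap.zero_comp]
  · intro x x' h h'
    rw [map_add, map_add, LinearMap.comp_add, h, h', LinearMap.add_comp]
  · intro c x h
    rw [map_smul, map_smul, LinearMap.comp_smul, h, LinearMap.smul_comp]
  refine total_ext_tilde M fun g v => ?_
  rw [LinearMap.comp_apply, LinearMap.comp_apply]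
  rw [totalMap_incl]
  by_cases h₀ : g = g₀
  · subst h₀
    rw [rho_ket_incl, rho_ket_incl, totalMap_incl, bact_hom]
  · have h₂ := fun h => h₀ (Tilde.ext_sigma h)
    rw [rho_ket_incl_of_ne M f _ h₂, rho_ket_incl_of_ne N f _ h₂, map_zero]

end RightAction

variable {G : Type} [Groupoid.{0} G] {α : Cocycle₃ G} [Fintype G] [∀ X Y : G, Fintype (X ⟶ Y)]
  {P Q : TwistedSubgroupoid α}

/-! ### The functor to right modules over the twisted groupoid algebra -/

section Functor

/-- The total space of a bimodule, as a right module over the twisted groupoid algebra. -/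
def BTotal (M : Bimod P.alg Q.alg) : Type := M.X.total

variable (M N : Bimod P.alg Q.alg)

instance : AddCommGroup (BTotal M) := inferInstanceAs (AddCommGroup M.X.total)

instance : Module ℂ (BTotal M) := inferInstanceAs (Module ℂ M.X.total)

/-- The representation of the opposite of the twisted groupoid algebra on the total space. -/
def rhoHom : (TwistedAlgebra (Tilde.varpi P Q))ᵐᵒᵖ →+* Module.End ℂ (BTotal M) where
  toFun x := rho M x.unop
  map_one' := rho_one M
  map_mul' x y := rho_mul M y.unop x.unop
  map_zero' := (rho M).map_zero
  map_add' x y := (rho M).map_add x.unop y.unop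

instance : Module (TwistedAlgebra (Tilde.varpi P Q))ᵐᵒᵖ (BTotal M) :=
  Module.compHom (BTotal M) (rhoHom M)

instance : IsScalarTower ℂ (TwistedAlgebra (Tilde.varpi P Q))ᵐᵒᵖ (BTotal M) where
  smul_assoc c x t := LinearMap.congr_fun ((rho M).map_smul c x.unop) t

open Classical in
instance : Module.Finite ℂ (BTotal M) :=
  inferInstanceAs (Module.Finite ℂ (⨁ k : (Σ X Y : G, X ⟶ Y), M.X.deg k.2.2))

instance : Module.Finite (TwistedAlgebra (Tilde.varpi P Q))ᵐᵒᵖ (BTotal M) :=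
  Module.Finite.of_restrictScalars_finite ℂ _ _

variable {M N}

/-- The module map induced by a bimodule map. -/
def BTotal.map (h : M ⟶ N) : BTotal M →ₗ[(TwistedAlgebra (Tilde.varpi P Q))ᵐᵒᵖ] BTotal N where
  toFun := totalMap h.hom
  map_add' := map_add _
  map_smul' x t := totalMap_rho h x.unop t

/-- Identity kets are the projections to homogeneous components; for this reason every module map
preserves the grading. -/
theorem rho_id (g : Tilde P Q) (t : M.X.total) :
    rho M (TwistedAlgebra.ket (𝟙 g)) t = M.X.incl g.mor (M.X.comp g.mor t) := by
  rw [rho, TwistedAlgebra.liftKet_ket, actKet, LinearMap.comp_apply, LinearMap.comp_apply, bact_id]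

/-- The morphism `(a, 1)` of `Tilde P Q`. -/
def Tilde.leftHom {X : G} (g : Tilde P Q) (a : X ⟶ g.src.val) (ha : a ∈ P.sub.arrows X g.src.val)
    {k : X ⟶ g.tgt.val} (e : a ≫ g.mor = k) :
    g ⟶ (⟨⟨X, P.sub.mem_objs_of_src ha⟩, g.tgt, k⟩ : Tilde P Q) :=
  ⟨⟨a, ha⟩, 𝟙 g.tgt, (congrArg (a ≫ ·) (Category.comp_id g.mor)).trans e⟩

/-- The morphism `(1, b)` of `Tilde P Q`. -/
def Tilde.rightHom {Y : G} (g : Tilde P Q) (b : g.tgt.val ⟶ Y) (hb : b ∈ Q.sub.arrows g.tgt.val Y)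
    {k : g.src.val ⟶ Y} (e : g.mor ≫ b = k) :
    g ⟶ (⟨g.src, ⟨Y, Q.sub.mem_objs_of_tgt hb⟩, k⟩ : Tilde P Q) :=
  ⟨𝟙 g.src, ⟨b, hb⟩, (Category.id_comp (g.mor ≫ b)).trans e⟩

theorem bact_leftHom {X : G} (g : Tilde P Q) (a : X ⟶ g.src.val)
    (ha : a ∈ P.sub.arrows X g.src.val) {k : X ⟶ g.tgt.val} (e : a ≫ g.mor = k)
    (v : M.X.deg g.mor) : bact M (g.leftHom a ha e) v = lact M a g.mor e v := by
  rw [bact_apply M (g.leftHom a ha e) (Category.comp_id g.mor) e]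
  exact congrArg _ (ract_id M g.mor v)

theorem bact_rightHom {Y : G} (g : Tilde P Q) (b : g.tgt.val ⟶ Y)
    (hb : b ∈ Q.sub.arrows g.tgt.val Y) {k : g.src.val ⟶ Y} (e : g.mor ≫ b = k)
    (v : M.X.deg g.mor) : bact M (g.rightHom b hb e) v = ract M g.mor b e v := by
  rw [bact_apply M (g.rightHom b hb e) e (Category.id_comp k)]
  exact lact_id M k _

/-! ### Module maps come from bimodule maps -/

section Full

variable (F : BTotal M →ₗ[(TwistedAlgebra (Tilde.varpi P Q))ᵐᵒᵖ] BTotal N)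

/-- The underlying complex linear map of a module map. -/
def BTotal.linear : M.X.total →ₗ[ℂ] N.X.total :=
  (F.restrictScalars ℂ : BTotal M →ₗ[ℂ] BTotal N)

theorem BTotal.linear_rho (x : TwistedAlgebra (Tilde.varpi P Q)) (t : M.X.total) :
    BTotal.linear F (rho M x t) = rho N x (BTotal.linear F t) :=
  F.map_smul (MulOpposite.op x) t

theorem BTotal.linear_incl (g : Tilde P Q) (v : M.X.deg g.mor) :
    BTotal.linear F (M.X.incl g.mor v) =
      N.X.incl g.mor (N.X.comp g.mor (BTotal.linear F (M.X.incl g.mor v))) := by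
  conv_lhs => rw [← comp_incl M.X g.mor v, ← rho_id, BTotal.linear_rho, rho_id]

/-- The homogeneous components of a module map. -/
def BTotal.component : M.X ⟶ N.X where
  app _ _ k := N.X.comp k ∘ₗ BTotal.linear F ∘ₗ M.X.incl k

theorem BTotal.component_app {X Y : G} (k : X ⟶ Y) (v : M.X.deg k) :
    (BTotal.component F).app k v = N.X.comp k (BTotal.linear F (M.X.incl k v)) := rfl

theorem BTotal.component_bact {g g' : Tilde P Q} (f : g ⟶ g') (v : M.X.deg g.mor) :
    (BTotal.component F).app g'.mor (bact M f v) =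
      bact N f ((BTotal.component F).app g.mor v) := by
  rw [component_app, component_app, ← rho_ket_incl, linear_rho, linear_incl, rho_ket_incl,
    comp_incl, comp_incl]

/-- The left action of `a` is that of the ket of `(a, 1)` when the right end of `g` is an object of
`Q`; otherwise the component is zero. -/
theorem BTotal.component_lact {X Y Z : G} (a : X ⟶ Y) (ha : a ∈ P.sub.arrows X Y) (g : Y ⟶ Z)
    {k : X ⟶ Z} (e : a ≫ g = k) (v : M.X.deg g) : (BTotal.component F).app k (lact M a g e v) =
      lact N a g e ((BTotal.component F).app g v) := by
  by_cases hZ : Z ∈ Q.sub.objs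
  · let g' : Tilde P Q := ⟨⟨Y, P.sub.mem_objs_of_tgt ha⟩, ⟨Z, hZ⟩, g⟩
    have := component_bact F (g'.leftHom a ha e) v
    rwa [bact_leftHom, bact_leftHom] at this
  · rw [deg_eq_zero M (fun h => hZ h.2) v]
    simp only [map_zero]

theorem BTotal.component_ract {X Y Z : G} (g : X ⟶ Y) (b : Y ⟶ Z) (hb : b ∈ Q.sub.arrows Y Z)
    {k : X ⟶ Z} (e : g ≫ b = k) (v : M.X.deg g) : (BTotal.component F).app k (ract M g b e v) =
      ract N g b e ((BTotal.component F).app g v) := by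
  by_cases hX : X ∈ P.sub.objs
  · let g' : Tilde P Q := ⟨⟨X, hX⟩, ⟨Y, Q.sub.mem_objs_of_src hb⟩, g⟩
    have := component_bact F (g'.rightHom b hb e) v
    rwa [bact_rightHom, bact_rightHom] at this
  · rw [deg_eq_zero M (fun h => hX h.1) v]
    simp only [map_zero]

/-- The bimodule map given by a module map. -/
def BTotal.preimage : M ⟶ N where
  hom := BTotal.component F
  left_act_hom := by
    apply P.ext_left
    intro X Y Z a b ha v
    rw [comp_app_apply, comp_app_apply, whiskerLeft_tn, actLeft_tn, actLeft_tn,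
      component_lact F a ha]
  right_act_hom := by
    apply Q.ext_right
    intro X Y Z g b hb v
    rw [comp_app_apply, comp_app_apply, whiskerRight_tn, actRight_tn, actRight_tn,
      component_ract F g b hb]

theorem BTotal.map_preimage : BTotal.map (BTotal.preimage F) = F := by
  refine LinearMap.ext fun t => ?_
  suffices H : totalMap (BTotal.component F) = BTotal.linear F from LinearMap.congr_fun H t
  refine total_ext_tilde M fun g v => ?_
  rw [totalMap_incl, component_app, ← linear_incl]

end Full

variable (P Q)

/-- The functor sending a bimodule to its total space. -/
def toModules : Bimod P.alg Q.alg ⥤ FGModuleCat.{0} (TwistedAlgebra (Tilde.varpi P Q))ᵐᵒᵖ where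
  obj M := FGModuleCat.of _ (BTotal M)
  map h := FGModuleCat.ofHom (BTotal.map h)
  map_id M := by
    apply FGModuleCat.hom_ext
    exact LinearMap.ext fun t => LinearMap.congr_fun totalMap_id t
  map_comp f g := by
    apply FGModuleCat.hom_ext
    exact LinearMap.ext fun t => LinearMap.congr_fun (totalMap_comp f.hom g.hom) t

instance : (toModules P Q).Faithful where
  map_injective {M N f g} h := by
    have h' : BTotal.map f = BTotal.map g := congrArg (fun k => k.hom.hom) h
    apply Bimod.hom_ext
    exact totalMap_injective (LinearMap.ext fun t => LinearMap.congr_fun h' t)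

instance : (toModules P Q).Full where
  map_surjective {M N} f :=
    ⟨BTotal.preimage f.hom.hom, FGModuleCat.hom_ext (BTotal.map_preimage f.hom.hom)⟩

/-- The image of a bimodule is its total space. -/
def toModulesEquiv (M : Bimod P.alg Q.alg) : ((toModules P Q).obj M).obj ≃ₗ[ℂ] M.X.total where
  toFun t := t
  invFun t := t
  left_inv _ := rfl
  right_inv _ := rfl
  map_add' _ _ := rfl
  map_smul' c t := by
    have h : rho M (algebraMap ℂ _ c) t = c • (show M.X.total from t) := by
      rw [Algebra.algebraMap_eq_smul_one, map_smul, rho_one]; rfl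
    exact h

end Functor

variable {G : Type} [Groupoid.{0} G] {α : Cocycle₃ G} [Fintype G] [∀ X Y : G, Fintype (X ⟶ Y)]

namespace GrVec

variable {U V W T : GrVec α}

theorem tensor_hom_ext₃ {f g : (U ⊗ V) ⊗ W ⟶ T}
    (H : ∀ {X Y Z X' : G} (a : X ⟶ Y) (b : Y ⟶ Z) (c : Z ⟶ X') (l : X ⟶ Z) (e : a ≫ b = l)
      (u : U.deg a) (v : V.deg b) (w : W.deg c),
      f.app (l ≫ c) (tn (V := U ⊗ V) l c rfl (tn a b e u v) w) =
        g.app (l ≫ c) (tn (V := U ⊗ V) l c rfl (tn a b e u v) w)) : f = g := by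
  apply hom_ext; intro X Z k
  refine tensor_ext₃ fun a b c l e e' u v w => ?_
  cases e'
  exact H a b c l e u v w

theorem tensor_hom_ext₃' {f g : U ⊗ (V ⊗ W) ⟶ T}
    (H : ∀ {X Y Z X' : G} (a : X ⟶ Y) (b : Y ⟶ Z) (c : Z ⟶ X') (l : Y ⟶ X') (e : b ≫ c = l)
      (u : U.deg a) (v : V.deg b) (w : W.deg c),
      f.app (a ≫ l) (tn (W := V ⊗ W) a l rfl u (tn b c e v w)) =
        g.app (a ≫ l) (tn (W := V ⊗ W) a l rfl u (tn b c e v w))) : f = g := by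
  apply hom_ext; intro X Z k
  refine tensor_ext₃' fun a b c l e e' u v w => ?_
  cases e'
  exact H a b c l e u v w

end GrVec

/-! ### Bimodules from the actions of basis vectors -/

/-- Commuting actions of the basis vectors of `P.alg` and `Q.alg` on a graded vector space. -/
structure ActData (P Q : TwistedSubgroupoid α) (V : GrVec α) where
  l : ∀ {X Y Z : G} (a : X ⟶ Y) (g : Y ⟶ Z) {k : X ⟶ Z}, a ≫ g = k → V.deg g →ₗ[ℂ] V.deg k
  r : ∀ {X Y Z : G} (g : X ⟶ Y) (b : Y ⟶ Z) {k : X ⟶ Z}, g ≫ b = k → V.deg g →ₗ[ℂ] V.deg k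
  l_eq_zero : ∀ {X Y Z : G} (a : X ⟶ Y) (g : Y ⟶ Z) {k : X ⟶ Z} (e : a ≫ g = k),
    a ∉ P.sub.arrows X Y → l a g e = 0
  r_eq_zero : ∀ {X Y Z : G} (g : X ⟶ Y) (b : Y ⟶ Z) {k : X ⟶ Z} (e : g ≫ b = k),
    b ∉ Q.sub.arrows Y Z → r g b e = 0
  l_id : ∀ {X Y : G} (g : X ⟶ Y) (v : V.deg g), l (𝟙 X) g (Category.id_comp g) v = v
  r_id : ∀ {X Y : G} (g : X ⟶ Y) (v : V.deg g), r g (𝟙 Y) (Category.comp_id g) v = v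
  l_l : ∀ {W X Y Z : G} (a' : W ⟶ X) (a : X ⟶ Y) (g : Y ⟶ Z) {k : X ⟶ Z} {l' : W ⟶ Z} {c : W ⟶ Y}
    (e : a ≫ g = k) (e' : a' ≫ k = l') (_ : a' ≫ a = c) (e₂ : c ≫ g = l') (v : V.deg g),
    (α.toFun a' a g : ℂ) • l a' k e' (l a g e v) = P.coeff a' a • l c g e₂ v
  r_r : ∀ {W X Y Z : G} (g : W ⟶ X) (b : X ⟶ Y) (b' : Y ⟶ Z) {k : W ⟶ Y} {l' : W ⟶ Z} {c : X ⟶ Z}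
    (e : g ≫ b = k) (e' : k ≫ b' = l') (_ : b ≫ b' = c) (e₂ : g ≫ c = l') (v : V.deg g),
    r k b' e' (r g b e v) = ((α.toFun g b b' : ℂ) * Q.coeff b b') • r g c e₂ v
  r_l : ∀ {W X Y Z : G} (a : W ⟶ X) (g : X ⟶ Y) (b : Y ⟶ Z) {k : W ⟶ Y} {l' : W ⟶ Z} {c : X ⟶ Z}
    (e : a ≫ g = k) (e' : k ≫ b = l') (e₁ : g ≫ b = c) (e₂ : a ≫ c = l') (v : V.deg g),
    r k b e' (l a g e v) = (α.toFun a g b : ℂ) • l a c e₂ (r g b e₁ v)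

namespace ActData

variable {P Q : TwistedSubgroupoid α} {V : GrVec α} (D : ActData P Q V)

/-- The left action on the graded vector space. -/
def actLeft : P.alg.X ⊗ V ⟶ V where
  app _ _ _ := tlift fun p => (P.aval p.fst).smulRight (D.l p.fst p.snd p.comp)

/-- The right action on the graded vector space. -/
def actRight : V ⊗ Q.alg.X ⟶ V where
  app _ _ _ := tlift fun p => ((Q.aval p.snd).smulRight (D.r p.fst p.snd p.comp)).flip

theorem actLeft_tn {X Y Z : G} (a : X ⟶ Y) (g : Y ⟶ Z) {k : X ⟶ Z} (e : a ≫ g = k)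
    (c : P.alg.X.deg a) (v : V.deg g) :
    D.actLeft.app k (tn a g e c v) = P.aval a c • D.l a g e v :=
  tlift_tm _ _ _ _ _ _

theorem actRight_tn {X Y Z : G} (g : X ⟶ Y) (b : Y ⟶ Z) {k : X ⟶ Z} (e : g ≫ b = k)
    (v : V.deg g) (c : Q.alg.X.deg b) :
    D.actRight.app k (tn g b e v c) = Q.aval b c • D.r g b e v :=
  tlift_tm _ _ _ _ _ _

theorem actLeft_avec {X Y Z : G} (a : X ⟶ Y) (g : Y ⟶ Z) {k : X ⟶ Z} (e : a ≫ g = k)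
    (v : V.deg g) : D.actLeft.app k (tn a g e (P.avec a) v) = D.l a g e v := by
  rw [actLeft_tn]
  by_cases ha : a ∈ P.sub.arrows X Y
  · rw [P.aval_avec ha, one_smul]
  · rw [D.l_eq_zero a g e ha, LinearMap.zero_apply, smul_zero]

theorem actRight_avec {X Y Z : G} (g : X ⟶ Y) (b : Y ⟶ Z) {k : X ⟶ Z} (e : g ≫ b = k)
    (v : V.deg g) : D.actRight.app k (tn g b e v (Q.avec b)) = D.r g b e v := by
  rw [actRight_tn]
  by_cases hb : b ∈ Q.sub.arrows Y Z
  · rw [Q.aval_avec hb, one_smul]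
  · rw [D.r_eq_zero g b e hb, LinearMap.zero_apply, smul_zero]

open MonObj in
/-- The bimodule given by commuting actions of the basis vectors. -/
def bimod : Bimod P.alg Q.alg where
  X := V
  actLeft := D.actLeft
  actRight := D.actRight
  one_actLeft := by
    rw [← cancel_epi (λ_ V).inv, Iso.inv_hom_id]
    apply hom_ext; intro X Y k
    refine LinearMap.ext fun v => ?_
    change (η[P.alg.X] ▷ V ≫ D.actLeft).app k ((λ_ V).inv.app k v) = v
    rw [leftUnitor_inv_tn, comp_app_apply, whiskerRight_tn, P.one_uvec, actLeft_avec, D.l_id]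
  actRight_one := by
    rw [← cancel_epi (ρ_ V).inv, Iso.inv_hom_id]
    apply hom_ext; intro X Y k
    refine LinearMap.ext fun v => ?_
    change (V ◁ η[Q.alg.X] ≫ D.actRight).app k ((ρ_ V).inv.app k v) = v
    rw [rightUnitor_inv_tn, comp_app_apply, whiskerLeft_tn, Q.one_uvec, actRight_avec, D.r_id]
  left_assoc := by
    apply tensor_hom_ext₃
    intro X Y Z X' a' a g c e u v w
    have e₂ : a' ≫ a ≫ g = c ≫ g := by rw [← e, Category.assoc]
    rw [P.eq_smul_avec u, P.eq_smul_avec v, tn_smul_left, tn_smul_right, tn_smul_left, tn_smul_left,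
      map_smul, map_smul, map_smul, map_smul, comp_app_apply, comp_app_apply, comp_app_apply,
      associator_hom_tn a' a g e rfl rfl e₂,
      map_smul, map_smul, whiskerRight_tn, whiskerLeft_tn, P.mul_avec, tn_smul_left, map_smul,
      actLeft_avec, actLeft_avec, actLeft_avec, D.l_l a' a g rfl e₂ e rfl]
  right_assoc := by
    apply tensor_hom_ext₃'
    intro X Y Z X' g b b' c e w u v
    have e₂ : (g ≫ b) ≫ b' = g ≫ c := by rw [← e, Category.assoc]
    rw [Q.eq_smul_avec u, Q.eq_smul_avec v, tn_smul_left, tn_smul_right, tn_smul_right,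
      tn_smul_right,
      map_smul, map_smul, map_smul, map_smul, comp_app_apply, comp_app_apply, comp_app_apply,
      associator_inv_tn g b b' rfl e₂ e rfl,
      map_smul, map_smul, whiskerRight_tn, whiskerLeft_tn, Q.mul_avec, tn_smul_right, map_smul,
      actRight_avec, actRight_avec, actRight_avec, D.r_r g b b' rfl e₂ e rfl, smul_smul _ (_ * _),
      ← _root_.mul_assoc, _root_.mul_comm ((_ : Circle) : ℂ), circle_mul_inv, _root_.one_mul]
  middle_assoc := by
    apply tensor_hom_ext₃
    intro X Y Z X' a g b c e u w v
    have e₂ : a ≫ g ≫ b = c ≫ b := by rw [← e, Category.assoc]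
    rw [P.eq_smul_avec u, Q.eq_smul_avec v, tn_smul_left, tn_smul_right, tn_smul_left,
      map_smul, map_smul, map_smul, map_smul, comp_app_apply, comp_app_apply, comp_app_apply,
      associator_hom_tn a g b e rfl rfl e₂,
      map_smul, map_smul, whiskerRight_tn, whiskerLeft_tn, actLeft_avec, actRight_avec,
      actRight_avec, actLeft_avec, D.r_l a g b e rfl rfl e₂]

theorem bact_bimod {g g' : Tilde P Q} (f : g ⟶ g') (v : V.deg g.mor) :
    bact D.bimod f v = D.l f.a.val (g.mor ≫ f.b.val) f.comm (D.r g.mor f.b.val rfl v) :=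
  (congrArg (lact D.bimod f.a.val (g.mor ≫ f.b.val) f.comm)
    (D.actRight_avec g.mor f.b.val rfl v)).trans
      (D.actLeft_avec f.a.val (g.mor ≫ f.b.val) f.comm _)

end ActData

open TwistedAlgebra

variable {G : Type} [Groupoid.{0} G] {α : Cocycle₃ G} [Fintype G] [∀ X Y : G, Fintype (X ⟶ Y)]
  {P Q : TwistedSubgroupoid α}

/-! ### Essential surjectivity -/

section Kets

variable (P Q)

open Classical in
/-- The element of the twisted groupoid algebra by which `a` acts from the left on degree `g`. -/
def lKet {X Y Z : G} (a : X ⟶ Y) (g : Y ⟶ Z) {k : X ⟶ Z} (e : a ≫ g = k) :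
    TwistedAlgebra (Tilde.varpi P Q) :=
  if h : a ∈ P.sub.arrows X Y ∧ Z ∈ Q.sub.objs then
    ket (Tilde.leftHom ⟨⟨Y, P.sub.mem_objs_of_tgt h.1⟩, ⟨Z, h.2⟩, g⟩ a h.1 e) else 0

open Classical in
/-- The element of the twisted groupoid algebra by which `b` acts from the right on degree `g`. -/
def rKet {X Y Z : G} (g : X ⟶ Y) (b : Y ⟶ Z) {k : X ⟶ Z} (e : g ≫ b = k) :
    TwistedAlgebra (Tilde.varpi P Q) :=
  if h : X ∈ P.sub.objs ∧ b ∈ Q.sub.arrows Y Z then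
    ket (Tilde.rightHom ⟨⟨X, h.1⟩, ⟨Y, Q.sub.mem_objs_of_src h.2⟩, g⟩ b h.2 e) else 0

variable {P Q}

theorem lKet_of_mem (g : Tilde P Q) {X : G} {a : X ⟶ g.src.val}
    (ha : a ∈ P.sub.arrows X g.src.val) {k : X ⟶ g.tgt.val} (e : a ≫ g.mor = k) :
    lKet P Q a g.mor e = ket (g.leftHom a ha e) :=
  dif_pos ⟨ha, g.tgt.2⟩

theorem rKet_of_mem (g : Tilde P Q) {Y : G} {b : g.tgt.val ⟶ Y}
    (hb : b ∈ Q.sub.arrows g.tgt.val Y) {k : g.src.val ⟶ Y} (e : g.mor ≫ b = k) :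
    rKet P Q g.mor b e = ket (g.rightHom b hb e) :=
  dif_pos ⟨g.src.2, hb⟩

theorem lKet_eq_zero {X Y Z : G} {a : X ⟶ Y} (g : Y ⟶ Z) {k : X ⟶ Z} (e : a ≫ g = k)
    (h : ¬(a ∈ P.sub.arrows X Y ∧ Z ∈ Q.sub.objs)) : lKet P Q a g e = 0 :=
  dif_neg h

theorem rKet_eq_zero {X Y Z : G} (g : X ⟶ Y) {b : Y ⟶ Z} {k : X ⟶ Z} (e : g ≫ b = k)
    (h : ¬(X ∈ P.sub.objs ∧ b ∈ Q.sub.arrows Y Z)) : rKet P Q g b e = 0 :=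
  dif_neg h

theorem lKet_id (g : Tilde P Q) :
    lKet P Q (𝟙 g.src.val) g.mor (Category.id_comp g.mor) = ket (𝟙 g) :=
  lKet_of_mem g ((P.id_mem_iff _).2 g.src.2) _

theorem rKet_id (g : Tilde P Q) :
    rKet P Q g.mor (𝟙 g.tgt.val) (Category.comp_id g.mor) = ket (𝟙 g) :=
  rKet_of_mem g ((Q.id_mem_iff _).2 g.tgt.2) _

/-- Both are the identity ket at `k`, or zero. The homogeneous component may thus be cut out from
either side. -/
theorem lKet_id_eq_rKet_id {X Y : G} (k : X ⟶ Y) :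
    lKet P Q (𝟙 X) k (Category.id_comp k) = rKet P Q k (𝟙 Y) (Category.comp_id k) := by
  by_cases h : X ∈ P.sub.objs ∧ Y ∈ Q.sub.objs
  · exact (lKet_id ⟨⟨X, h.1⟩, ⟨Y, h.2⟩, k⟩).trans (rKet_id ⟨⟨X, h.1⟩, ⟨Y, h.2⟩, k⟩).symm
  · rw [lKet_eq_zero, rKet_eq_zero]
    · rwa [Q.id_mem_iff]
    · rwa [P.id_mem_iff]

/-- With `rKet_mul_rKet` and `lKet_mul_rKet`, these are the relations required by `ActData`, lifted
to the algebra. Factors appear in reversed order because they act on right modules. -/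
theorem lKet_mul_lKet {W X Y Z : G} (a' : W ⟶ X) (a : X ⟶ Y) (g : Y ⟶ Z) {k : X ⟶ Z} {l : W ⟶ Z}
    {c : W ⟶ Y} (e : a ≫ g = k) (e' : a' ≫ k = l) (e₁ : a' ≫ a = c) (e₂ : c ≫ g = l) :
    (α.toFun a' a g : ℂ) • (lKet P Q a g e * lKet P Q a' k e') =
      P.coeff a' a • lKet P Q c g e₂ := by
  by_cases ha : a ∈ P.sub.arrows X Y
  swap
  · rw [lKet_eq_zero g e (fun h => ha h.1), P.coeff_eq_zero (fun h => ha h.2), zero_mul, smul_zero,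
      zero_smul]
  by_cases ha' : a' ∈ P.sub.arrows W X
  swap
  · rw [lKet_eq_zero k e' (fun h => ha' h.1), P.coeff_eq_zero (fun h => ha' h.1), mul_zero,
      smul_zero, zero_smul]
  by_cases hZ : Z ∈ Q.sub.objs
  swap
  · rw [lKet_eq_zero g e (fun h => hZ h.2), lKet_eq_zero g e₂ (fun h => hZ h.2), zero_mul,
      smul_zero, smul_zero]
  subst e₁
  let g₁ : Tilde P Q := ⟨⟨Y, P.sub.mem_objs_of_tgt ha⟩, ⟨Z, hZ⟩, g⟩
  let g₂ : Tilde P Q := ⟨⟨X, P.sub.mem_objs_of_src ha⟩, ⟨Z, hZ⟩, k⟩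
  have h : g₁.leftHom a ha e ≫ g₂.leftHom a' ha' e' = g₁.leftHom (a' ≫ a) (P.sub.mul ha' ha) e₂ :=
    Tilde.Hom.ext rfl (Category.comp_id _)
  have h₁ : lKet P Q a g e * lKet P Q a' k e' = _ :=
    (congrArg₂ (· * ·) (lKet_of_mem g₁ ha e) (lKet_of_mem g₂ ha' e')).trans (ket_mul_ket _ _)
  rw [h₁, h, smul_smul, mul_comm]
  refine congrArg₂ (· • ·) ?_ (lKet_of_mem g₁ (P.sub.mul ha' ha) e₂).symm
  have h₂ := varpi_coe (g₁.leftHom a ha e) (g₂.leftHom a' ha' e')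
  change _ * (α.toFun a' a (g ≫ 𝟙 Z ≫ 𝟙 Z) : ℂ) = α.toFun a (g ≫ 𝟙 Z) (𝟙 Z) * α.toFun g (𝟙 Z) (𝟙 Z) *
    P.coeff a' a * Q.coeff (𝟙 Z) (𝟙 Z) at h₂
  rw [Category.comp_id, Category.comp_id, α.id_right, α.id_right,
    Q.coeff_id_left ((Q.id_mem_iff Z).2 hZ)] at h₂
  rw [h₂]
  simp

theorem rKet_mul_rKet {W X Y Z : G} (g : W ⟶ X) (b : X ⟶ Y) (b' : Y ⟶ Z) {k : W ⟶ Y} {l : W ⟶ Z}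
    {c : X ⟶ Z} (e : g ≫ b = k) (e' : k ≫ b' = l) (e₁ : b ≫ b' = c) (e₂ : g ≫ c = l) :
    rKet P Q g b e * rKet P Q k b' e' =
      ((α.toFun g b b' : ℂ) * Q.coeff b b') • rKet P Q g c e₂ := by
  by_cases hb : b ∈ Q.sub.arrows X Y
  swap
  · rw [rKet_eq_zero g e (fun h => hb h.2), Q.coeff_eq_zero (fun h => hb h.1), zero_mul, mul_zero,
      zero_smul]
  by_cases hb' : b' ∈ Q.sub.arrows Y Z
  swap
  · rw [rKet_eq_zero k e' (fun h => hb' h.2), Q.coeff_eq_zero (fun h => hb' h.2), mul_zero,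
      mul_zero, zero_smul]
  by_cases hW : W ∈ P.sub.objs
  swap
  · rw [rKet_eq_zero g e (fun h => hW h.1), rKet_eq_zero g e₂ (fun h => hW h.1), zero_mul,
      smul_zero]
  subst e₁
  let g₁ : Tilde P Q := ⟨⟨W, hW⟩, ⟨X, Q.sub.mem_objs_of_src hb⟩, g⟩
  let g₂ : Tilde P Q := ⟨⟨W, hW⟩, ⟨Y, Q.sub.mem_objs_of_src hb'⟩, k⟩
  have h : g₁.rightHom b hb e ≫ g₂.rightHom b' hb' e' = g₁.rightHom (b ≫ b') (Q.sub.mul hb hb') e₂ :=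
    Tilde.Hom.ext (Category.comp_id _) rfl
  have h₁ : rKet P Q g b e * rKet P Q k b' e' = _ :=
    (congrArg₂ (· * ·) (rKet_of_mem g₁ hb e) (rKet_of_mem g₂ hb' e')).trans (ket_mul_ket _ _)
  rw [h₁, h]
  refine congrArg₂ (· • ·) ?_ (rKet_of_mem g₁ (Q.sub.mul hb hb') e₂).symm
  have h₂ := varpi_coe (g₁.rightHom b hb e) (g₂.rightHom b' hb' e')
  change _ * (α.toFun (𝟙 W) (𝟙 W) (g ≫ b ≫ b') : ℂ) = α.toFun (𝟙 W) (g ≫ b) b' * α.toFun g b b' *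
    P.coeff (𝟙 W) (𝟙 W) * Q.coeff b b' at h₂
  rw [α.id_left, α.id_left, P.coeff_id_left ((P.id_mem_iff W).2 hW)] at h₂
  simpa using h₂

/-- Both products are multiples of the ket of `(a, b)`. By normalisation `ϖ` equals `α(a,g,b)` for
the order on the left and `1` for the order on the right. -/
theorem lKet_mul_rKet {W X Y Z : G} (a : W ⟶ X) (g : X ⟶ Y) (b : Y ⟶ Z) {k : W ⟶ Y} {l : W ⟶ Z}
    {c : X ⟶ Z} (e : a ≫ g = k) (e' : k ≫ b = l) (e₁ : g ≫ b = c) (e₂ : a ≫ c = l) :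
    lKet P Q a g e * rKet P Q k b e' =
      (α.toFun a g b : ℂ) • (rKet P Q g b e₁ * lKet P Q a c e₂) := by
  by_cases ha : a ∈ P.sub.arrows W X
  swap
  · rw [lKet_eq_zero g e (fun h => ha h.1), lKet_eq_zero c e₂ (fun h => ha h.1), zero_mul, mul_zero,
      smul_zero]
  by_cases hb : b ∈ Q.sub.arrows Y Z
  swap
  · rw [rKet_eq_zero k e' (fun h => hb h.2), rKet_eq_zero g e₁ (fun h => hb h.2), zero_mul, mul_zero,
      smul_zero]
  let g₁ : Tilde P Q := ⟨⟨X, P.sub.mem_objs_of_tgt ha⟩, ⟨Y, Q.sub.mem_objs_of_src hb⟩, g⟩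
  let g₂ : Tilde P Q := ⟨⟨W, P.sub.mem_objs_of_src ha⟩, ⟨Y, Q.sub.mem_objs_of_src hb⟩, k⟩
  let g₃ : Tilde P Q := ⟨⟨X, P.sub.mem_objs_of_tgt ha⟩, ⟨Z, Q.sub.mem_objs_of_tgt hb⟩, c⟩
  have h : g₁.leftHom a ha e ≫ g₂.rightHom b hb e' = g₁.rightHom b hb e₁ ≫ g₃.leftHom a ha e₂ :=
    Tilde.Hom.ext ((Category.id_comp _).trans (Category.comp_id _).symm)
      ((Category.id_comp _).trans (Category.comp_id _).symm)
  have h₁ : lKet P Q a g e * rKet P Q k b e' = _ :=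
    (congrArg₂ (· * ·) (lKet_of_mem g₁ ha e) (rKet_of_mem g₂ hb e')).trans (ket_mul_ket _ _)
  have h₂ : rKet P Q g b e₁ * lKet P Q a c e₂ = _ :=
    (congrArg₂ (· * ·) (rKet_of_mem g₁ hb e₁) (lKet_of_mem g₃ ha e₂)).trans (ket_mul_ket _ _)
  rw [h₁, h₂, h, smul_smul]
  congr 1
  have h₃ := varpi_coe (g₁.leftHom a ha e) (g₂.rightHom b hb e')
  have h₄ := varpi_coe (g₁.rightHom b hb e₁) (g₃.leftHom a ha e₂)
  change _ * (α.toFun (𝟙 W) a (g ≫ 𝟙 Y ≫ b) : ℂ) = α.toFun a (g ≫ 𝟙 Y) b * α.toFun g (𝟙 Y) b *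
    P.coeff (𝟙 W) a * Q.coeff (𝟙 Y) b at h₃
  change _ * (α.toFun a (𝟙 X) (g ≫ b ≫ 𝟙 Z) : ℂ) = α.toFun (𝟙 X) (g ≫ b) (𝟙 Z) * α.toFun g b (𝟙 Z) *
    P.coeff a (𝟙 X) * Q.coeff b (𝟙 Z) at h₄
  rw [α.id_left, Category.comp_id, α.id_mid, P.coeff_id_left ha, Q.coeff_id_left hb] at h₃
  rw [α.id_left, α.id_mid, α.id_right, P.coeff_id_right ha, Q.coeff_id_right hb] at h₄
  simp only [Circle.coe_one, mul_one] at h₃ h₄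
  rw [h₃, h₄, mul_one]

/-- In this order `ϖ` is `1`. Hence the one-sided moves generate the twisted algebra and a module is
determined by them. -/
theorem rKet_mul_lKet {g g' : Tilde P Q} (f : g ⟶ g') {c : g.src.val ⟶ g'.tgt.val}
    (e₁ : g.mor ≫ f.b.val = c) (e₂ : f.a.val ≫ c = g'.mor) :
    rKet P Q g.mor f.b.val e₁ * lKet P Q f.a.val c e₂ = ket f := by
  let g₁ : Tilde P Q := ⟨g.src, g'.tgt, c⟩
  have h : g.rightHom f.b.val f.b.2 e₁ ≫ g₁.leftHom f.a.val f.a.2 e₂ = f :=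
    Tilde.Hom.ext (Category.comp_id _) (Category.comp_id _)
  have h₁ : rKet P Q g.mor f.b.val e₁ * lKet P Q f.a.val c e₂ = _ :=
    (congrArg₂ (· * ·) (rKet_of_mem g f.b.2 e₁) (lKet_of_mem g₁ f.a.2 e₂)).trans (ket_mul_ket _ _)
  have h₂ := varpi_coe (g.rightHom f.b.val f.b.2 e₁) (g₁.leftHom f.a.val f.a.2 e₂)
  change _ * (α.toFun f.a.val (𝟙 g.src.val) (g.mor ≫ f.b.val ≫ 𝟙 g'.tgt.val) : ℂ) =
    α.toFun (𝟙 g.src.val) (g.mor ≫ f.b.val) (𝟙 g'.tgt.val) * α.toFun g.mor f.b.val (𝟙 g'.tgt.val) *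
    P.coeff f.a.val (𝟙 g.src.val) * Q.coeff f.b.val (𝟙 g'.tgt.val) at h₂
  rw [α.id_left, α.id_mid, α.id_right, P.coeff_id_right f.a.2, Q.coeff_id_right f.b.2] at h₂
  simp only [Circle.coe_one, mul_one] at h₂
  rw [h₁, h₂, one_smul]
  exact congrArg ket h

end Kets

open TwistedAlgebra

variable {G : Type} [Groupoid.{0} G] {α : Cocycle₃ G} [Fintype G] [∀ X Y : G, Fintype (X ⟶ Y)]
  {P Q : TwistedSubgroupoid α}

section RightModule

variable {R V : Type} [Ring R] [Algebra ℂ R] [AddCommGroup V] [Module ℂ V] [Module Rᵐᵒᵖ V]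
  [IsScalarTower ℂ Rᵐᵒᵖ V]

theorem rAct_apply (x : R) (v : V) : rAct R V x v = MulOpposite.op x • v := rfl

theorem rAct_mul (x y : R) (v : V) : rAct R V (x * y) v = rAct R V y (rAct R V x v) := by
  rw [rAct_apply, MulOpposite.op_mul, mul_smul]; rfl

theorem smul_rAct (c : ℂ) (x : R) (v : V) : c • rAct R V x v = rAct R V (c • x) v := by
  rw [map_smul, LinearMap.smul_apply]

theorem rAct_one (v : V) : rAct R V 1 v = v := by
  rw [rAct_apply, MulOpposite.op_one, one_smul]

end RightModule

/-! ### A right module as the total space of its homogeneous components -/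

section EssSurj

variable (V : Type) [AddCommGroup V] [Module ℂ V] [Module (TwistedAlgebra (Tilde.varpi P Q))ᵐᵒᵖ V]
  [IsScalarTower ℂ (TwistedAlgebra (Tilde.varpi P Q))ᵐᵒᵖ V]

/-- The homogeneous component of a right module in degree `k`. -/
def homog {X Y : G} (k : X ⟶ Y) : Submodule ℂ V :=
  LinearMap.eqLocus (rAct (TwistedAlgebra (Tilde.varpi P Q)) V
    (lKet P Q (𝟙 X) k (Category.id_comp k))) LinearMap.id

variable {V}

theorem mem_homog {X Y : G} {k : X ⟶ Y} {v : V} : v ∈ homog (P := P) (Q := Q) V k ↔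
    rAct (TwistedAlgebra (Tilde.varpi P Q)) V (lKet P Q (𝟙 X) k (Category.id_comp k)) v = v :=
  Iff.rfl

theorem lKet_mem_homog {X Y Z : G} (a : X ⟶ Y) (g : Y ⟶ Z) {k : X ⟶ Z} (e : a ≫ g = k) (v : V) :
    rAct _ V (lKet P Q a g e) v ∈ homog (P := P) (Q := Q) V k := by
  rw [mem_homog, ← rAct_mul]
  by_cases ha : a ∈ P.sub.arrows X Y
  · have h := lKet_mul_lKet (P := P) (Q := Q) (𝟙 X) a g e (Category.id_comp k) (Category.id_comp a) e
    rw [α.id_left, P.coeff_id_left ha, Circle.coe_one, one_smul, one_smul] at h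
    rw [h]
  · rw [lKet_eq_zero g e (fun h => ha h.1), zero_mul]

theorem rKet_mem_homog {X Y Z : G} (g : X ⟶ Y) (b : Y ⟶ Z) {k : X ⟶ Z} (e : g ≫ b = k) (v : V) :
    rAct _ V (rKet P Q g b e) v ∈ homog (P := P) (Q := Q) V k := by
  rw [mem_homog, ← rAct_mul, lKet_id_eq_rKet_id]
  by_cases hb : b ∈ Q.sub.arrows Y Z
  · have h := rKet_mul_rKet (P := P) (Q := Q) g b (𝟙 Z) e (Category.comp_id k) (Category.comp_id b) e
    rw [α.id_right, Q.coeff_id_right hb, Circle.coe_one, one_mul, one_smul] at h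
    rw [h]
  · rw [rKet_eq_zero g e (fun h => hb h.2), zero_mul]

variable (P Q V) in
/-- The graded vector space of homogeneous components of a right module. -/
def homogObj [Module.Finite ℂ V] : GrVec α where
  deg _ _ k := FGModuleCat.of ℂ (homog (P := P) (Q := Q) V k)

variable (P Q V) in
/-- The actions of the basis vectors on the homogeneous components of a right module. -/
def homogActData [Module.Finite ℂ V] : ActData P Q (homogObj P Q V) where
  l {X Y Z} a g {k} e := (rAct _ V (lKet P Q a g e)).restrict
    (p := homog (P := P) (Q := Q) V g) (q := homog (P := P) (Q := Q) V k)
    fun v _ => lKet_mem_homog a g e v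
  r {X Y Z} g b {k} e := (rAct _ V (rKet P Q g b e)).restrict
    (p := homog (P := P) (Q := Q) V g) (q := homog (P := P) (Q := Q) V k)
    fun v _ => rKet_mem_homog g b e v
  l_eq_zero {X Y Z} a g {k} e h := by
    refine LinearMap.ext fun v => Subtype.ext ?_
    change rAct _ V (lKet P Q a g e) v.val = 0
    rw [lKet_eq_zero g e (fun h' => h h'.1), map_zero, LinearMap.zero_apply]
  r_eq_zero {X Y Z} g b {k} e h := by
    refine LinearMap.ext fun v => Subtype.ext ?_
    change rAct _ V (rKet P Q g b e) v.val = 0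
    rw [rKet_eq_zero g e (fun h' => h h'.2), map_zero, LinearMap.zero_apply]
  l_id {X Y} g v := Subtype.ext v.2
  r_id {X Y} g v := Subtype.ext <| by
    have h := mem_homog.1 v.2
    rwa [lKet_id_eq_rKet_id] at h
  l_l {W X Y Z} a' a g {k l' c} e e' e₁ e₂ v := Subtype.ext <| by
    change (α.toFun a' a g : ℂ) • rAct _ V (lKet P Q a' k e') (rAct _ V (lKet P Q a g e) v.val) =
      P.coeff a' a • rAct _ V (lKet P Q c g e₂) v.val
    rw [← rAct_mul, smul_rAct, smul_rAct, lKet_mul_lKet a' a g e e' e₁ e₂]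
  r_r {W X Y Z} g b b' {k l' c} e e' e₁ e₂ v := Subtype.ext <| by
    change rAct _ V (rKet P Q k b' e') (rAct _ V (rKet P Q g b e) v.val) =
      ((α.toFun g b b' : ℂ) * Q.coeff b b') • rAct _ V (rKet P Q g c e₂) v.val
    rw [← rAct_mul, smul_rAct, rKet_mul_rKet g b b' e e' e₁ e₂]
  r_l {W X Y Z} a g b {k l' c} e e' e₁ e₂ v := Subtype.ext <| by
    change rAct _ V (rKet P Q k b e') (rAct _ V (lKet P Q a g e) v.val) =
      (α.toFun a g b : ℂ) • rAct _ V (lKet P Q a c e₂) (rAct _ V (rKet P Q g b e₁) v.val)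
    rw [← rAct_mul, ← rAct_mul, smul_rAct, lKet_mul_rKet a g b e e' e₁ e₂]

variable (P Q V) in
/-- The bimodule of homogeneous components of a right module. -/
def homogBimod [Module.Finite ℂ V] : Bimod P.alg Q.alg := (homogActData P Q V).bimod

variable [Module.Finite ℂ V]

theorem ket_id_smul (g : Tilde P Q) (v : homog (P := P) (Q := Q) V g.mor) :
    rAct (TwistedAlgebra (Tilde.varpi P Q)) V (ket (𝟙 g)) v.val = v.val := by
  rw [← lKet_id]
  exact v.2

variable (P Q V) in
/-- The inclusion of a homogeneous component. -/
def homogIncl {X Y : G} (k : X ⟶ Y) :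
    homog (P := P) (Q := Q) V k →ₗ[ℂ] (homogBimod P Q V).X.total :=
  (homogBimod P Q V).X.incl k

theorem homog_total_ext {E : Type*} [AddCommMonoid E] [Module ℂ E]
    {F F' : (homogBimod P Q V).X.total →ₗ[ℂ] E}
    (h : ∀ (g : Tilde P Q) (v : homog (P := P) (Q := Q) V g.mor),
      F (homogIncl P Q V g.mor v) = F' (homogIncl P Q V g.mor v)) : F = F' :=
  total_ext_tilde (homogBimod P Q V) h

open Classical in
variable (P Q V) in
/-- The sum of the homogeneous components. -/
def homogSum : (homogBimod P Q V).X.total →ₗ[ℂ] V :=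
  DirectSum.toModule ℂ _ V fun k => (homog (P := P) (Q := Q) V k.2.2).subtype

open Classical in
theorem homogSum_incl {X Y : G} (k : X ⟶ Y) (v : homog (P := P) (Q := Q) V k) :
    homogSum P Q V (homogIncl P Q V k v) = v.val :=
  DirectSum.toModule_lof (φ := fun k : (Σ X Y : G, X ⟶ Y) =>
    (homog (P := P) (Q := Q) V k.2.2).subtype) _ _ _

theorem rho_ket_homogIncl {g g' : Tilde P Q} (f : g ⟶ g')
    (v : homog (P := P) (Q := Q) V g.mor) :
    rho (homogBimod P Q V) (ket f) (homogIncl P Q V g.mor v) =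
      homogIncl P Q V g'.mor ⟨rAct _ V (lKet P Q f.a.val (g.mor ≫ f.b.val) f.comm)
        (rAct _ V (rKet P Q g.mor f.b.val rfl) v.val), lKet_mem_homog _ _ _ _⟩ :=
  (rho_ket_incl (homogBimod P Q V) f v).trans
    (congrArg _ ((homogActData P Q V).bact_bimod f v))

/-- For a vector in the source degree of a ket this is the factorisation `rKet_mul_lKet`. In any
other degree both sides vanish, since kets with mismatched ends multiply to zero. -/
theorem homogSum_rho (x : TwistedAlgebra (Tilde.varpi P Q)) :
    homogSum P Q V ∘ₗ rho (homogBimod P Q V) x = rAct _ V x ∘ₗ homogSum P Q V := by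
  refine TwistedAlgebra.ket_induction x (fun {g₀ g₁} f => ?_) ?_ ?_ ?_
  rotate_left
  · rw [map_zero, map_zero, LinearMap.comp_zero, LinearMap.zero_comp]
  · intro x x' h h'
    rw [map_add, map_add, LinearMap.comp_add, h, h', LinearMap.add_comp]
  · intro c x h
    rw [map_smul, map_smul, LinearMap.comp_smul, h, LinearMap.smul_comp]
  refine homog_total_ext fun g v => ?_
  rw [LinearMap.comp_apply, LinearMap.comp_apply, homogSum_incl g.mor v]
  by_cases h₀ : g = g₀
  · subst h₀
    rw [rho_ket_homogIncl, homogSum_incl]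
    dsimp only
    rw [← rAct_mul, rKet_mul_lKet f rfl f.comm]
  · have h₁ : rho (homogBimod P Q V) (ket f) (homogIncl P Q V g.mor v) = 0 :=
      rho_ket_incl_of_ne (homogBimod P Q V) f g.mor (fun h => h₀ (Tilde.ext_sigma h)) v
    rw [h₁, map_zero, ← ket_id_smul g v, ← rAct_mul, ket_mul_ket_of_ne _ _ h₀, map_zero, LinearMap.zero_apply]

variable (P Q V) in
/-- The projection to a homogeneous component. -/
def homogProj {X Y : G} (k : X ⟶ Y) : V →ₗ[ℂ] homog (P := P) (Q := Q) V k :=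
  (rAct (TwistedAlgebra (Tilde.varpi P Q)) V (lKet P Q (𝟙 X) k (Category.id_comp k))).codRestrict
    (homog (P := P) (Q := Q) V k) fun v => lKet_mem_homog _ _ _ v

theorem homogProj_val (g : Tilde P Q) (v : V) :
    (homogProj P Q V g.mor v).val = rAct (TwistedAlgebra (Tilde.varpi P Q)) V (ket (𝟙 g)) v := by
  rw [← lKet_id]; rfl

variable (P Q V) in
/-- The decomposition into homogeneous components. -/
def homogSplit : V →ₗ[ℂ] (homogBimod P Q V).X.total :=
  ∑ g : Tilde P Q, homogIncl P Q V g.mor ∘ₗ homogProj P Q V g.mor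

theorem homogSplit_apply (v : V) : homogSplit P Q V v =
    ∑ g : Tilde P Q, homogIncl P Q V g.mor (homogProj P Q V g.mor v) := by
  rw [homogSplit, LinearMap.sum_apply]; rfl

theorem homogSum_homogSplit (v : V) : homogSum P Q V (homogSplit P Q V v) = v := by
  rw [homogSplit_apply, map_sum]
  simp only [homogSum_incl, homogProj_val]
  rw [← LinearMap.sum_apply, ← map_sum, ← one_eq_sum_ket, rAct_one]

/-- Orthogonality of the identity kets; `homogSum_homogSplit` uses instead that their sum is `1`. -/
theorem homogSplit_homogSum : homogSplit P Q V ∘ₗ homogSum P Q V = LinearMap.id := by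
  refine homog_total_ext fun g v => ?_
  rw [LinearMap.comp_apply, homogSum_incl g.mor v, homogSplit_apply, Finset.sum_eq_single g,
    LinearMap.id_apply]
  · exact congrArg _ (Subtype.ext v.2)
  · intro g' _ h
    have h' : homogProj P Q V g'.mor v.val = 0 := by
      apply Subtype.ext
      rw [homogProj_val, ← ket_id_smul g v, ← rAct_mul, ket_mul_ket_of_ne _ _ h.symm, map_zero]
      rfl
    rw [h', map_zero]
  · simp

variable (P Q V) in
/-- A right module is the total space of the bimodule of its homogeneous components. -/
def homogEquiv : BTotal (homogBimod P Q V) ≃ₗ[(TwistedAlgebra (Tilde.varpi P Q))ᵐᵒᵖ] V where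
  toFun := homogSum P Q V
  invFun := homogSplit P Q V
  left_inv t := LinearMap.congr_fun homogSplit_homogSum t
  right_inv v := homogSum_homogSplit v
  map_add' := map_add _
  map_smul' x t := LinearMap.congr_fun (homogSum_rho x.unop) t

end EssSurj

variable (P Q)

instance : Module.Finite ℂ (TwistedAlgebra (Tilde.varpi P Q)) :=
  inferInstanceAs (Module.Finite ℂ ((Σ X Y : Tilde P Q, X ⟶ Y) → ℂ))

instance : Module.Finite ℂ (TwistedAlgebra (Tilde.varpi P Q))ᵐᵒᵖ :=
  Module.Finite.equiv (MulOpposite.opLinearEquiv ℂ)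

instance : (toModules P Q).EssSurj where
  mem_essImage V :=
    have : Module.Finite ℂ V.obj := Module.Finite.trans (TwistedAlgebra (Tilde.varpi P Q))ᵐᵒᵖ _
    ⟨homogBimod P Q V.obj, ⟨(homogEquiv P Q V.obj).toFGModuleCatIso⟩⟩

instance : (toModules P Q).IsEquivalence where

/-- The equivalence of bimodules with right modules over the twisted groupoid algebra. -/
def bimodEquivalence :
    Bimod P.alg Q.alg ≌ FGModuleCat.{0} (TwistedAlgebra (Tilde.varpi P Q))ᵐᵒᵖ :=
  (toModules P Q).asEquivalence

open TwistedAlgebra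

variable {G : Type} [Groupoid.{0} G] {α : Cocycle₃ G} [Fintype G] [∀ X Y : G, Fintype (X ⟶ Y)]
  {P Q R : TwistedSubgroupoid α}

/-! ### The two-sided action on a tensor product, on homogeneous vectors -/

section TensorBiact

variable (M : Bimod P.alg Q.alg) (N : Bimod Q.alg R.alg)

/-- The five values of `α` come from the five associators in `tensorBiact`, in the order of the
factors, and the remaining factors come from `Δ(id_Y)`. -/
theorem tensorBiact_tn {X' X Y Z Z' : G} (a : X' ⟶ X) (g₁ : X ⟶ Y) (g₂ : Y ⟶ Z) (c : Z ⟶ Z')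
    {k : X' ⟶ Z'} {g : X ⟶ Z} {h : X ⟶ Z'} (e : g₁ ≫ g₂ = g) (e' : g ≫ c = h) (e'' : a ≫ h = k)
    (hY : Y ∈ Q.sub.objs) (m : M.X.deg g₁) (n : N.X.deg g₂)
    (hk : ∀ p : Fac (𝟙 Y), (a ≫ g₁ ≫ p.fst) ≫ p.snd ≫ g₂ ≫ c = k) :
    (tensorBiact Q.asec M N).app k
      (tn a h e'' (P.avec a) (tn g c e' (tn g₁ g₂ e m n) (R.avec c))) =
    (Q.outDegree Y : ℂ)⁻¹ • ∑ p : Fac (𝟙 Y),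
      ((α.toFun g₁ g₂ c : ℂ) * (((α.toFun a g₁ (g₂ ≫ c))⁻¹ : Circle) : ℂ) *
        (Q.coeff p.fst p.snd)⁻¹ * (((α.toFun (a ≫ g₁) p.fst p.snd)⁻¹ : Circle) : ℂ) *
        (α.toFun a g₁ p.fst : ℂ) * (α.toFun (a ≫ g₁ ≫ p.fst) p.snd (g₂ ≫ c) : ℂ)) •
      tn (a ≫ g₁ ≫ p.fst) (p.snd ≫ g₂ ≫ c) (hk p)
        (lact M a (g₁ ≫ p.fst) rfl (ract M g₁ p.fst rfl m))
        (lact N p.snd (g₂ ≫ c) rfl (ract N g₂ c rfl n)) := by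
  have e₁ : g₁ ≫ g₂ ≫ c = h := by rw [← e', ← e, Category.assoc]
  have e₂ : (a ≫ g₁) ≫ g₂ ≫ c = k := by rw [Category.assoc, e₁, e'']
  simp only [tensorBiact, comp_app_apply]
  rw [whiskerLeft_tn, associator_hom_tn g₁ g₂ c e e' rfl e₁, tn_smul_right]
  simp only [map_smul]
  rw [associator_inv_tn a g₁ (g₂ ≫ c) rfl e₂ e₁ e'']
  simp only [map_smul]
  rw [whiskerRight_tn, rightUnitor_inv_tn, whiskerRight_tn, whiskerLeft_tn, Q.one_uvec,
    whiskerRight_tn, whiskerLeft_tn, Q.asec_avec ((Q.id_mem_iff Y).2 hY), tn_smul_right,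
    tn_sum_right, tn_smul_left, tn_sum_left]
  simp only [map_smul, map_sum, smul_smul, Finset.smul_sum]
  refine Finset.sum_congr rfl fun p _ => ?_
  have e₃ : ((a ≫ g₁) ≫ p.fst) ≫ p.snd = a ≫ g₁ := by rw [Category.assoc, p.comp, Category.comp_id]
  have e₄ : (a ≫ g₁ ≫ p.fst) ≫ p.snd = a ≫ g₁ := by
    rw [← Category.assoc a, Category.assoc, p.comp, Category.comp_id]
  have e₅ : (a ≫ g₁) ≫ p.fst = a ≫ g₁ ≫ p.fst := Category.assoc _ _ _
  rw [tn_smul_right, tn_smul_left]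
  simp only [map_smul]
  rw [whiskerRight_tn, associator_inv_tn (a ≫ g₁) p.fst p.snd e₅ e₄ p.comp (Category.comp_id _),
    tn_smul_left]
  simp only [map_smul]
  rw [whiskerRight_tn, whiskerRight_tn, associator_hom_tn a g₁ p.fst rfl e₅ rfl rfl,
    tn_smul_left, tn_smul_left]
  simp only [map_smul]
  rw [associator_hom_tn (a ≫ g₁ ≫ p.fst) p.snd (g₂ ≫ c) e₄ e₂ rfl (hk p)]
  simp only [map_smul]
  rw [tensorHom_tn, biact_tn, biact_tn]
  simp only [smul_smul]
  congr 1
  ring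

/-- Factorisations of an identity are pairs `(b, b⁻¹)`, and only those with `b` in the subgroupoid
contribute. -/
theorem sum_fac_id {E : Type*} [AddCommMonoid E] (Y : Q.sub.objs) (F : Fac (𝟙 Y.val) → E)
    (hF : ∀ p, p.fst ∉ Q.sub.arrows Y.val p.mid → F p = 0) :
    ∑ p : Fac (𝟙 Y.val), F p = ∑ Y' : Q.sub.objs, ∑ b : Y ⟶ Y',
      F ⟨Y'.val, b.val, Groupoid.inv b.val, Groupoid.comp_inv b.val⟩ := by
  rw [Finset.sum_sigma']
  symm
  refine Finset.sum_of_injOn (fun s : Σ Y' : Q.sub.objs, Y ⟶ Y' =>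
    (⟨s.1.val, s.2.val, Groupoid.inv s.2.val, Groupoid.comp_inv s.2.val⟩ : Fac (𝟙 Y.val)))
    ?_ (fun _ _ => Finset.mem_coe.2 (Finset.mem_univ _)) ?_ (fun _ _ => rfl)
  · rintro ⟨⟨Z, hZ⟩, ⟨b, hb⟩⟩ _ ⟨⟨Z', hZ'⟩, ⟨b', hb'⟩⟩ _ h
    simp only [Fac.mk.injEq] at h
    obtain ⟨rfl, h, -⟩ := h
    obtain rfl := eq_of_heq h
    rfl
  · rintro ⟨Z, b, b', e⟩ _ h
    refine hF _ fun hb => h ?_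
    refine ⟨⟨⟨Z, Q.sub.mem_objs_of_tgt hb⟩, ⟨b, hb⟩⟩, Finset.mem_coe.2 (Finset.mem_univ _), ?_⟩
    have : b' = Groupoid.inv b := by
      rw [← Category.comp_id (Groupoid.inv b), ← e, ← Category.assoc, Groupoid.inv_comp,
        Category.id_comp]
    subst this
    rfl

/-- The action of a morphism of `Tilde P R` on the outer sides of `M ⊗ N`. -/
def outerBact {g g' : Tilde P R} (f : g ⟶ g') :
    (M.X ⊗ N.X).deg g.mor →ₗ[ℂ] (M.X ⊗ N.X).deg g'.mor :=
  bact (outer M N) f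

/-- The source of the coefficients `comulCoeff`: on `m ⊗ n` the composite is `tensorBiact`, and its
terms are indexed by the pairs `(b, b⁻¹)`. -/
theorem insertSection_outerBact {g g' : Tilde P R} (f : g ⟶ g') (Y : Q.sub.objs)
    (g₁ : g.src.val ⟶ Y.val) (g₂ : Y.val ⟶ g.tgt.val) (e : g₁ ≫ g₂ = g.mor) (m : M.X.deg g₁)
    (n : N.X.deg g₂)
    (hk : ∀ {Y' : G} (b : Y.val ⟶ Y'),
      (f.a.val ≫ g₁ ≫ b) ≫ Groupoid.inv b ≫ g₂ ≫ f.b.val = g'.mor) :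
    (insertSection Q.asec M N).app g'.mor
      (outerBact M N f (tn g₁ g₂ e m n)) =
    ∑ Y' : Q.sub.objs, ∑ b : Y ⟶ Y',
      ((Q.outDegree Y.val : ℂ)⁻¹ * (comulCoeff Q f.a.val g₁ g₂ f.b.val b : ℂ)) •
      tn (f.a.val ≫ g₁ ≫ b.val) (Groupoid.inv b.val ≫ g₂ ≫ f.b.val) (hk b.val)
        (lact M f.a.val (g₁ ≫ b.val) rfl (ract M g₁ b.val rfl m))
        (lact N (Groupoid.inv b.val) (g₂ ≫ f.b.val) rfl (ract N g₂ f.b.val rfl n)) := by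
  have h₀ : ∀ p : Fac (𝟙 Y.val), (f.a.val ≫ g₁ ≫ p.fst) ≫ p.snd ≫ g₂ ≫ f.b.val = g'.mor := by
    rintro ⟨Z, b, b', e'⟩
    have : b' = Groupoid.inv b := by
      rw [← Category.comp_id (Groupoid.inv b), ← e', ← Category.assoc, Groupoid.inv_comp,
        Category.id_comp]
    subst this
    exact hk b
  have h₁ : (insertSection Q.asec M N).app g'.mor
      (outerBact M N f (tn g₁ g₂ e m n)) =
      (tensorBiact Q.asec M N).app g'.mor (tn f.a.val (g.mor ≫ f.b.val) f.comm (P.avec f.a.val)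
        (tn g.mor f.b.val rfl (tn g₁ g₂ e m n) (R.avec f.b.val))) := by
    rw [tensorBiact_eq]
    exact congrArg ((insertSection Q.asec M N).app g'.mor)
      (biactAt_eq (outer M N) f (tn (V := M.X) (W := N.X) g₁ g₂ e m n)).symm
  rw [h₁, tensorBiact_tn M N f.a.val g₁ g₂ f.b.val e rfl f.comm Y.2 m n h₀, sum_fac_id Y,
    Finset.smul_sum]
  · refine Finset.sum_congr rfl fun Y' _ => ?_
    rw [Finset.smul_sum]
    refine Finset.sum_congr rfl fun b _ => ?_
    rw [smul_smul]
    congr 1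
    have h₂ : Q.coeff b.val (Groupoid.inv b.val) = Q.φ b (Groupoid.inv b) :=
      Q.coeff_of_mem b.2 (Q.sub.inv b.2)
    dsimp only
    rw [h₂, comulCoeff]
    simp only [Circle.coe_mul, Circle.coe_inv, mul_inv]
    ring
  · intro p hp
    rw [Q.coeff_eq_zero (fun h => hp h.1), inv_zero, mul_zero, zero_mul, zero_mul, zero_mul,
      zero_smul]

end TensorBiact

/-! ### Total spaces of tensor products -/

namespace GrVec

variable {V W : GrVec α}

open Classical in
theorem totTensor_incl_tn {X Y Z : G} (f : X ⟶ Y) (g : Y ⟶ Z) {k : X ⟶ Z} (e : f ≫ g = k)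
    (v : V.deg f) (w : W.deg g) :
    totTensor V W ((V ⊗ W).incl k (tn f g e v w)) = V.incl f v ⊗ₜ[ℂ] W.incl g w :=
  (DirectSum.toModule_lof ℂ (⟨X, Z, k⟩ : Σ X Y : G, X ⟶ Y) _).trans (tlift_tm _ f g e v w)

open Classical in
variable (V W) in
/-- The product of homogeneous vectors in the tensor product, `0` if the degrees are not
composable. -/
def inclPair {X Y Y' Z : G} (f : X ⟶ Y) (g : Y' ⟶ Z) :
    V.deg f →ₗ[ℂ] W.deg g →ₗ[ℂ] (V ⊗ W).total :=
  if h : Y = Y' then by subst h; exact (tnL f g rfl).compr₂ ((V ⊗ W).incl (f ≫ g)) else 0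

theorem inclPair_apply {X Y Z : G} (f : X ⟶ Y) (g : Y ⟶ Z) {k : X ⟶ Z} (e : f ≫ g = k)
    (v : V.deg f) (w : W.deg g) : inclPair V W f g v w = (V ⊗ W).incl k (tn f g e v w) := by
  subst e
  rw [inclPair, dif_pos rfl]
  rfl

theorem inclPair_of_ne {X Y Y' Z : G} (f : X ⟶ Y) (g : Y' ⟶ Z) (h : Y ≠ Y') :
    inclPair V W f g = 0 := dif_neg h

open Classical in
variable (V W) in
/-- The projection of the tensor product of the total spaces to the total space of the tensor
product. -/
def totProj : V.total ⊗[ℂ] W.total →ₗ[ℂ] (V ⊗ W).total :=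
  TensorProduct.lift <| DirectSum.toModule ℂ _ _ fun k =>
    LinearMap.flip <| DirectSum.toModule ℂ _ _ fun l => (inclPair V W k.2.2 l.2.2).flip

open Classical in
theorem totProj_incl {X Y Y' Z : G} (f : X ⟶ Y) (g : Y' ⟶ Z) (v : V.deg f) (w : W.deg g) :
    totProj V W (V.incl f v ⊗ₜ[ℂ] W.incl g w) = inclPair V W f g v w := by
  rw [totProj, TensorProduct.lift.tmul, incl, incl]
  rw [DirectSum.toModule_lof]
  rw [LinearMap.flip_apply, DirectSum.toModule_lof]
  rfl

/-- The graded tensor product keeps only composable pairs of degrees, so its total space is a direct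
summand of the product of total spaces. -/
theorem totProj_totTensor (u : (V ⊗ W).total) : totProj V W (totTensor V W u) = u := by
  suffices H : totProj V W ∘ₗ totTensor V W = LinearMap.id from LinearMap.congr_fun H u
  refine total_linearMap_ext fun {X Z} k v => ?_
  suffices H : (totProj V W ∘ₗ totTensor V W) ∘ₗ (V ⊗ W).incl k = (V ⊗ W).incl k from
    LinearMap.congr_fun H v
  apply tensor_linearMap_ext
  intro Y f g e v w
  rw [LinearMap.comp_apply, LinearMap.comp_apply, totTensor_incl_tn, totProj_incl,
    inclPair_apply f g e]

theorem totTensor_injective : Function.Injective (totTensor V W) :=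
  Function.LeftInverse.injective totProj_totTensor

end GrVec

open TwistedAlgebra

variable {G : Type} [Groupoid.{0} G] {α : Cocycle₃ G} [Fintype G] [∀ X Y : G, Fintype (X ⟶ Y)]
  {P Q R : TwistedSubgroupoid α}

/-! ### The comultiplication acting on tensor products of total spaces -/

section Comul

variable (M : Bimod P.alg Q.alg) (N : Bimod Q.alg R.alg)

/-- The action of a tensor product of twisted groupoid algebras on a tensor product of total
spaces. -/
def rho₂ : TwistedAlgebra (Tilde.varpi P Q) ⊗[ℂ] TwistedAlgebra (Tilde.varpi Q R) →ₗ[ℂ]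
    M.X.total ⊗[ℂ] N.X.total →ₗ[ℂ] M.X.total ⊗[ℂ] N.X.total :=
  TensorProduct.lift
    ((TensorProduct.mapBilinear (RingHom.id ℂ) _ _ _ _).compl₁₂ (rho M) (rho N))

theorem rho₂_tmul (x : TwistedAlgebra (Tilde.varpi P Q)) (y : TwistedAlgebra (Tilde.varpi Q R))
    (u : M.X.total) (v : N.X.total) :
    rho₂ M N (x ⊗ₜ y) (u ⊗ₜ v) = rho M x u ⊗ₜ[ℂ] rho N y v := rfl

variable {M N}

theorem tensor_total_ext {E : Type*} [AddCommMonoid E] [Module ℂ E]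
    {F F' : M.X.total ⊗[ℂ] N.X.total →ₗ[ℂ] E}
    (h : ∀ (g₁ : Tilde P Q) (g₂ : Tilde Q R) (m : M.X.deg g₁.mor) (n : N.X.deg g₂.mor),
      F (M.X.incl g₁.mor m ⊗ₜ N.X.incl g₂.mor n) = F' (M.X.incl g₁.mor m ⊗ₜ N.X.incl g₂.mor n)) :
    F = F' := by
  apply TensorProduct.ext
  refine total_ext_tilde M fun g₁ m => total_ext_tilde N fun g₂ n => ?_
  exact h g₁ g₂ m n

variable (M N)

theorem comul_ket {g g' : Tilde P R} (f : g ⟶ g') : comul P Q R (ket f) = comulKet P Q R f :=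
  sum_coeff_ket_smul (fun _ _ f => comulKet P Q R f) f

theorem rho₂_comulKet_of_ne {g g' : Tilde P R} (f : g ⟶ g') (g₁ : Tilde P Q) (g₂ : Tilde Q R)
    (h : ¬∃ (Y : Q.sub.objs) (k : g.src.val ⟶ Y.val),
      g₁ = ⟨g.src, Y, k⟩ ∧ g₂ = ⟨Y, g.tgt, Groupoid.inv k ≫ g.mor⟩)
    (m : M.X.deg g₁.mor) (n : N.X.deg g₂.mor) :
    rho₂ M N (comulKet P Q R f) (M.X.incl g₁.mor m ⊗ₜ N.X.incl g₂.mor n) = 0 := by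
  simp only [comulKet, map_sum, map_smul, LinearMap.sum_apply, LinearMap.smul_apply]
  refine Finset.sum_eq_zero fun Y _ => Finset.sum_eq_zero fun k _ =>
    Finset.sum_eq_zero fun Y' _ => Finset.sum_eq_zero fun b _ => ?_
  rw [rho₂_tmul]
  by_cases h₁ : g₁ = ⟨g.src, Y, k⟩
  · rw [rho_ket_incl_of_ne N _ _ (fun h' => h ⟨Y, k, h₁, Tilde.ext_sigma h'⟩),
      TensorProduct.tmul_zero, smul_zero]
  · rw [rho_ket_incl_of_ne M _ _ (fun h' => h₁ (Tilde.ext_sigma h')), TensorProduct.zero_tmul,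
      smul_zero]

theorem rho₂_comulKet {g g' : Tilde P R} (f : g ⟶ g') (Y : Q.sub.objs) (k : g.src.val ⟶ Y.val)
    (m : M.X.deg k) (n : N.X.deg (Groupoid.inv k ≫ g.mor)) :
    rho₂ M N (comulKet P Q R f) (M.X.incl k m ⊗ₜ N.X.incl (Groupoid.inv k ≫ g.mor) n) =
      ∑ Y' : Q.sub.objs, ∑ b : Y ⟶ Y', ((Q.outDegree Y.val : ℂ)⁻¹ *
        (comulCoeff Q f.a.val k (Groupoid.inv k ≫ g.mor) f.b.val b : ℂ)) •
      (M.X.incl (f.a.val ≫ k ≫ b.val) (lact M f.a.val (k ≫ b.val) rfl (ract M k b.val rfl m)) ⊗ₜ[ℂ]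
        N.X.incl (Groupoid.inv b.val ≫ (Groupoid.inv k ≫ g.mor) ≫ f.b.val)
          (lact N (Groupoid.inv b.val) ((Groupoid.inv k ≫ g.mor) ≫ f.b.val) rfl
            (ract N (Groupoid.inv k ≫ g.mor) f.b.val rfl n))) := by
  simp only [comulKet, map_sum, map_smul, LinearMap.sum_apply, LinearMap.smul_apply]
  rw [Finset.sum_eq_single Y, Finset.sum_eq_single k]
  · refine Finset.sum_congr rfl fun Y' _ => Finset.sum_congr rfl fun b _ => ?_
    rw [rho₂_tmul]
    congr 2
    · exact rho_ket_incl M (show (⟨g.src, Y, k⟩ : Tilde P Q) ⟶ ⟨g'.src, Y', f.a.val ≫ k ≫ b.val⟩ from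
        ⟨f.a, b, rfl⟩) m
    · exact rho_ket_incl N (show (⟨Y, g.tgt, Groupoid.inv k ≫ g.mor⟩ : Tilde Q R) ⟶
        ⟨Y', g'.tgt, Groupoid.inv b.val ≫ (Groupoid.inv k ≫ g.mor) ≫ f.b.val⟩ from
          ⟨Groupoid.inv b, f.b, rfl⟩) n
  · intro k' _ hk
    refine Finset.sum_eq_zero fun Y' _ => Finset.sum_eq_zero fun b _ => ?_
    rw [rho₂_tmul, rho_ket_incl_of_ne M, TensorProduct.zero_tmul, smul_zero]
    intro h
    simp only [Sigma.mk.injEq, heq_eq_eq, true_and] at h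
    exact hk h.symm
  · simp
  · intro Y₁ _ hY
    refine Finset.sum_eq_zero fun k' _ => Finset.sum_eq_zero fun Y' _ =>
      Finset.sum_eq_zero fun b _ => ?_
    rw [rho₂_tmul, rho_ket_incl_of_ne M, TensorProduct.zero_tmul, smul_zero]
    intro h
    simp only [Sigma.mk.injEq, heq_eq_eq, true_and] at h
    exact hY (Subtype.ext h.1.symm)
  · simp

/-- The action of the twisted groupoid algebra on the outer sides of `M ⊗ N`. -/
def outerRho : TwistedAlgebra (Tilde.varpi P R) →ₗ[ℂ]
    (M.X ⊗ N.X).total →ₗ[ℂ] (M.X ⊗ N.X).total :=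
  rho (outer M N)

theorem outerRho_ket_incl {g g' : Tilde P R} (f : g ⟶ g') (v : (M.X ⊗ N.X).deg g.mor) :
    outerRho M N (ket f) ((M.X ⊗ N.X).incl g.mor v) =
      (M.X ⊗ N.X).incl g'.mor (outerBact M N f v) :=
  rho_ket_incl (outer M N) f v

theorem outerRho_ket_incl_of_ne {g g' : Tilde P R} (f : g ⟶ g') {X Y : G} (k : X ⟶ Y)
    (h : (⟨X, Y, k⟩ : Σ X Y : G, X ⟶ Y) ≠ ⟨g.src.val, g.tgt.val, g.mor⟩)
    (v : (M.X ⊗ N.X).deg k) : outerRho M N (ket f) ((M.X ⊗ N.X).incl k v) = 0 :=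
  rho_ket_incl_of_ne (outer M N) f k h v

theorem outerRho_mul (x y : TwistedAlgebra (Tilde.varpi P R)) (u : (M.X ⊗ N.X).total) :
    outerRho M N (x * y) u = outerRho M N y (outerRho M N x u) :=
  LinearMap.congr_fun (rho_mul (outer M N) x y) u

theorem outerRho_one (u : (M.X ⊗ N.X).total) : outerRho M N (1 : TwistedAlgebra _) u = u :=
  LinearMap.congr_fun (rho_one (outer M N)) u

/-- Insertion of the separability section on total spaces. -/
def insertTotal : (M.X ⊗ N.X).total →ₗ[ℂ] (M.X ⊗ N.X).total :=
  totalMap (insertSection Q.asec M N)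

/-- Conceptual form of the comultiplication. On a composable pair whose composite is the source of
the ket, both sides are the sum of `insertSection_outerBact`; on all other pairs both sides vanish.
-/
theorem rho₂_comul_apply (x : TwistedAlgebra (Tilde.varpi P R)) (w : M.X.total ⊗[ℂ] N.X.total) :
    rho₂ M N (comul P Q R x) w =
      totTensor M.X N.X (insertTotal M N (outerRho M N x (totProj M.X N.X w))) := by
  suffices H : rho₂ M N (comul P Q R x) = totTensor M.X N.X ∘ₗ insertTotal M N ∘ₗ
      outerRho M N x ∘ₗ totProj M.X N.X from LinearMap.congr_fun H w
  induction x using ket_induction with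
  | zero => rw [map_zero, map_zero, map_zero, LinearMap.zero_comp, LinearMap.comp_zero, LinearMap.comp_zero]
  | add x y hx hy =>
    rw [map_add, map_add, map_add, hx, hy, LinearMap.add_comp, LinearMap.comp_add,
      LinearMap.comp_add]
  | smul c x hx =>
    rw [map_smul, map_smul, map_smul, hx, LinearMap.smul_comp, LinearMap.comp_smul,
      LinearMap.comp_smul]
  | @ket g g' f =>
    rw [comul_ket]
    refine tensor_total_ext fun g₁ g₂ m n => ?_
    rw [LinearMap.comp_apply, LinearMap.comp_apply, LinearMap.comp_apply, totProj_incl]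
    by_cases h : ∃ (Y : Q.sub.objs) (k : g.src.val ⟶ Y.val),
      g₁ = ⟨g.src, Y, k⟩ ∧ g₂ = ⟨Y, g.tgt, Groupoid.inv k ≫ g.mor⟩
    · obtain ⟨Y, k, rfl, rfl⟩ := h
      have e : k ≫ Groupoid.inv k ≫ g.mor = g.mor := by
        rw [← Category.assoc, Groupoid.comp_inv, Category.id_comp]
      dsimp only
      have hk : ∀ {Y' : G} (b : Y.val ⟶ Y'), (f.a.val ≫ k ≫ b) ≫ Groupoid.inv b ≫
          (Groupoid.inv k ≫ g.mor) ≫ f.b.val = g'.mor := by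
        intro Y' b
        rw [← f.comm]
        simp
      rw [rho₂_comulKet, inclPair_apply k _ e, outerRho_ket_incl, insertTotal, totalMap_incl,
        insertSection_outerBact M N f Y k _ e m n hk]
      simp only [map_sum, map_smul, totTensor_incl_tn]
    · rw [rho₂_comulKet_of_ne M N f g₁ g₂ h]
      by_cases h₁ : g₁.tgt = g₂.src
      · obtain ⟨Y, Z, l⟩ := g₂
        dsimp only at h₁
        subst h₁
        dsimp only
        rw [inclPair_apply g₁.mor l rfl]
        have h₂ : outerRho M N (ket f) ((M.X ⊗ N.X).incl (g₁.mor ≫ l)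
            (tn g₁.mor l rfl m n)) = 0 := by
          refine outerRho_ket_incl_of_ne M N f _ (fun h' => h ?_) _
          obtain rfl : (⟨g₁.src, Z, g₁.mor ≫ l⟩ : Tilde P R) = g := Tilde.ext_sigma h'
          refine ⟨g₁.tgt, g₁.mor, rfl, ?_⟩
          simp
        rw [h₂, map_zero, map_zero]
      · rw [inclPair_of_ne _ _ (fun h' => h₁ (Subtype.ext h')), LinearMap.zero_apply,
          LinearMap.zero_apply, map_zero, map_zero, map_zero]

theorem rho₂_mul (z w : TwistedAlgebra (Tilde.varpi P Q) ⊗[ℂ] TwistedAlgebra (Tilde.varpi Q R)) :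
    rho₂ M N (z * w) = rho₂ M N w ∘ₗ rho₂ M N z := by
  induction z using TensorProduct.induction_on with
  | zero => rw [zero_mul, map_zero, LinearMap.comp_zero]
  | add z z' h h' => rw [add_mul, map_add, map_add, h, h', LinearMap.comp_add]
  | tmul x y =>
    induction w using TensorProduct.induction_on with
    | zero => rw [mul_zero, map_zero, LinearMap.zero_comp]
    | add z z' h h' => rw [mul_add, map_add, map_add, h, h', LinearMap.add_comp]
    | tmul x' y' =>
      rw [Algebra.TensorProduct.tmul_mul_tmul]
      refine TensorProduct.ext' fun u v => ?_
      rw [LinearMap.comp_apply, rho₂_tmul, rho₂_tmul, rho₂_tmul, rho_mul, rho_mul]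
      rfl

/-- Insertion of the separability section, as a map of bimodules. -/
def insertSectionHom : outer M N ⟶ outer M N where
  hom := insertSection Q.asec M N
  left_act_hom := (actLeft_insertSection M N).symm
  right_act_hom := (insertSection_actRight M N).symm

theorem insertSection_asec_idem :
    insertSection Q.asec M N ≫ insertSection Q.asec M N = insertSection Q.asec M N :=
  insertSection_idem M N Q.isSeparableSection_asec

theorem insertTotal_insertTotal (u : (M.X ⊗ N.X).total) :
    insertTotal M N (insertTotal M N u) = insertTotal M N u := by
  rw [insertTotal, ← LinearMap.comp_apply, ← totalMap_comp, insertSection_asec_idem]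

theorem insertTotal_outerRho (x : TwistedAlgebra (Tilde.varpi P R)) (u : (M.X ⊗ N.X).total) :
    insertTotal M N (outerRho M N x u) = outerRho M N x (insertTotal M N u) :=
  totalMap_rho (insertSectionHom M N) x u

/-- Between two factors of the form `rho₂_comul_apply` the inclusion and projection cancel. The
insertion commutes with the outer action, so its two copies merge by idempotence. -/
theorem rho₂_comul_mul (x y : TwistedAlgebra (Tilde.varpi P R)) :
    rho₂ M N (comul P Q R (x * y)) = rho₂ M N (comul P Q R x * comul P Q R y) := by
  refine LinearMap.ext fun t => ?_
  rw [rho₂_mul, LinearMap.comp_apply, rho₂_comul_apply, rho₂_comul_apply, rho₂_comul_apply,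
    totProj_totTensor, outerRho_mul, ← insertTotal_outerRho, insertTotal_insertTotal]

end Comul

/-! ### Faithfulness of the action on regular bimodules -/

section Regular

variable (P Q)

/-- The bimodule corresponding to the regular right module. -/
def regular : Bimod P.alg Q.alg := homogBimod P Q (TwistedAlgebra (Tilde.varpi P Q))

/-- The identification of the total space of the regular bimodule. -/
def regularEquiv : (regular P Q).X.total ≃ₗ[ℂ] TwistedAlgebra (Tilde.varpi P Q) :=
  LinearEquiv.ofLinearMap (homogSum P Q (TwistedAlgebra (Tilde.varpi P Q))) (homogSplit P Q _)
    (LinearMap.ext homogSum_homogSplit) homogSplit_homogSum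

theorem regularEquiv_rho (x : TwistedAlgebra (Tilde.varpi P Q)) (t : (regular P Q).X.total) :
    regularEquiv P Q (rho (regular P Q) x t) = regularEquiv P Q t * x :=
  LinearMap.congr_fun (homogSum_rho (V := TwistedAlgebra (Tilde.varpi P Q)) x) t

/-- An element of the tensor product of the two algebras is recovered from its action on `1 ⊗ 1`. -/
theorem rho₂_regular_injective : Function.Injective (rho₂ (regular P Q) (regular Q R)) := by
  have h : ∀ z, TensorProduct.map (regularEquiv P Q).toLinearMap (regularEquiv Q R).toLinearMap
      (rho₂ (regular P Q) (regular Q R) z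
        ((regularEquiv P Q).symm 1 ⊗ₜ (regularEquiv Q R).symm 1)) = z := by
    intro z
    induction z using TensorProduct.induction_on with
    | zero => simp only [map_zero, LinearMap.zero_apply]
    | add z z' h h' => rw [map_add, LinearMap.add_apply, map_add, h, h']
    | tmul x y =>
      rw [rho₂_tmul, TensorProduct.map_tmul]
      change regularEquiv P Q _ ⊗ₜ regularEquiv Q R _ = _
      rw [regularEquiv_rho, regularEquiv_rho, LinearEquiv.apply_symm_apply,
        LinearEquiv.apply_symm_apply, one_mul, one_mul]
  intro z w hzw
  rw [← h z, hzw, h w]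

end Regular

theorem comul_mul (x y : TwistedAlgebra (Tilde.varpi P R)) :
    comul P Q R (x * y) = comul P Q R x * comul P Q R y :=
  rho₂_regular_injective P Q (rho₂_comul_mul _ _ x y)

/-! ### Relative tensor products -/

section Monoidal

open MonObj

variable {C : Type*} [Category C] [MonoidalCategory C] {A B D : Mon C}

/-- The tensor product of two bimodule maps, as a map for the outer actions. -/
def outerHom {M M' : Bimod A B} {N N' : Bimod B D} (f : M ⟶ M') (g : N ⟶ N') :
    outer M N ⟶ outer M' N' where
  hom := f.hom ⊗ₘ g.hom
  left_act_hom := by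
    change ((α_ A.X M.X N.X).inv ≫ M.actLeft ▷ N.X) ≫ (f.hom ⊗ₘ g.hom) =
      A.X ◁ (f.hom ⊗ₘ g.hom) ≫ (α_ A.X M'.X N'.X).inv ≫ M'.actLeft ▷ N'.X
    simp only [MonoidalCategory.tensorHom_def, Category.assoc, whiskerLeft_comp]
    rw [← comp_whiskerRight_assoc, f.left_act_hom, comp_whiskerRight_assoc,
      associator_inv_naturality_right_assoc, whisker_exchange, associator_inv_naturality_middle_assoc]
  right_act_hom := by
    change ((α_ M.X N.X D.X).hom ≫ M.X ◁ N.actRight) ≫ (f.hom ⊗ₘ g.hom) =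
      (f.hom ⊗ₘ g.hom) ▷ D.X ≫ (α_ M'.X N'.X D.X).hom ≫ M'.X ◁ N'.actRight
    simp only [MonoidalCategory.tensorHom_def', Category.assoc, comp_whiskerRight]
    rw [← whiskerLeft_comp_assoc, g.right_act_hom, whiskerLeft_comp_assoc,
      associator_naturality_left_assoc, ← whisker_exchange, associator_naturality_middle_assoc]

/-- The map of retracts induced by a bimodule map which commutes with the idempotents. -/
def retractHom {O O' : Bimod A D} (h : O ⟶ O') {e : O.X ⟶ O.X} {e' : O'.X ⟶ O'.X}
    (hl : A.X ◁ e ≫ O.actLeft = O.actLeft ≫ e) (hr : e ▷ D.X ≫ O.actRight = O.actRight ≫ e)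
    {T T' : C} (s : O.X ⟶ T) (r : T ⟶ O.X) (hsr : s ≫ r = e) (hrs : r ≫ s = 𝟙 T)
    (hl' : A.X ◁ e' ≫ O'.actLeft = O'.actLeft ≫ e') (hr' : e' ▷ D.X ≫ O'.actRight = O'.actRight ≫ e')
    (s' : O'.X ⟶ T') (r' : T' ⟶ O'.X) (hsr' : s' ≫ r' = e') (hrs' : r' ≫ s' = 𝟙 T')
    (he : h.hom ≫ e' = e ≫ h.hom) :
    retract O hl hr s r hsr hrs ⟶ retract O' hl' hr' s' r' hsr' hrs' where
  hom := r ≫ h.hom ≫ s'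
  left_act_hom := by
    have h1 : e' ≫ s' = s' := by rw [← hsr', Category.assoc, hrs', Category.comp_id]
    change (A.X ◁ r ≫ O.actLeft ≫ s) ≫ r ≫ h.hom ≫ s' =
      A.X ◁ (r ≫ h.hom ≫ s') ≫ A.X ◁ r' ≫ O'.actLeft ≫ s'
    simp only [Category.assoc, whiskerLeft_comp]
    rw [reassoc_of% hsr, ← reassoc_of% he, h1, h.left_act_hom_assoc, ← whiskerLeft_comp_assoc _ s',
      hsr', reassoc_of% hl', h1]
  right_act_hom := by
    have h1 : e' ≫ s' = s' := by rw [← hsr', Category.assoc, hrs', Category.comp_id]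
    change (r ▷ D.X ≫ O.actRight ≫ s) ≫ r ≫ h.hom ≫ s' =
      (r ≫ h.hom ≫ s') ▷ D.X ≫ r' ▷ D.X ≫ O'.actRight ≫ s'
    simp only [Category.assoc, comp_whiskerRight]
    rw [reassoc_of% hsr, ← reassoc_of% he, h1, h.right_act_hom_assoc, ← comp_whiskerRight_assoc s',
      hsr', reassoc_of% hr', h1]

/-- The action of `T` ends in `s`, and `s ≫ r` is the insertion, which is absorbed by the insertion
already contained in `tensorBiact`. -/
theorem IsRelTensor.biact_comp {Δ : B.X ⟶ B.X ⊗ B.X} {M : Bimod A B} {N : Bimod B D} {T : Bimod A D}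
    {s : M.X ⊗ N.X ⟶ T.X} {r : T.X ⟶ M.X ⊗ N.X} (h : IsRelTensor Δ M N T s r)
    (hΔ : IsSeparableSection B Δ) :
    biact T ≫ r = A.X ◁ (r ▷ D.X) ≫ biact (outer M N) ≫ insertSection Δ M N := by
  have h1 : tensorBiact Δ M N ≫ s ≫ r = biact (outer M N) ≫ insertSection Δ M N := by
    rw [h.split, sepIdem_eq, tensorBiact_eq]
    exact (Category.assoc _ _ _).trans (congrArg _ (insertSection_idem M N hΔ))
  rw [h.action, Category.assoc, Category.assoc]
  exact congrArg (A.X ◁ (r ▷ D.X) ≫ ·) h1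

variable (Δ : B.X ⟶ B.X ⊗ B.X) (T : Bimod A B → Bimod B D → C)
  (s : ∀ (M : Bimod A B) (N : Bimod B D), M.X ⊗ N.X ⟶ T M N)
  (r : ∀ (M : Bimod A B) (N : Bimod B D), T M N ⟶ M.X ⊗ N.X)
  (hsr : ∀ M N, s M N ≫ r M N = insertSection Δ M N) (hrs : ∀ M N, r M N ≫ s M N = 𝟙 (T M N))

/-- The bimodule structure on a splitting of the separability idempotent. -/
def relTensor (M : Bimod A B) (N : Bimod B D) : Bimod A D :=
  retract (outer M N) (e := insertSection Δ M N) (actLeft_insertSection M N)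
    (insertSection_actRight M N) (s M N) (r M N) (hsr M N) (hrs M N)

/-- The map of relative tensor products induced by bimodule maps. -/
def relTensorMap {M M' : Bimod A B} {N N' : Bimod B D} (f : M ⟶ M') (g : N ⟶ N') :
    relTensor Δ T s r hsr hrs M N ⟶ relTensor Δ T s r hsr hrs M' N' :=
  retractHom (outerHom f g) _ _ (s M N) (r M N) _ _ _ _ (s M' N') (r M' N') _ _
    (insertSection_naturality f g)

theorem isRelTensor_relTensor (M : Bimod A B) (N : Bimod B D) :
    IsRelTensor Δ M N (relTensor Δ T s r hsr hrs M N) (s M N) (r M N) where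
  split := (hsr M N).trans (sepIdem_eq M N).symm
  retract := hrs M N
  action := by
    have h : insertSection Δ M N ≫ s M N = s M N := by
      rw [← hsr, Category.assoc, hrs, Category.comp_id]
    refine (retract_biact (outer M N) _ _ _ _ _ _).trans ?_
    rw [tensorBiact_eq]
    exact congrArg (A.X ◁ (r M N ▷ D.X) ≫ ·)
      ((Category.assoc _ _ _).trans (congrArg (biact (outer M N) ≫ ·) h)).symm

/-- The relative tensor product as a bifunctor. -/
def relTensorFunctor : Bimod A B × Bimod B D ⥤ Bimod A D where
  obj X := relTensor Δ T s r hsr hrs X.1 X.2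
  map f := relTensorMap Δ T s r hsr hrs f.1 f.2
  map_id X := by
    apply Bimod.hom_ext
    change r X.1 X.2 ≫ (𝟙 X.1.X ⊗ₘ 𝟙 X.2.X) ≫ s X.1 X.2 = 𝟙 (T X.1 X.2)
    rw [id_tensorHom_id, Category.id_comp, hrs]
  map_comp {X Y Z} f g := by
    apply Bimod.hom_ext
    change r X.1 X.2 ≫ ((f.1.hom ≫ g.1.hom) ⊗ₘ (f.2.hom ≫ g.2.hom)) ≫ s Z.1 Z.2 =
      (r X.1 X.2 ≫ (f.1.hom ⊗ₘ f.2.hom) ≫ s Y.1 Y.2) ≫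
        r Y.1 Y.2 ≫ (g.1.hom ⊗ₘ g.2.hom) ≫ s Z.1 Z.2
    have h : insertSection Δ Z.1 Z.2 ≫ s Z.1 Z.2 = s Z.1 Z.2 := by
      rw [← hsr, Category.assoc, hrs, Category.comp_id]
    simp only [Category.assoc]
    rw [reassoc_of% hsr, ← reassoc_of% (insertSection_naturality g.1 g.2), h,
      tensorHom_comp_tensorHom_assoc]

theorem exists_relTensor_functor
    (hsr : ∀ M N, s M N ≫ r M N = insertSection Δ M N) (hrs : ∀ M N, r M N ≫ s M N = 𝟙 (T M N)) :
    ∃ (F : Bimod A B × Bimod B D ⥤ Bimod A D)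
      (s : ∀ (M : Bimod A B) (N : Bimod B D), M.X ⊗ N.X ⟶ (F.obj (M, N)).X)
      (r : ∀ (M : Bimod A B) (N : Bimod B D), (F.obj (M, N)).X ⟶ M.X ⊗ N.X),
      (∀ M N, IsRelTensor Δ M N (F.obj (M, N)) (s M N) (r M N)) ∧
      ∀ (M M' : Bimod A B) (N N' : Bimod B D) (f : M ⟶ M') (g : N ⟶ N'),
        (F.map (Prod.mkHom f g)).hom = r M N ≫ (f.hom ⊗ₘ g.hom) ≫ s M' N' :=
  ⟨relTensorFunctor Δ T s r hsr hrs, s, r, isRelTensor_relTensor Δ T s r hsr hrs,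
    fun _ _ _ _ _ _ => rfl⟩

end Monoidal

variable {G : Type} [Groupoid.{0} G] {α : Cocycle₃ G}

/-! ### Splitting idempotents of graded vector spaces -/

namespace GrVec

variable {V : GrVec α} (e : V ⟶ V)

/-- The image of an endomorphism. -/
def image : GrVec α where
  deg _ _ k := FGModuleCat.of ℂ (LinearMap.range (e.app k))

/-- The corestriction of an endomorphism to its image. -/
def toImage : V ⟶ image e where
  app _ _ k := (e.app k).rangeRestrict

/-- The inclusion of the image of an endomorphism. -/
def ofImage : image e ⟶ V where
  app _ _ k := (LinearMap.range (e.app k)).subtype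

theorem toImage_ofImage : toImage e ≫ ofImage e = e := rfl

theorem ofImage_toImage (h : e ≫ e = e) : ofImage e ≫ toImage e = 𝟙 (image e) := by
  apply hom_ext; intro X Y k
  refine LinearMap.ext ?_
  rintro ⟨_, v, rfl⟩
  exact Subtype.ext (congrArg (fun f : V ⟶ V => f.app k v) h)

end GrVec

variable [Fintype G] [∀ X Y : G, Fintype (X ⟶ Y)] {P Q R : TwistedSubgroupoid α}

/-! ### Relative tensor products inside tensor products of modules -/

section RelMap

variable {M : Bimod P.alg Q.alg} {N : Bimod Q.alg R.alg} {T : Bimod P.alg R.alg}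
  {s : M.X ⊗ N.X ⟶ T.X} {r : T.X ⟶ M.X ⊗ N.X}

theorem IsRelTensor.app_bact (h : IsRelTensor Q.asec M N T s r) {g g' : Tilde P R} (f : g ⟶ g')
    (v : T.X.deg g.mor) : r.app g'.mor (bact T f v) =
      (insertSection Q.asec M N).app g'.mor (outerBact M N f (r.app g.mor v)) := by
  have h₁ := app_congr (h.biact_comp Q.isSeparableSection_asec)
    (tn f.a.val (g.mor ≫ f.b.val) f.comm (P.avec f.a.val)
      (tn g.mor f.b.val rfl v (R.avec f.b.val)))
  rw [comp_app_apply, biact_tn, comp_app_apply, whiskerLeft_tn, whiskerRight_tn] at h₁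
  refine h₁.trans ?_
  exact congrArg ((insertSection Q.asec M N).app g'.mor)
    (biactAt_eq (outer M N) f (r.app g.mor v))

theorem IsRelTensor.totalMap_rho (h : IsRelTensor Q.asec M N T s r)
    (x : TwistedAlgebra (Tilde.varpi P R)) (t : T.X.total) :
    totalMap r (rho T x t) = insertTotal M N (outerRho M N x (totalMap r t)) := by
  suffices H : totalMap r ∘ₗ rho T x = insertTotal M N ∘ₗ outerRho M N x ∘ₗ totalMap r from
    LinearMap.congr_fun H t
  induction x using TwistedAlgebra.ket_induction with
  | zero => rw [map_zero, map_zero, LinearMap.zero_comp, LinearMap.comp_zero, LinearMap.comp_zero]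
  | add x y hx hy =>
    rw [map_add, map_add, LinearMap.comp_add, hx, hy, LinearMap.add_comp, LinearMap.comp_add]
  | smul c x hx =>
    rw [map_smul, map_smul, LinearMap.comp_smul, hx, LinearMap.smul_comp, LinearMap.comp_smul]
  | @ket g₀ g₁ f =>
    refine total_ext_tilde T fun g v => ?_
    rw [LinearMap.comp_apply, LinearMap.comp_apply, LinearMap.comp_apply, totalMap_incl]
    by_cases h₀ : g = g₀
    · subst h₀
      rw [rho_ket_incl, outerRho_ket_incl, totalMap_incl, insertTotal, totalMap_incl, h.app_bact]
    · have h₂ := fun h => h₀ (Tilde.ext_sigma h)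
      rw [rho_ket_incl_of_ne T f _ h₂, outerRho_ket_incl_of_ne M N f _ h₂, map_zero, map_zero]

variable {U V W : Type} [AddCommGroup U] [Module ℂ U]
  [Module (TwistedAlgebra (Tilde.varpi P R))ᵐᵒᵖ U]
  [AddCommGroup V] [Module ℂ V] [Module (TwistedAlgebra (Tilde.varpi P Q))ᵐᵒᵖ V]
  [IsScalarTower ℂ (TwistedAlgebra (Tilde.varpi P Q))ᵐᵒᵖ V]
  [AddCommGroup W] [Module ℂ W] [Module (TwistedAlgebra (Tilde.varpi Q R))ᵐᵒᵖ W]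
  [IsScalarTower ℂ (TwistedAlgebra (Tilde.varpi Q R))ᵐᵒᵖ W]
  (θM : V ≃ₗ[ℂ] M.X.total) (θN : W ≃ₗ[ℂ] N.X.total) (θT : U ≃ₗ[ℂ] T.X.total)

theorem rAct₂_congr
    (hM : ∀ (x : TwistedAlgebra (Tilde.varpi P Q)) (v : V),
      θM (MulOpposite.op x • v) = rho M x (θM v))
    (hN : ∀ (x : TwistedAlgebra (Tilde.varpi Q R)) (w : W),
      θN (MulOpposite.op x • w) = rho N x (θN w))
    (z : TwistedAlgebra (Tilde.varpi P Q) ⊗[ℂ] TwistedAlgebra (Tilde.varpi Q R)) (t : V ⊗[ℂ] W) :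
    TensorProduct.congr θM θN (rAct₂ (TwistedAlgebra (Tilde.varpi P Q))
      (TwistedAlgebra (Tilde.varpi Q R)) V W z t) = rho₂ M N z (TensorProduct.congr θM θN t) := by
  induction z using TensorProduct.induction_on with
  | zero => rw [map_zero, map_zero, LinearMap.zero_apply, LinearMap.zero_apply, map_zero]
  | add z z' h h' => rw [map_add, map_add, LinearMap.add_apply, LinearMap.add_apply, map_add, h, h']
  | tmul x y =>
    induction t using TensorProduct.induction_on with
    | zero => rw [map_zero, map_zero, map_zero]
    | add t t' h h' => rw [map_add, map_add, h, h', map_add, map_add]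
    | tmul v w =>
      rw [TensorProduct.congr_tmul, rho₂_tmul, ← hM, ← hN]
      rfl

theorem congr_relMap (u : U) :
    TensorProduct.congr θM θN (relMap θM θN θT r u) =
      totTensor M.X N.X (totalMap r (θT u)) :=
  (TensorProduct.congr θM θN).apply_symm_apply _

/-- The map `r` has the left inverse `s` on total spaces, and `totTensor` is injective. -/
theorem IsRelTensor.relMap_injective (h : IsRelTensor Q.asec M N T s r) :
    Function.Injective (relMap θM θN θT r) := by
  have h₁ : Function.Injective (totalMap r) := by
    refine Function.LeftInverse.injective (g := totalMap s) fun t => ?_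
    rw [← LinearMap.comp_apply, ← totalMap_comp, h.retract, totalMap_id, LinearMap.id_apply]
  intro u u' hu
  have h₂ := congrArg (TensorProduct.congr θM θN) hu
  rw [congr_relMap, congr_relMap] at h₂
  exact θT.injective (h₁ (totTensor_injective h₂))

theorem IsRelTensor.relMap_smul (h : IsRelTensor Q.asec M N T s r)
    (hM : ∀ (x : TwistedAlgebra (Tilde.varpi P Q)) (v : V),
      θM (MulOpposite.op x • v) = rho M x (θM v))
    (hN : ∀ (x : TwistedAlgebra (Tilde.varpi Q R)) (w : W),
      θN (MulOpposite.op x • w) = rho N x (θN w))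
    (hT : ∀ (x : TwistedAlgebra (Tilde.varpi P R)) (u : U),
      θT (MulOpposite.op x • u) = rho T x (θT u))
    (x : TwistedAlgebra (Tilde.varpi P R)) (u : U) :
    relMap θM θN θT r (MulOpposite.op x • u) = rAct₂ (TwistedAlgebra (Tilde.varpi P Q))
      (TwistedAlgebra (Tilde.varpi Q R)) V W (comul P Q R x) (relMap θM θN θT r u) := by
  apply (TensorProduct.congr θM θN).injective
  rw [rAct₂_congr θM θN hM hN, congr_relMap, congr_relMap, hT, h.totalMap_rho, rho₂_comul_apply,
    totProj_totTensor]

/-- By `rho₂_comul_apply` at `x = 1`, the operator is `totProj`, then `s`, then `r`, then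
`totTensor`. Its image is that of the last two maps because `s` and `totProj` are surjective. -/
theorem IsRelTensor.range_relMap (h : IsRelTensor Q.asec M N T s r)
    (hM : ∀ (x : TwistedAlgebra (Tilde.varpi P Q)) (v : V),
      θM (MulOpposite.op x • v) = rho M x (θM v))
    (hN : ∀ (x : TwistedAlgebra (Tilde.varpi Q R)) (w : W),
      θN (MulOpposite.op x • w) = rho N x (θN w)) :
    LinearMap.range (relMap θM θN θT r) = LinearMap.range
      (rAct₂ (TwistedAlgebra (Tilde.varpi P Q)) (TwistedAlgebra (Tilde.varpi Q R)) V W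
        (comul P Q R 1)) := by
  have h₁ : insertTotal M N = totalMap r ∘ₗ totalMap s := by
    rw [insertTotal, ← totalMap_comp, h.split, sepIdem_eq]
  have h₂ : ∀ t, totalMap s (totalMap r t) = t := fun t => by
    rw [← LinearMap.comp_apply, ← totalMap_comp, h.retract, totalMap_id, LinearMap.id_apply]
  have h₃ := rAct₂_congr θM θN hM hN (comul P Q R 1)
  ext t
  simp only [LinearMap.mem_range]
  constructor
  · rintro ⟨u, rfl⟩
    refine ⟨relMap θM θN θT r u, (TensorProduct.congr θM θN).injective ?_⟩
    rw [h₃, congr_relMap, rho₂_comul_apply, totProj_totTensor, outerRho_one, h₁,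
      LinearMap.comp_apply, h₂]
  · rintro ⟨w, rfl⟩
    refine ⟨θT.symm (totalMap s (totProj M.X N.X (TensorProduct.congr θM θN w))),
      (TensorProduct.congr θM θN).injective ?_⟩
    rw [h₃, congr_relMap, rho₂_comul_apply, outerRho_one, h₁, LinearMap.comp_apply,
      LinearEquiv.apply_symm_apply]

end RelMap

variable (P Q R)

theorem toModulesEquiv_smul (M : Bimod P.alg Q.alg) (x : TwistedAlgebra (Tilde.varpi P Q))
    (v : ((toModules P Q).obj M).obj) :
    toModulesEquiv P Q M (MulOpposite.op x • v) = rho M x (toModulesEquiv P Q M v) := rfl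

end GroupoidGraded

end

theorem mainTheorem8 {G : Type} [Groupoid.{0} G] [Fintype G] [∀ X Y : G, Fintype (X ⟶ Y)]
    (α : Cocycle₃ G) :
    (∀ P : TwistedSubgroupoid α, IsSeparableSection P.alg P.section_) ∧
    (∀ A : Mon (GrVec α), (∃ P : TwistedSubgroupoid α, Nonempty (A ≅ P.alg)) ↔
      IsSeparable A ∧ ∀ (X Y : G) (g : X ⟶ Y), Module.finrank ℂ (A.X.deg g) ≤ 1) ∧
    (∀ P Q : TwistedSubgroupoid α, Nonempty (P.alg ≅ Q.alg) ↔ Cohomologous P Q) ∧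
    ∃ (E : ∀ P Q : TwistedSubgroupoid α,
        Bimod P.alg Q.alg ≌ FGModuleCat.{0} (TwistedAlgebra (Tilde.varpi P Q))ᵐᵒᵖ)
      (θ : ∀ (P Q : TwistedSubgroupoid α) (M : Bimod P.alg Q.alg),
        ((E P Q).functor.obj M).obj ≃ₗ[ℂ] M.X.total),
      (∀ (P Q : TwistedSubgroupoid α) (M N : Bimod P.alg Q.alg) (h : M ⟶ N)
        (v : ((E P Q).functor.obj M).obj),
        θ P Q N (((E P Q).functor.map h).hom.hom v) = totalMap h.hom (θ P Q M v)) ∧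
      (∀ (P Q : TwistedSubgroupoid α) (M : Bimod P.alg Q.alg) (g g' : Tilde P Q) (f : g ⟶ g'),
        (∀ v : M.X.deg g.mor,
          θ P Q M (MulOpposite.op (TwistedAlgebra.ket f : TwistedAlgebra (Tilde.varpi P Q)) •
             (θ P Q M).symm (M.X.incl g.mor v)) =
            M.X.incl g'.mor (biactAt M f v)) ∧
        ∀ (X Y : G) (k : X ⟶ Y),
          (⟨X, Y, k⟩ : Σ X Y : G, X ⟶ Y) ≠ ⟨g.src.val, g.tgt.val, g.mor⟩ → ∀ v : M.X.deg k,
            θ P Q M (MulOpposite.op (TwistedAlgebra.ket f : TwistedAlgebra (Tilde.varpi P Q)) •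
             (θ P Q M).symm (M.X.incl k v)) = 0) ∧
      ∀ P Q R : TwistedSubgroupoid α,
        (∀ x y : TwistedAlgebra (Tilde.varpi P R),
          comul P Q R (x * y) = comul P Q R x * comul P Q R y) ∧
        (∃ (F : Bimod P.alg Q.alg × Bimod Q.alg R.alg ⥤ Bimod P.alg R.alg)
          (s : ∀ (M : Bimod P.alg Q.alg) (N : Bimod Q.alg R.alg), M.X ⊗ N.X ⟶ (F.obj (M, N)).X)
          (r : ∀ (M : Bimod P.alg Q.alg) (N : Bimod Q.alg R.alg), (F.obj (M, N)).X ⟶ M.X ⊗ N.X),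
          (∀ M N, IsRelTensor Q.section_ M N (F.obj (M, N)) (s M N) (r M N)) ∧
          ∀ (M M' : Bimod P.alg Q.alg) (N N' : Bimod Q.alg R.alg) (f : M ⟶ M') (g : N ⟶ N'),
            (F.map (Prod.mkHom f g)).hom =
              r M N ≫ (f.hom ⊗ₘ g.hom) ≫ s M' N') ∧
        ∀ (M : Bimod P.alg Q.alg) (N : Bimod Q.alg R.alg) (T : Bimod P.alg R.alg)
          (s : M.X ⊗ N.X ⟶ T.X) (r : T.X ⟶ M.X ⊗ N.X), IsRelTensor Q.section_ M N T s r →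
          Function.Injective (relMap (θ P Q M) (θ Q R N) (θ P R T) r) ∧
          LinearMap.range (relMap (θ P Q M) (θ Q R N) (θ P R T) r) =
            LinearMap.range (rAct₂ (TwistedAlgebra (Tilde.varpi P Q))
              (TwistedAlgebra (Tilde.varpi Q R)) ((E P Q).functor.obj M).obj
              ((E Q R).functor.obj N).obj (comul P Q R 1)) ∧
          ∀ (x : TwistedAlgebra (Tilde.varpi P R)) (t : ((E P R).functor.obj T).obj),
            relMap (θ P Q M) (θ Q R N) (θ P R T) r (MulOpposite.op x • t) =
              rAct₂ (TwistedAlgebra (Tilde.varpi P Q))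
                (TwistedAlgebra (Tilde.varpi Q R)) ((E P Q).functor.obj M).obj
                ((E Q R).functor.obj N).obj (comul P Q R x)
                (relMap (θ P Q M) (θ Q R N) (θ P R T) r t) := by

  -- The identification `toModulesEquiv` is the identity on vectors, so its naturality holds by
  -- `rfl` and the action of kets is that of `rho`.
  refine ⟨fun P => P.isSeparableSection, exists_iso_alg_iff, nonempty_iso_alg_iff,
    bimodEquivalence, toModulesEquiv, fun P Q M N h v => rfl, fun P Q M g g' f => ⟨fun v => ?_,
      fun X Y k hk v => rho_ket_incl_of_ne M f k hk v⟩, fun P Q R => ⟨comul_mul, ?_, ?_⟩⟩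
  · exact (rho_ket_incl M f v).trans (congrArg _ (biactAt_eq M f v).symm)
  -- The degreewise image of the idempotent splits it.
  · exact exists_relTensor_functor Q.asec (fun M N => image (insertSection Q.asec M N))
      (fun M N => toImage (insertSection Q.asec M N))
      (fun M N => ofImage (insertSection Q.asec M N)) (fun _ _ => toImage_ofImage _)
      (fun M N => ofImage_toImage _ (insertSection_asec_idem M N))
  · intro M N T s r h
    exact ⟨IsRelTensor.relMap_injective (toModulesEquiv P Q M) (toModulesEquiv Q R N)
        (toModulesEquiv P R T) h,
      IsRelTensor.range_relMap (toModulesEquiv P Q M) (toModulesEquiv Q R N)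
        (toModulesEquiv P R T) h (toModulesEquiv_smul P Q M) (toModulesEquiv_smul Q R N),
      IsRelTensor.relMap_smul (toModulesEquiv P Q M) (toModulesEquiv Q R N)
        (toModulesEquiv P R T) h (toModulesEquiv_smul P Q M) (toModulesEquiv_smul Q R N)
        (toModulesEquiv_smul P R T)⟩
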